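/- Let $G$ be a finite group, $k\ge 0$ an integer, and let $G$ act on $\mathbb{R}^k$ by orthogonal transformations. Let $G$ act on $\mathbb{C}^k$ by complexification and diagonally on $\mathbb{C}^{2k}=\mathbb{C}^k\oplus\mathbb{C}^k$. Write $$J_n=\begin{pmatrix}0&-\mathrm{Id}_n\\ \mathrm{Id}_n&0\end{pmatrix},\qquad K_n=\begin{pmatrix}0&\mathrm{Id}_n\\ \mathrm{Id}_n&0\end{pmatrix},\qquad (X,Y)=X^tY .$$ Let $\mathbb{G}^{n,2n}$ be the Grassmannian of $n$-dimensional subspaces of $\mathbb{C}^{2n}$, $\mathbb{L}^n\subset\mathbb{G}^{n,2n}$ the Lagrangian Grassmannian of those subspaces that are isotropic for $(X,J_nY)$, $\mathbb{O}^n\subset\mathbb{G}^{n,2n}$ the set of those that are isotropic for $(X,K_nY)$, and $\mathbb{SO}^n$ the connected component of $\mathbb{O}^n$ containing $\mathbb{C}^n\oplus 0$. Let $\hat{\mathbb{L}}^G\subset\mathbb{L}^k$ be the set of $G$-invariant Lagrangian subspaces. Let $\mathrm{Sym}^G(\mathbb{C})$ be the space of complex symmetric $k\times k$ matrices commuting with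 $G$, embedded in $\mathbb{L}^k$ by $Q\mapsto L_Q=\mathrm{span}\{e_i+\sum_j Q_{i,j}e'_j\}_{i}$, where $(e_1,\dots,e_k,e'_1,\dots,e'_k)$ is the canonical basis of $\mathbb{C}^{2k}$, and let $\mathbb{L}^G$ be its closure in $\mathbb{L}^k$. Let $\mathbb{R}^k=V_0\oplus\cdots\oplus V_r$ be a decomposition into subrepresentations, where $V_i$ is isomorphic to the direct sum of $n_i$ copies of a finite-dimensional irreducible real representation $W_i$ and the $W_i$ are pairwise non-isomorphic. One says that $W_i$ is of type 2 if its complexification $W_i^{\mathbb{C}}$ is irreducible. Otherwise $W_i^{\mathbb{C}}=U_i\oplus\overline{U_i}$ with $U_i$ irreducible over $\mathbb{C}$, and $W_i$ is of type 1 if the character of $U_i$ is not real, of type 3 if the character of $U_i$ is real (and $U_i$ is not realizable over $\mathbb{R}$). Then $\mathbb{L}^G$ is an algebraic subvariety of $\mathbb{G}^{k,2k}$; it is the connected component of $\hat{\mathbb{L}}^G$ that contains $\mathbb{C}^k\oplus 0$; and it is isomorphic, as an algebraic variety, to a product $$\mathcal{L}_0\times\cdots\times\mathcal{L}_r,$$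 where each $\mathcal{L}_i$ is a smooth complex variety and - $\mathcal{L}_i=\mathbb{G}^{n_i,2n_i}$, of dimension $n_i^2$, if $W_i$ is of type 1; - $\mathcal{L}_i=\mathbb{L}^{n_i}$, of dimension $n_i(n_i+1)/2$, if $W_i$ is of type 2; - $\mathcal{L}_i=\mathbb{SO}^{2n_i}$, of dimension $2n_i^2-n_i$, if $W_i$ is of type 3. -/

import Mathlib

open scoped TensorProduct Matrix Topology

noncomputable section

namespace GLag

/-! ### Half-dimensional Grassmannians and their frames -/

/-- The Grassmannian `𝔾^{n,2n}` of `n`-dimensional subspaces of `ℂ^{2n} = ℂ^n ⊕ ℂ^n`. -/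
def HalfGr (n : ℕ) : Type :=
  {L : Submodule ℂ (Fin n ⊕ Fin n → ℂ) // Module.finrank ℂ L = n}

/-- A space whose points are described by frames, i.e. by vectors of complex coordinates
(for a Grassmannian: the entries of a matrix whose columns form a basis of the subspace).
It is only used for Grassmannians and for finite products of Grassmannians, see the two instances
below. -/
class HasFrames (X : Type*) where
  /-- the set of indices of the coordinates of a frame -/
  Coord : Type
  /-- there are finitely many coordinates -/
  [fintypeCoord : Fintype Coord]
  /-- `IsFrame A x`: the coordinate vector `A` is a frame of the point `x` -/
  IsFrame : (Coord → ℂ) → X → Prop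

attribute [reducible, instance] HasFrames.fintypeCoord

/-- A frame of `L` in `𝔾^{n,2n}` is a `2n × n` matrix whose `n` columns span `L`
(and hence form a basis of `L`). -/
instance instHasFramesHalfGr (n : ℕ) : HasFrames (HalfGr n) where
  Coord := (Fin n ⊕ Fin n) × Fin n
  IsFrame A L := Submodule.span ℂ (Set.range fun (j : Fin n) (a : Fin n ⊕ Fin n) => A (a, j)) = L.1

/-- A frame of a point of a finite product is a family of frames of its components. -/
instance instHasFramesPi {ι : Type} [Fintype ι] (X : ι → Type*) [∀ i, HasFrames (X i)] :
    HasFrames (∀ i, X i) where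
  Coord := Σ i, HasFrames.Coord (X i)
  IsFrame A x := ∀ i, HasFrames.IsFrame (fun c => A ⟨i, c⟩) (x i)

/-- The pairs (frame, point). As a frame determines its point, this is the set of all frames
(for a Grassmannian: the matrices of maximal rank). -/
abbrev FrameSpace (X : Type*) [HasFrames X] : Type _ :=
  {p : (HasFrames.Coord X → ℂ) × X // HasFrames.IsFrame p.1 p.2}

/-- The usual (analytic) topology: the quotient topology of the space of frames. -/
@[reducible] def analyticTopology (X : Type*) [HasFrames X] : TopologicalSpace X :=
  TopologicalSpace.coinduced (fun p : FrameSpace X => p.1.2)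
    (TopologicalSpace.induced (fun p : FrameSpace X => p.1.1) inferInstance)

/-- The Zariski topology of the affine space `ℂ^σ`. -/
@[reducible] def affineZariski (σ : Type) : TopologicalSpace (σ → ℂ) :=
  TopologicalSpace.induced (MvPolynomial.pointToPoint (k := ℂ) (K := ℂ) (σ := σ)) inferInstance

/-- The Zariski topology: a subset is closed iff the set of its frames is defined, among all
frames, by polynomial equations. -/
@[reducible] def zariskiTopology (X : Type*) [HasFrames X] : TopologicalSpace X :=
  TopologicalSpace.coinduced (fun p : FrameSpace X => p.1.2)
    (TopologicalSpace.induced (fun p : FrameSpace X => p.1.1) (affineZariski _))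

instance instTopologicalSpaceHalfGr (n : ℕ) : TopologicalSpace (HalfGr n) :=
  analyticTopology (HalfGr n)

/-! ### Subvarieties, morphisms and dimension -/

section Varieties

variable {X Y : Type*} [HasFrames X] [HasFrames Y]

/-- The Zariski topology of a subset. -/
@[reducible] def zariskiOn (S : Set X) : TopologicalSpace S :=
  TopologicalSpace.induced Subtype.val (zariskiTopology X)

/-- The function `h` is regular on the subset `V` of the subvariety `S`: locally for the Zariski
topology it is a quotient of two polynomials in the coordinates of a frame. -/
def IsRegularOn (S : Set X) (V : Set S) (h : S → ℂ) : Prop :=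
  ∀ x ∈ V, ∀ A, HasFrames.IsFrame A x.1 →
    ∃ P Q : MvPolynomial (HasFrames.Coord X) ℂ, MvPolynomial.eval A Q ≠ 0 ∧
      ∀ y ∈ V, ∀ B, HasFrames.IsFrame B y.1 → MvPolynomial.eval B Q ≠ 0 →
        h y = MvPolynomial.eval B P / MvPolynomial.eval B Q

/-- Morphisms of subvarieties: the Zariski continuous maps that pull back regular functions on
open subsets to regular functions. -/
structure IsMorphism (S : Set X) (T : Set Y) (f : S → T) : Prop where
  continuous : Continuous[zariskiOn S, zariskiOn T] f
  regular : ∀ V : Set T, IsOpen[zariskiOn T] V → ∀ h : T → ℂ,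
    IsRegularOn T V h → IsRegularOn S (f ⁻¹' V) (h ∘ f)

/-- Isomorphism of algebraic varieties. -/
def AreIsomorphic (S : Set X) (T : Set Y) : Prop :=
  ∃ e : S ≃ T, IsMorphism S T e ∧ IsMorphism T S e.symm

/-- `φ` is a holomorphic map from the subset `U` to `ℂ^d`: near each frame it is the restriction
of a holomorphic map of the coordinates of the frame. -/
def IsHolomorphicOn (U : Set X) {d : ℕ} (φ : X → Fin d → ℂ) : Prop :=
  ∀ x ∈ U, ∀ A, HasFrames.IsFrame A x →
    ∃ (O : Set (HasFrames.Coord X → ℂ)) (Φ : (HasFrames.Coord X → ℂ) → Fin d → ℂ),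
      IsOpen O ∧ A ∈ O ∧ DifferentiableOn ℂ Φ O ∧
        ∀ y ∈ U, ∀ B ∈ O, HasFrames.IsFrame B y → φ y = Φ B

/-- `S` is a complex submanifold of dimension `d` (at each of its points): near each point `x` there
is a parametrization `ψ` of a neighbourhood of `x` in `S` by an open subset `D` of `ℂ^d`, where `ψ`
is holomorphic (it is represented by frames `Ψ u` that depend holomorphically on `u`), and so is
its inverse `φ`. -/
def IsSmoothOfDim (S : Set X) (d : ℕ) : Prop :=
  ∀ x ∈ S, ∃ (Ω : Set X) (D : Set (Fin d → ℂ)) (ψ : (Fin d → ℂ) → X)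
      (Ψ : (Fin d → ℂ) → HasFrames.Coord X → ℂ) (φ : X → Fin d → ℂ),
    IsOpen[analyticTopology X] Ω ∧ x ∈ Ω ∧ IsOpen D ∧
    Set.BijOn ψ D (S ∩ Ω) ∧ Set.InvOn φ ψ D (S ∩ Ω) ∧
    DifferentiableOn ℂ Ψ D ∧ (∀ u ∈ D, HasFrames.IsFrame (Ψ u) (ψ u)) ∧
    IsHolomorphicOn (S ∩ Ω) φ

end Varieties

/-! ### Lagrangian and orthogonal Grassmannians -/

/-- The Lagrangian Grassmannian `𝕃^n`: the `n`-dimensional subspaces of `ℂ^{2n}` that are isotropic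
for the symplectic form `ω(X, Y) = (X, J_n Y)`, where `J_n` has the blocks `0, -1, 1, 0`. -/
def lagrangianGr (n : ℕ) : Set (HalfGr n) :=
  {L | ∀ x ∈ L.1, ∀ y ∈ L.1, x ⬝ᵥ (Matrix.J (Fin n) ℂ *ᵥ y) = 0}

/-- The matrix `K_n` with the blocks `0, 1, 1, 0`. -/
def matK (n : ℕ) : Matrix (Fin n ⊕ Fin n) (Fin n ⊕ Fin n) ℂ := Matrix.fromBlocks 0 1 1 0

/-- `𝕆^n`: the `n`-dimensional subspaces of `ℂ^{2n}` that are isotropic for the symmetric bilinear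
form `(X, K_n Y)`. -/
def orthogonalGr (n : ℕ) : Set (HalfGr n) :=
  {L | ∀ x ∈ L.1, ∀ y ∈ L.1, x ⬝ᵥ (matK n *ᵥ y) = 0}

lemma linearIndependent_graph {n : ℕ} (Q : Matrix (Fin n) (Fin n) ℂ) :
    LinearIndependent ℂ
      (fun i : Fin n => (Sum.elim (Pi.single i 1) (Q i) : Fin n ⊕ Fin n → ℂ)) := by
  rw [Fintype.linearIndependent_iff]
  intro c hc i
  have h := congrFun hc (Sum.inl i)
  simpa [Finset.sum_apply, Pi.single_apply] using h

/-- The subspace `L_Q = span {e_i + ∑ j, Q i j • e'_j}` of `ℂ^{2n}`. -/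
def graphOf {n : ℕ} (Q : Matrix (Fin n) (Fin n) ℂ) : HalfGr n :=
  ⟨Submodule.span ℂ (Set.range fun i : Fin n =>
      (Sum.elim (Pi.single i 1) (Q i) : Fin n ⊕ Fin n → ℂ)), by
    rw [finrank_span_eq_card (linearIndependent_graph Q), Fintype.card_fin]⟩

/-- The linear map `ℂ^n → ℂ^{2n}`, `x ↦ (x, 0)`. -/
def inclFirst (n : ℕ) : (Fin n → ℂ) →ₗ[ℂ] (Fin n ⊕ Fin n → ℂ) where
  toFun x := Sum.elim x 0
  map_add' x y := by ext (a | a) <;> simp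
  map_smul' c x := by ext (a | a) <;> simp

/-- The subspace `ℂ^n ⊕ 0` of `ℂ^{2n}`. -/
def firstSummand (n : ℕ) : HalfGr n :=
  ⟨LinearMap.range (inclFirst n), by
    rw [LinearMap.finrank_range_of_inj, Module.finrank_fin_fun]
    intro x y h
    funext i
    exact congrFun h (Sum.inl i)⟩

/-- `𝕊𝕆^n`: the connected component of `𝕆^n` that contains `ℂ^n ⊕ 0`. -/
def specialOrthogonalGr (n : ℕ) : Set (HalfGr n) :=
  connectedComponentIn (orthogonalGr n) (firstSummand n)

/-! ### `G`-invariant Lagrangian subspaces -/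

section Invariant

variable {G : Type*} [Group G] {k : ℕ} (ρ : G →* Matrix.orthogonalGroup (Fin k) ℝ)

/-- The real representation `ℝ^k` of `G`. -/
def realRep : Representation ℝ G (Fin k → ℝ) where
  toFun g := Matrix.toLin' (ρ g : Matrix (Fin k) (Fin k) ℝ)
  map_one' := by simp [Module.End.one_eq_id]
  map_mul' g h := by simp [Module.End.mul_eq_comp, Matrix.toLin'_mul]

/-- The matrix of `g` acting on `ℂ^k`. -/
def complexMat (g : G) : Matrix (Fin k) (Fin k) ℂ :=
  (ρ g : Matrix (Fin k) (Fin k) ℝ).map Complex.ofReal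

/-- The variety of all `G`-invariant Lagrangian subspaces of `ℂ^{2k}`, for the diagonal action
of `G` on `ℂ^{2k} = ℂ^k ⊕ ℂ^k`. -/
def invariantLagrangians : Set (HalfGr k) :=
  {L | L ∈ lagrangianGr k ∧ ∀ g : G, ∀ x ∈ L.1,
    Matrix.fromBlocks (complexMat ρ g) 0 0 (complexMat ρ g) *ᵥ x ∈ L.1}

/-- `Sym^G(ℂ)`: the complex symmetric `k × k` matrices that commute with `G`. -/
def invariantSym : Set (Matrix (Fin k) (Fin k) ℂ) :=
  {Q | Q.IsSymm ∧ ∀ g : G, complexMat ρ g * Q = Q * complexMat ρ g}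

/-- `𝕃^G`: the closure in `𝕃^k` of `Sym^G(ℂ)`, where `Q` is identified with `L_Q`. -/
def closureSym : Set (HalfGr k) :=
  lagrangianGr k ∩ closure (graphOf '' invariantSym ρ)

end Invariant

/-! ### The type of a real irreducible representation -/

section Types

variable {G : Type*} [Group G] {W : Type*} [AddCommGroup W] [Module ℝ W]

/-- The complexification of a real representation. -/
def complexify (σ : Representation ℝ G W) : Representation ℂ G (ℂ ⊗[ℝ] W) where
  toFun g := (σ g).baseChange ℂ
  map_one' := by simp [Module.End.one_eq_id]
  map_mul' g h := by simp [Module.End.mul_eq_comp, LinearMap.baseChange_comp]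

/-- The complex conjugation `z ⊗ w ↦ conj z ⊗ w` of the complexification. -/
def conjMap (W : Type*) [AddCommGroup W] [Module ℝ W] :
    (ℂ ⊗[ℝ] W) →ₛₗ[starRingEnd ℂ] (ℂ ⊗[ℝ] W) where
  toFun := LinearMap.rTensor W Complex.conjAe.toLinearMap
  map_add' x y := map_add _ x y
  map_smul' c x := by
    induction x using TensorProduct.induction_on with
    | zero => simp
    | tmul z w => simp [TensorProduct.smul_tmul']
    | add x y hx hy => rw [smul_add, map_add, map_add, smul_add, hx, hy]

/-- All values of the character are real. -/
def HasRealCharacter {V : Type*} [AddCommGroup V] [Module ℂ V] (τ : Representation ℂ G V) : Prop :=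
  ∀ g : G, (τ.character g).im = 0

/-- `τ` is isomorphic to the complexification of a (finite-dimensional) real representation. -/
def IsRealizableOverReal {V : Type*} [AddCommGroup V] [Module ℂ V]
    (τ : Representation ℂ G V) : Prop :=
  ∃ (m : ℕ) (σ : Representation ℝ G (Fin m → ℝ)), Nonempty ((complexify σ).Equiv τ)

/-- The three types of real irreducible representations. -/
inductive RepType
  | one
  | two
  | three

/-- The type of a real irreducible representation `W`. Type 2: the complexification of `W` is
irreducible. Type 1 (resp. 3): the complexification is `U ⊕ conj U` with `U` irreducible, where the
character of `U` is not real (resp. is real, but `U` is not realizable over `ℝ`). -/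
def HasType (σ : Representation ℝ G W) : RepType → Prop
  | .one => ∃ U : Subrepresentation (complexify σ), U.toRepresentation.IsIrreducible ∧
      IsCompl U.toSubmodule (U.toSubmodule.map (conjMap W)) ∧
      ¬ HasRealCharacter U.toRepresentation
  | .two => (complexify σ).IsIrreducible
  | .three => ∃ U : Subrepresentation (complexify σ), U.toRepresentation.IsIrreducible ∧
      IsCompl U.toSubmodule (U.toSubmodule.map (conjMap W)) ∧
      HasRealCharacter U.toRepresentation ∧ ¬ IsRealizableOverReal U.toRepresentation

/-- The integer `m` such that the factor for multiplicity `n` lies in `𝔾^{m,2m}`. -/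
def RepType.half : RepType → ℕ → ℕ
  | .one, n => n
  | .two, n => n
  | .three, n => 2 * n

/-- The factor `𝔾^{n,2n}`, `𝕃^n` or `𝕊𝕆^{2n}`. -/
def RepType.factor : (t : RepType) → (n : ℕ) → Set (HalfGr (t.half n))
  | .one, _ => Set.univ
  | .two, n => lagrangianGr n
  | .three, n => specialOrthogonalGr (2 * n)

/-- The dimension of the factor. -/
def RepType.dim : RepType → ℕ → ℕ
  | .one, n => n ^ 2
  | .two, n => n * (n + 1) / 2
  | .three, n => 2 * n ^ 2 - n

/-- The real representation `π` is the direct sum of subrepresentations `V i`, each isomorphic to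
the direct sum of `n i` copies of the irreducible representation `σ i`, and the `σ i` are pairwise
not isomorphic. -/
structure IsIsotypicDecomposition {E : Type*} [AddCommGroup E] [Module ℝ E]
    (π : Representation ℝ G E) {r : ℕ} {W : Fin (r + 1) → Type*} [∀ i, AddCommGroup (W i)]
    [∀ i, Module ℝ (W i)] (σ : ∀ i, Representation ℝ G (W i)) (n : Fin (r + 1) → ℕ)
    (V : Fin (r + 1) → Subrepresentation π) : Prop where
  isInternal : DirectSum.IsInternal fun i => (V i).toSubmodule
  irreducible : ∀ i, (σ i).IsIrreducible
  not_iso : ∀ i j, i ≠ j → IsEmpty ((σ i).Equiv (σ j))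
  component : ∀ i, Nonempty
    ((V i).toRepresentation.Equiv (Representation.directSum fun _ : Fin (n i) => σ i))

end Types

end GLag

end

open GLag

noncomputable section

namespace GLag

/-! ### Spaces with well-behaved frames -/

open HasFrames MvPolynomial

/-! An invariant Lagrangian subspace is a half-dimensional subspace isotropic for all the bilinear
forms `(x, J g y)` with `g` in `G`, so the geometry takes place in a set `isoGr Γ`. For each family
`Γ` used here (the forms `J g`, the form `J`, the form `K`, or no form), the Hermitian complement of
an isotropic subspace is again isotropic: when a form is imposed, it is `J` or `K` applied to the
complex conjugate. Hence every isotropic `L` has a chart, the subspaces transverse to `orth L`, in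
which the isotropic ones form a linear space of matrices (`mem_isoGr_iff_mem_chartSpace`).

The graphs are one such chart, and inside another chart they are the non-vanishing locus of a
determinant. A chart that contains one graph therefore lies in the closure of the graphs. So this
closure is open and closed in `isoGr Γ`, even for the Zariski topology, and connected, because the
graphs are: it is the component of `ℂ^k ⊕ 0` (`closure_graphs_eq_connectedComponentIn`). The same
charts give smoothness of the factors, with symmetric, antisymmetric or arbitrary matrices as
tangent spaces (`finrank_chartSpace`).

For the product, `ℂ^k` is a sum of spaces `U_a ⊗ ℂ^{m_a}` over complex irreducible constituents, and
by Schur orthogonality the matrix units of `U_a` lie in the span of the group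
(`SplitReps.f_mul_e_mem`). An invariant `L` is thus determined by its multiplicity spaces in `ℂ^{2
m_a}`. On the closure of the graphs these have dimension exactly `m_a` (`SplitData.finrank_piece`).
Invariant bilinear forms on the constituents are unique up to a scalar, so the symplectic form
factors. In type 1 it pairs `U` with its conjugate: one multiplicity space is arbitrary and the
other is its complement. In type 2 the form on `U` is symmetric and the multiplicity spaces are
Lagrangian. In type 3 the form on `U` is antisymmetric, since a symmetric one would produce a real
structure, and `J` becomes `K`.

Both maps between `L` and its multiplicity spaces are polynomial on frames, hence morphisms.
Connectedness of the source of each map, with base points in correspondence, keeps its image in the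
right component. -/

/-- Every point has a frame, a frame determines its point, and two frames of a point differ by a
polynomial change of coordinates that maps frames to frames of the same point. -/
class GoodFrames (X : Type*) [HasFrames X] : Prop where
  exists_frame : ∀ x : X, ∃ A, IsFrame A x
  eq_of_isFrame : ∀ {x y : X} {A}, IsFrame A x → IsFrame A y → x = y
  change : ∀ (x : X) {A B}, IsFrame A x → IsFrame B x →
    ∃ τ : Coord X → MvPolynomial (Coord X) ℂ, (fun c => eval A (τ c)) = B ∧
      ∀ (y : X) {C}, IsFrame C y → IsFrame (fun c => eval C (τ c)) y

lemma eval_bind₁_apply {σ κ : Type} (A : σ → ℂ) (F : κ → MvPolynomial σ ℂ)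
    (p : MvPolynomial κ ℂ) : eval A (bind₁ F p) = eval (fun c => eval A (F c)) p := by
  exact eval₂Hom_bind₁ (RingHom.id ℂ) A F p

/-- Basic opens form a basis of the prime spectrum, and a closed point lies in the basic open of `R`
exactly when `R` does not vanish there; this removes the spectrum from all later arguments. -/
lemma isOpen_affineZariski_iff {σ : Type} {U : Set (σ → ℂ)} :
    IsOpen[affineZariski σ] U ↔
      ∀ x ∈ U, ∃ R : MvPolynomial σ ℂ, eval x R ≠ 0 ∧ ∀ y, eval y R ≠ 0 → y ∈ U := by
  have key : ∀ (R : MvPolynomial σ ℂ) (x : σ → ℂ),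
      pointToPoint (k := ℂ) x ∈ PrimeSpectrum.basicOpen R ↔ eval x R ≠ 0 := by
    intro R x
    rw [PrimeSpectrum.mem_basicOpen]
    simp [pointToPoint, aeval_eq_eval]
  constructor
  · rintro ⟨V, hV, rfl⟩ x hx
    obtain ⟨_, ⟨R, rfl⟩, h1, h2⟩ :=
      PrimeSpectrum.isTopologicalBasis_basic_opens.exists_subset_of_mem_open hx hV
    exact ⟨R, (key R x).1 h1, fun y hy => h2 ((key R y).2 hy)⟩
  · intro h
    choose! R h1 h2 using h
    refine ⟨⋃ x ∈ U, PrimeSpectrum.basicOpen (R x),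
      isOpen_biUnion fun x _ => PrimeSpectrum.isOpen_basicOpen, ?_⟩
    ext y
    simp only [Set.mem_preimage, Set.mem_iUnion, SetLike.mem_coe]
    constructor
    · rintro ⟨x, hx, hy⟩
      exact h2 x hx y ((key _ _).1 hy)
    · intro hy
      exact ⟨y, hy, (key _ _).2 (h1 y hy)⟩

/-! ### Open sets described through frames -/

section

variable {X Y Z : Type*} [HasFrames X] [HasFrames Y] [HasFrames Z]

lemma isOpen_zariski_iff {U : Set X} :
    IsOpen[zariskiTopology X] U ↔ ∀ x ∈ U, ∀ A, IsFrame A x →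
      ∃ R, eval A R ≠ 0 ∧ ∀ y B, IsFrame B y → eval B R ≠ 0 → y ∈ U := by
  rw [zariskiTopology, isOpen_coinduced, @isOpen_induced_iff _ _ (affineZariski _)]
  constructor
  · rintro ⟨V, hV, h⟩ x hx A hA
    rw [isOpen_affineZariski_iff] at hV
    have hm : ∀ p : FrameSpace X, p.1.1 ∈ V ↔ p.1.2 ∈ U := fun p => Set.ext_iff.1 h p
    obtain ⟨R, h1, h2⟩ := hV A ((hm ⟨(A, x), hA⟩).2 hx)
    exact ⟨R, h1, fun y B hB hR => (hm ⟨(B, y), hB⟩).1 (h2 B hR)⟩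
  · intro h
    -- The open set of coordinate vectors is the largest possible one: the union of all
    -- non-vanishing loci whose frames lie over `U`. It may also contain vectors that are not
    -- frames.
    refine ⟨{A | ∃ R, eval A R ≠ 0 ∧ ∀ y B, IsFrame B y → eval B R ≠ 0 → y ∈ U}, ?_, ?_⟩
    · rw [isOpen_affineZariski_iff]
      rintro A ⟨R, h1, h2⟩
      exact ⟨R, h1, fun B hB => ⟨R, hB, h2⟩⟩
    · ext ⟨⟨A, x⟩, hA⟩
      constructor
      · rintro ⟨R, h1, h2⟩
        exact h2 x A hA h1
      · intro hx
        exact h x hx A hA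

lemma isOpen_analytic_iff {U : Set X} :
    IsOpen[analyticTopology X] U ↔ ∀ x ∈ U, ∀ A, IsFrame A x →
      ∃ O : Set (Coord X → ℂ), IsOpen O ∧ A ∈ O ∧ ∀ y B, IsFrame B y → B ∈ O → y ∈ U := by
  rw [analyticTopology, isOpen_coinduced, isOpen_induced_iff]
  constructor
  · rintro ⟨V, hV, h⟩ x hx A hA
    have hm : ∀ p : FrameSpace X, p.1.1 ∈ V ↔ p.1.2 ∈ U := fun p => Set.ext_iff.1 h p
    exact ⟨V, hV, (hm ⟨(A, x), hA⟩).2 hx, fun y B hB hR => (hm ⟨(B, y), hB⟩).1 hR⟩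
  · intro h
    refine ⟨⋃₀ {O | IsOpen O ∧ ∀ y B, IsFrame B y → B ∈ O → y ∈ U},
      isOpen_sUnion fun O hO => hO.1, ?_⟩
    ext ⟨⟨A, x⟩, hA⟩
    constructor
    · rintro ⟨O, ⟨-, h2⟩, h1⟩
      exact h2 x A hA h1
    · intro hx
      obtain ⟨O, h1, h2, h3⟩ := h x hx A hA
      exact ⟨O, ⟨h1, h3⟩, h2⟩

/-- One good frame per point suffices: from any other frame `A`, the polynomial change of frame
carries `A` to the good one, and pulling `R` back along it gives a polynomial that works near `A`.
-/
lemma isOpen_zariski_image [GoodFrames X] (R : MvPolynomial (Coord X) ℂ) :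
    IsOpen[zariskiTopology X] {y : X | ∃ B, IsFrame B y ∧ eval B R ≠ 0} := by
  rw [isOpen_zariski_iff]
  rintro x ⟨B, hB, hR⟩ A hA
  obtain ⟨τ, h1, h2⟩ := GoodFrames.change x hA hB
  refine ⟨bind₁ τ R, ?_, fun y C hC hCR => ⟨_, h2 y hC, ?_⟩⟩
  · rwa [eval_bind₁_apply, h1]
  · rwa [eval_bind₁_apply] at hCR

lemma continuous_evalMap {σ κ : Type} (F : κ → MvPolynomial σ ℂ) :
    Continuous fun A : σ → ℂ => fun c => eval A (F c) :=
  continuous_pi fun c => (F c).continuous_eval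

lemma isOpen_analytic_image [GoodFrames X] {O : Set (Coord X → ℂ)} (hO : IsOpen O) :
    IsOpen[analyticTopology X] {y : X | ∃ B, IsFrame B y ∧ B ∈ O} := by
  rw [isOpen_analytic_iff]
  rintro x ⟨B, hB, hR⟩ A hA
  obtain ⟨τ, h1, h2⟩ := GoodFrames.change x hA hB
  refine ⟨(fun A => fun c => eval A (τ c)) ⁻¹' O, hO.preimage (continuous_evalMap τ), ?_,
    fun y C hC hCR => ⟨_, h2 y hC, hCR⟩⟩
  simpa only [Set.mem_preimage, h1] using hR

lemma isOpen_analytic_of_zariski {U : Set X} (hU : IsOpen[zariskiTopology X] U) :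
    IsOpen[analyticTopology X] U := by
  rw [isOpen_zariski_iff] at hU
  rw [isOpen_analytic_iff]
  intro x hx A hA
  obtain ⟨R, h1, h2⟩ := hU x hx A hA
  exact ⟨{B | eval B R ≠ 0}, isOpen_ne_fun R.continuous_eval continuous_const, h1, h2⟩

/-- A map given on frames is continuous for the analytic topology. -/
lemma continuous_of_frame {T : Type*} [TopologicalSpace T] (γ : T → X) (Γ : T → Coord X → ℂ)
    (hΓ : Continuous Γ) (h : ∀ t, IsFrame (Γ t) (γ t)) :
    Continuous[_, analyticTopology X] γ := by
  rw [continuous_def]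
  intro U hU
  rw [isOpen_analytic_iff] at hU
  rw [isOpen_iff_mem_nhds]
  intro t ht
  obtain ⟨O, h1, h2, h3⟩ := hU _ ht _ (h t)
  exact Filter.mem_of_superset ((h1.preimage hΓ).mem_nhds h2) fun s hs => h3 _ _ (h s) hs

/-! ### Maps that are polynomial on frames -/

/-- Near each frame, the map is given by polynomials in the coordinates of the frames. -/
def IsFrameMapOn (S : Set X) (f : X → Y) : Prop :=
  ∀ x ∈ S, ∀ A, IsFrame A x →
    ∃ (Q : MvPolynomial (Coord X) ℂ) (F : Coord Y → MvPolynomial (Coord X) ℂ), eval A Q ≠ 0 ∧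
      ∀ y ∈ S, ∀ B, IsFrame B y → eval B Q ≠ 0 → IsFrame (fun c => eval B (F c)) (f y)

lemma IsFrameMapOn.comp {S : Set X} {T : Set Y} {f : X → Y} {g : Y → Z} (hg : IsFrameMapOn T g)
    (hf : IsFrameMapOn S f) (hST : Set.MapsTo f S T) : IsFrameMapOn S (g ∘ f) := by
  intro x hx A hA
  obtain ⟨Q, F, h1, h2⟩ := hf x hx A hA
  obtain ⟨Q', F', h1', h2'⟩ := hg (f x) (hST hx) _ (h2 x hx A hA h1)
  refine ⟨Q * bind₁ F Q', fun c => bind₁ F (F' c), ?_, ?_⟩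
  · rw [map_mul, eval_bind₁_apply]
    exact mul_ne_zero h1 h1'
  · intro y hy B hB hQ
    rw [map_mul, eval_bind₁_apply] at hQ
    have := h2' (f y) (hST hy) _ (h2 y hy B hB (left_ne_zero_of_mul hQ)) (right_ne_zero_of_mul hQ)
    simpa only [eval_bind₁_apply, Function.comp_apply] using this

theorem IsFrameMapOn.isMorphism [GoodFrames X] {S : Set X} {T : Set Y} {f : X → Y}
    (hf : IsFrameMapOn S f) (hST : Set.MapsTo f S T) :
    IsMorphism S T (hST.restrict f S T) where
  continuous := by
    rw [continuous_def]
    rintro _ ⟨V, hV, rfl⟩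
    rw [isOpen_zariski_iff] at hV
    -- The preimage of `V` in `S` must be induced by an open subset of `X`, on which `f` need not be
    -- polynomial; the union over all `R` whose non-vanishing locus meets `S` inside the preimage
    -- provides one.
    let I := {R : MvPolynomial (Coord X) ℂ //
      ∀ y ∈ S, ∀ B, IsFrame B y → eval B R ≠ 0 → f y ∈ V}
    refine ⟨⋃ R : I, {y : X | ∃ B, IsFrame B y ∧ eval B R.1 ≠ 0}, ?_, ?_⟩
    · exact @isOpen_iUnion _ _ (zariskiTopology X) _ fun R => isOpen_zariski_image R.1
    · ext ⟨x, hx⟩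
      simp only [Set.mem_preimage, Set.mem_iUnion]
      constructor
      · rintro ⟨R, B, hB, hR⟩
        exact R.2 x hx B hB hR
      · intro hxV
        change f x ∈ V at hxV
        obtain ⟨A, hA⟩ := GoodFrames.exists_frame x
        obtain ⟨Q, F, h1, h2⟩ := hf x hx A hA
        obtain ⟨R, h3, h4⟩ := hV _ hxV _ (h2 x hx A hA h1)
        refine ⟨⟨Q * bind₁ F R, ?_⟩, A, hA, ?_⟩
        · intro y hy B hB hQ
          rw [map_mul, eval_bind₁_apply] at hQ
          exact h4 _ _ (h2 y hy B hB (left_ne_zero_of_mul hQ)) (right_ne_zero_of_mul hQ)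
        · rw [map_mul, eval_bind₁_apply]
          exact mul_ne_zero h1 h3
  regular := by
    intro V _ h hh x hx A hA
    obtain ⟨Q, F, h1, h2⟩ := hf x.1 x.2 A hA
    obtain ⟨P', Q', h3, h4⟩ := hh _ hx _ (h2 x.1 x.2 A hA h1)
    -- The common factor `Q` cancels in the quotient; in the denominator it restricts to the frames
    -- for which `F` is valid.
    refine ⟨Q * bind₁ F P', Q * bind₁ F Q', ?_, ?_⟩
    · rw [map_mul, eval_bind₁_apply]
      exact mul_ne_zero h1 h3
    · intro y hy B hB hQ
      simp only [map_mul, eval_bind₁_apply] at hQ ⊢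
      rw [mul_div_mul_left _ _ (left_ne_zero_of_mul hQ)]
      exact h4 _ hy _ (h2 y.1 y.2 B hB (left_ne_zero_of_mul hQ)) (right_ne_zero_of_mul hQ)

theorem IsFrameMapOn.continuousOn [GoodFrames X] {S : Set X} {f : X → Y}
    (hf : IsFrameMapOn S f) :
    @ContinuousOn X Y (analyticTopology X) (analyticTopology Y) f S := by
  let _ := analyticTopology X
  let _ := analyticTopology Y
  rw [continuousOn_iff']
  intro V hV
  rw [isOpen_analytic_iff] at hV
  let I := {O : Set (Coord X → ℂ) // IsOpen O ∧ ∀ y ∈ S, ∀ B, IsFrame B y → B ∈ O → f y ∈ V}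
  refine ⟨⋃ O : I, {y : X | ∃ B, IsFrame B y ∧ B ∈ O.1},
    isOpen_iUnion fun O => isOpen_analytic_image O.2.1, ?_⟩
  ext x
  simp only [Set.mem_inter_iff, Set.mem_preimage, Set.mem_iUnion]
  refine and_congr_left fun hx => ⟨fun hxV => ?_, ?_⟩
  · obtain ⟨A, hA⟩ := GoodFrames.exists_frame x
    obtain ⟨Q, F, h1, h2⟩ := hf x hx A hA
    obtain ⟨O, h3, h4, h5⟩ := hV _ hxV _ (h2 x hx A hA h1)
    refine ⟨⟨{B | eval B Q ≠ 0} ∩ (fun A => fun c => eval A (F c)) ⁻¹' O, ?_, ?_⟩, A, hA, h1, h4⟩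
    · exact (isOpen_ne_fun Q.continuous_eval continuous_const).inter
        (h3.preimage (continuous_evalMap F))
    · rintro y hy B hB ⟨hQ, hO⟩
      exact h5 _ _ (h2 y hy B hB hQ) hO
  · rintro ⟨O, B, hB, hO⟩
    exact O.2.2 x hx B hB hO

end

/-! ### Finite products -/

section Pi

variable {ι : Type} [Fintype ι] {X : ι → Type*} [∀ i, HasFrames (X i)]
variable {Y : Type*} [HasFrames Y]

instance instGoodFramesPi [∀ i, GoodFrames (X i)] : GoodFrames (∀ i, X i) where
  exists_frame x := by
    choose A hA using fun i => GoodFrames.exists_frame (x i)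
    exact ⟨fun c => A c.1 c.2, hA⟩
  eq_of_isFrame h1 h2 := funext fun i => GoodFrames.eq_of_isFrame (h1 i) (h2 i)
  change x A B hA hB := by
    choose τ h1 h2 using fun i => GoodFrames.change (x i) (hA i) (hB i)
    refine ⟨fun c => rename (Sigma.mk c.1) (τ c.1 c.2), ?_, fun y C hC i => ?_⟩
    · ext ⟨i, c⟩
      rw [eval_rename]
      exact congrFun (h1 i) c
    · have := h2 i (y i) (hC i)
      simp only [eval_rename]
      exact this

lemma isFrameMapOn_apply (i : ι) (S : Set (∀ i, X i)) :
    IsFrameMapOn S (fun x : ∀ i, X i => x i) := by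
  intro x _ A _
  refine ⟨1, fun c => MvPolynomial.X ⟨i, c⟩, by simp, fun y _ B hB _ => ?_⟩
  simpa only [eval_X] using hB i

lemma isFrameMapOn_pi {S : Set Y} {f : Y → ∀ i, X i}
    (hf : ∀ i, IsFrameMapOn S (fun y => f y i)) : IsFrameMapOn S f := by
  intro x hx A hA
  choose Q F h1 h2 using fun i => hf i x hx A hA
  refine ⟨∏ i, Q i, fun c => F c.1 c.2, ?_, fun y hy B hB hQ i => ?_⟩
  · rw [map_prod]
    exact Finset.prod_ne_zero_iff.2 fun i _ => h1 i
  · rw [map_prod, Finset.prod_ne_zero_iff] at hQ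
    exact h2 i y hy B hB (hQ i (Finset.mem_univ i))

/-- Connectedness of a product of sets is available for the product topology, while maps are
controlled through frames of the product. Only this comparison of the two topologies is needed; it
holds because a neighbourhood of a family of frames contains a box of coordinates. -/
lemma isOpen_pi_of_isOpen_analytic [∀ i, GoodFrames (X i)] {U : Set (∀ i, X i)}
    (hU : IsOpen[analyticTopology (∀ i, X i)] U) :
    IsOpen[@Pi.topologicalSpace ι X fun i => analyticTopology (X i)] U := by
  let _ := fun i => analyticTopology (X i)
  rw [isOpen_analytic_iff] at hU
  rw [isOpen_pi_iff']
  intro x hx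
  obtain ⟨A, hA⟩ := GoodFrames.exists_frame x
  obtain ⟨O, h1, h2, h3⟩ := hU x hx A hA
  rw [isOpen_pi_iff'] at h1
  obtain ⟨u, hu1, hu2⟩ := h1 A h2
  refine ⟨fun i => {y | ∃ B, IsFrame B y ∧ B ∈ Set.univ.pi fun c => u ⟨i, c⟩}, fun i => ⟨?_, ?_⟩, ?_⟩
  · exact isOpen_analytic_image (isOpen_set_pi Set.finite_univ fun c _ => (hu1 ⟨i, c⟩).1)
  · exact ⟨_, hA i, fun c _ => (hu1 ⟨i, c⟩).2⟩
  · intro y hy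
    choose B hB1 hB2 using fun i => hy i (Set.mem_univ i)
    exact h3 y (fun c => B c.1 c.2) hB1 (hu2 fun c _ => hB2 c.1 c.2 (Set.mem_univ _))

theorem IsFrameMapOn.continuousOn_pi [∀ i, GoodFrames (X i)] {S : Set (∀ i, X i)}
    {f : (∀ i, X i) → Y} (hf : IsFrameMapOn S f) :
    @ContinuousOn _ _ (@Pi.topologicalSpace ι X fun i => analyticTopology (X i))
      (analyticTopology Y) f S := by
  let _ := fun i => analyticTopology (X i)
  let _ := analyticTopology Y
  have h := hf.continuousOn
  rw [@continuousOn_iff' _ _ (analyticTopology (∀ i, X i))] at h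
  rw [continuousOn_iff']
  intro V hV
  obtain ⟨U, hU, hU'⟩ := h V hV
  exact ⟨U, isOpen_pi_of_isOpen_analytic hU, hU'⟩

end Pi

/-! ### Frames of points of the Grassmannian as matrices -/

open HasFrames

section Spans

variable {n : ℕ}

/-- The columns of the matrix `M` span `L`. -/
def Spans (M : Matrix (Fin n ⊕ Fin n) (Fin n) ℂ) (L : HalfGr n) : Prop :=
  LinearMap.range M.mulVecLin = L.1

lemma isFrame_iff {A : (Fin n ⊕ Fin n) × Fin n → ℂ} {L : HalfGr n} :
    IsFrame (X := HalfGr n) A L ↔ Spans (Matrix.of fun a j => A (a, j)) L := by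
  rw [Spans, Matrix.range_mulVecLin]
  exact Iff.rfl

lemma Spans.isFrame {M : Matrix (Fin n ⊕ Fin n) (Fin n) ℂ} {L : HalfGr n} (h : Spans M L) :
    IsFrame (X := HalfGr n) (fun c : (Fin n ⊕ Fin n) × Fin n => M c.1 c.2) L :=
  isFrame_iff.2 h

lemma Spans.mem_iff {M : Matrix (Fin n ⊕ Fin n) (Fin n) ℂ} {L : HalfGr n} (h : Spans M L)
    {x : Fin n ⊕ Fin n → ℂ} : x ∈ L.1 ↔ ∃ v, M *ᵥ v = x := by
  rw [← h]
  rfl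

lemma Spans.mulVec_mem {M : Matrix (Fin n ⊕ Fin n) (Fin n) ℂ} {L : HalfGr n} (h : Spans M L)
    (v : Fin n → ℂ) : M *ᵥ v ∈ L.1 := h.mem_iff.2 ⟨v, rfl⟩

lemma Spans.injective {M : Matrix (Fin n ⊕ Fin n) (Fin n) ℂ} {L : HalfGr n} (h : Spans M L) :
    Function.Injective M.mulVec := by
  have h1 : Function.Injective M.mulVecLin := by
    rw [← LinearMap.ker_eq_bot, ← Submodule.finrank_eq_zero]
    have := M.mulVecLin.finrank_range_add_finrank_ker
    rw [h, L.2] at this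
    simpa using this
  exact h1

lemma Spans.eq_zero {M : Matrix (Fin n ⊕ Fin n) (Fin n) ℂ} {L : HalfGr n} (h : Spans M L)
    {v : Fin n → ℂ} (hv : M *ᵥ v = 0) : v = 0 :=
  h.injective (by rw [hv, Matrix.mulVec_zero])

lemma exists_spans (L : HalfGr n) : ∃ M, Spans M L := by
  let b := Module.finBasisOfFinrankEq ℂ L.1 L.2
  refine ⟨Matrix.of fun a j => (b j : Fin n ⊕ Fin n → ℂ) a, ?_⟩
  rw [Spans, Matrix.range_mulVecLin]
  have : (Matrix.of fun a j => (b j : Fin n ⊕ Fin n → ℂ) a).col = L.1.subtype ∘ b := rfl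
  rw [this, Set.range_comp, ← Submodule.map_span, b.span_eq, Submodule.map_top,
    Submodule.range_subtype]

/-- The point spanned by the columns of a matrix of maximal rank. -/
def ofInj (M : Matrix (Fin n ⊕ Fin n) (Fin n) ℂ) (h : Function.Injective M.mulVec) : HalfGr n :=
  ⟨LinearMap.range M.mulVecLin, by
    rw [LinearMap.finrank_range_of_inj (f := M.mulVecLin) h, Module.finrank_fin_fun]⟩

lemma spans_ofInj (M : Matrix (Fin n ⊕ Fin n) (Fin n) ℂ) (h : Function.Injective M.mulVec) :
    Spans M (ofInj M h) := rfl

lemma Spans.unique {M : Matrix (Fin n ⊕ Fin n) (Fin n) ℂ} {L L' : HalfGr n} (h : Spans M L)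
    (h' : Spans M L') : L = L' := Subtype.ext (h.symm.trans h')

lemma spans_of_injective {M : Matrix (Fin n ⊕ Fin n) (Fin n) ℂ} {L : HalfGr n}
    (h : Function.Injective M.mulVec) (hm : ∀ v, M *ᵥ v ∈ L.1) : Spans M L := by
  refine Submodule.eq_of_le_of_finrank_eq ?_ ?_
  · rintro _ ⟨v, rfl⟩
    exact hm v
  · rw [LinearMap.finrank_range_of_inj (f := M.mulVecLin) h, Module.finrank_fin_fun, L.2]

lemma Spans.mul_right {M : Matrix (Fin n ⊕ Fin n) (Fin n) ℂ} {L : HalfGr n} (h : Spans M L)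
    {g : Matrix (Fin n) (Fin n) ℂ} (hg : IsUnit g.det) : Spans (M * g) L := by
  refine spans_of_injective ?_ fun v => ?_
  · intro v w hvw
    simp only [← Matrix.mulVec_mulVec] at hvw
    exact Matrix.mulVec_injective_iff_isUnit.2 ((Matrix.isUnit_iff_isUnit_det g).2 hg)
      (h.injective hvw)
  · rw [← Matrix.mulVec_mulVec]
    exact h.mulVec_mem _

lemma Spans.exists_mul {M M' : Matrix (Fin n ⊕ Fin n) (Fin n) ℂ} {L : HalfGr n} (h : Spans M L)
    (h' : Spans M' L) : ∃ g : Matrix (Fin n) (Fin n) ℂ, IsUnit g.det ∧ M' = M * g := by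
  have h1 : ∀ j, ∃ v, M *ᵥ v = M'.col j := fun j => by
    rw [← h.mem_iff, ← Matrix.mulVec_single_one]
    exact h'.mulVec_mem _
  choose v hv using h1
  have h2 : M' = M * (Matrix.of fun i j => v j i) := by
    ext a j
    exact (congrFun (hv j) a).symm
  refine ⟨_, ?_, h2⟩
  rw [← Matrix.isUnit_iff_isUnit_det, ← Matrix.mulVec_injective_iff_isUnit]
  intro x y hxy
  apply h'.injective
  rw [h2, ← Matrix.mulVec_mulVec, ← Matrix.mulVec_mulVec, hxy]

/-- Two frames of one subspace differ by an invertible matrix on the right. This substitution is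
linear in the coordinates and preserves the span of every frame. -/
instance instGoodFramesHalfGr : GoodFrames (HalfGr n) where
  exists_frame L := by
    obtain ⟨M, hM⟩ := exists_spans L
    exact ⟨_, hM.isFrame⟩
  eq_of_isFrame h1 h2 := (isFrame_iff.1 h1).unique (isFrame_iff.1 h2)
  change L A B hA hB := by
    obtain ⟨g, hg, h⟩ := (isFrame_iff.1 hA).exists_mul (isFrame_iff.1 hB)
    refine ⟨fun c : (Fin n ⊕ Fin n) × Fin n =>
      ∑ j, MvPolynomial.X ((c.1, j) : (Fin n ⊕ Fin n) × Fin n) * MvPolynomial.C (g j c.2), ?_, ?_⟩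
    · ext c
      have := congrFun (congrFun h c.1) c.2
      simp only [Matrix.of_apply, Matrix.mul_apply] at this
      simp only [map_sum, map_mul, MvPolynomial.eval_X, MvPolynomial.eval_C]
      exact this.symm
    · intro y C hC
      have := ((isFrame_iff.1 hC).mul_right hg).isFrame
      simp only [map_sum, map_mul, MvPolynomial.eval_X, MvPolynomial.eval_C]
      exact this

/-- A curve in the Grassmannian whose frames depend affinely on the parameter is continuous. -/
lemma continuous_affine_curve {γ : ℂ → HalfGr n} {X Y : Matrix (Fin n ⊕ Fin n) (Fin n) ℂ}
    (h : ∀ t, Spans (X + t • Y) (γ t)) : Continuous γ := by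
  refine continuous_of_frame γ (fun t c => (X + t • Y) c.1 c.2) ?_ fun t => (h t).isFrame
  refine continuous_pi fun c => ?_
  simp only [Matrix.add_apply, Matrix.smul_apply, smul_eq_mul]
  fun_prop

end Spans

/-! ### Isotropic subspaces for a family of bilinear forms -/

section Iso

variable {n : ℕ}

/-- The subspaces that are isotropic for all the bilinear forms `(x, B y)`, `B ∈ Γ`. -/
def isoGr (Γ : Set (Matrix (Fin n ⊕ Fin n) (Fin n ⊕ Fin n) ℂ)) : Set (HalfGr n) :=
  {L | ∀ B ∈ Γ, ∀ x ∈ L.1, ∀ y ∈ L.1, x ⬝ᵥ (B *ᵥ y) = 0}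

lemma dotProduct_mulVec_mulVec {l m k : Type*} [Fintype l] [Fintype m] [Fintype k]
    (A : Matrix l m ℂ) (B : Matrix l l ℂ) (C : Matrix l k ℂ) (v : m → ℂ) (w : k → ℂ) :
    (A *ᵥ v) ⬝ᵥ (B *ᵥ (C *ᵥ w)) = v ⬝ᵥ ((Aᵀ * B * C) *ᵥ w) := by
  rw [← Matrix.mulVec_mulVec, ← Matrix.mulVec_mulVec, Matrix.dotProduct_mulVec v,
    Matrix.vecMul_transpose]

lemma eq_zero_of_forall_dotProduct {m k : Type*} [Fintype m] [Fintype k] [DecidableEq m]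
    [DecidableEq k] {D : Matrix m k ℂ} (h : ∀ v w, v ⬝ᵥ (D *ᵥ w) = 0) : D = 0 := by
  ext i j
  simpa using h (Pi.single i 1) (Pi.single j 1)

lemma Spans.mem_isoGr_iff {Γ : Set (Matrix (Fin n ⊕ Fin n) (Fin n ⊕ Fin n) ℂ)}
    {M : Matrix (Fin n ⊕ Fin n) (Fin n) ℂ} {L : HalfGr n} (h : Spans M L) :
    L ∈ isoGr Γ ↔ ∀ B ∈ Γ, Mᵀ * B * M = 0 := by
  constructor
  · intro hL B hB
    refine eq_zero_of_forall_dotProduct fun v w => ?_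
    rw [← dotProduct_mulVec_mulVec]
    exact hL B hB _ (h.mulVec_mem v) _ (h.mulVec_mem w)
  · intro hM B hB x hx y hy
    obtain ⟨v, rfl⟩ := h.mem_iff.1 hx
    obtain ⟨w, rfl⟩ := h.mem_iff.1 hy
    rw [dotProduct_mulVec_mulVec, hM B hB, Matrix.zero_mulVec, dotProduct_zero]

lemma isClosed_zariski_isoGr (Γ : Set (Matrix (Fin n ⊕ Fin n) (Fin n ⊕ Fin n) ℂ)) :
    IsClosed[zariskiTopology (HalfGr n)] (isoGr Γ) := by
  rw [← @isOpen_compl_iff _ _ (zariskiTopology (HalfGr n)), isOpen_zariski_iff]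
  intro L hL A hA
  rw [Set.mem_compl_iff, (isFrame_iff.1 hA).mem_isoGr_iff] at hL
  push Not at hL
  obtain ⟨B, hB, hne⟩ := hL
  have : ∃ i j, ((Matrix.of fun a j => A (a, j))ᵀ * B * (Matrix.of fun a j => A (a, j))) i j ≠ 0 := by
    by_contra! hc
    exact hne (by ext i j; exact hc i j)
  obtain ⟨i, j, hij⟩ := this
  -- A nonzero entry of the Gram matrix of the frame for `B`, as a quadratic polynomial in the frame
  -- coordinates.
  let R : MvPolynomial ((Fin n ⊕ Fin n) × Fin n) ℂ :=
    ∑ b, (∑ a, MvPolynomial.X (a, i) * MvPolynomial.C (B a b)) * MvPolynomial.X (b, j)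
  have hR : ∀ C : (Fin n ⊕ Fin n) × Fin n → ℂ, MvPolynomial.eval C R =
      ((Matrix.of fun a j => C (a, j))ᵀ * B * (Matrix.of fun a j => C (a, j))) i j := by
    intro C
    simp [R, Matrix.mul_apply]
  refine ⟨R, by rw [hR]; exact hij, fun L' C hC hCR hL' => hCR ?_⟩
  rw [hR, (isFrame_iff.1 hC).mem_isoGr_iff.1 hL' B hB, Matrix.zero_apply]

lemma isClosed_isoGr (Γ : Set (Matrix (Fin n ⊕ Fin n) (Fin n ⊕ Fin n) ℂ)) :
    IsClosed (isoGr Γ) := by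
  rw [← isOpen_compl_iff]
  exact isOpen_analytic_of_zariski
    ((@isOpen_compl_iff _ _ (zariskiTopology (HalfGr n))).2 (isClosed_zariski_isoGr Γ))

end Iso

/-! ### Charts -/

section Charts

variable {n : ℕ}

/-- The Hermitian orthogonal complement. -/
def orthSub (L : HalfGr n) : Submodule ℂ (Fin n ⊕ Fin n → ℂ) where
  carrier := {y | ∀ x ∈ L.1, star x ⬝ᵥ y = 0}
  add_mem' h1 h2 x hx := by rw [dotProduct_add, h1 x hx, h2 x hx, add_zero]
  zero_mem' x _ := dotProduct_zero _
  smul_mem' c y h x hx := by rw [dotProduct_smul, h x hx, smul_zero]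

open scoped ComplexOrder in
lemma orthSub_eq_ker {M : Matrix (Fin n ⊕ Fin n) (Fin n) ℂ} {L : HalfGr n} (h : Spans M L) :
    orthSub L = LinearMap.ker Mᴴ.mulVecLin := by
  ext y
  rw [LinearMap.mem_ker, Matrix.mulVecLin_apply]
  have key : ∀ v, star (M *ᵥ v) ⬝ᵥ y = star v ⬝ᵥ (Mᴴ *ᵥ y) := fun v => by
    rw [Matrix.star_mulVec, Matrix.dotProduct_mulVec]
  constructor
  · intro hy
    -- Testing against `M Mᴴ y` produces the squared norm of `Mᴴ y`.
    have := hy _ (h.mulVec_mem (Mᴴ *ᵥ y))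
    rw [key] at this
    exact dotProduct_star_self_eq_zero.1 this
  · intro hy x hx
    obtain ⟨v, rfl⟩ := h.mem_iff.1 hx
    rw [key, hy, dotProduct_zero]

open scoped ComplexOrder in
/-- The Hermitian orthogonal complement, as a point of the Grassmannian. -/
def orth (L : HalfGr n) : HalfGr n :=
  ⟨orthSub L, by
    obtain ⟨M, hM⟩ := exists_spans L
    have h1 := Mᴴ.mulVecLin.finrank_range_add_finrank_ker
    have h2 : Module.finrank ℂ (LinearMap.range Mᴴ.mulVecLin) = n := by
      change Mᴴ.rank = n
      rw [Matrix.rank_conjTranspose]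
      change Module.finrank ℂ (LinearMap.range M.mulVecLin) = n
      rw [hM, L.2]
    rw [h2, ← orthSub_eq_ker hM] at h1
    simp at h1
    exact h1⟩

/-- The columns of `A` and `B` form together a basis of `ℂ^{2n}`. -/
def IsFramePair (A B : Matrix (Fin n ⊕ Fin n) (Fin n) ℂ) : Prop :=
  (Matrix.fromCols A B).det ≠ 0

lemma isFramePair_of_injective {A B : Matrix (Fin n ⊕ Fin n) (Fin n) ℂ}
    (h : ∀ v w, A *ᵥ v + B *ᵥ w = 0 → v = 0 ∧ w = 0) : IsFramePair A B := by
  rw [IsFramePair, ← isUnit_iff_ne_zero, ← Matrix.isUnit_iff_isUnit_det,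
    ← Matrix.mulVec_injective_iff_isUnit]
  have : Function.Injective (Matrix.fromCols A B).mulVecLin := by
    rw [← LinearMap.ker_eq_bot, LinearMap.ker_eq_bot']
    intro v hv
    rw [Matrix.mulVecLin_apply, Matrix.fromCols_mulVec] at hv
    obtain ⟨h1, h2⟩ := h _ _ hv
    ext (i | i)
    · exact congrFun h1 i
    · exact congrFun h2 i
  exact this

-- If `A v + B w = 0`, then `A v` is orthogonal to itself. The positivity of the Hermitian form is
-- what makes every subspace the centre of a chart.
open scoped ComplexOrder in
lemma isFramePair_orth {A B : Matrix (Fin n ⊕ Fin n) (Fin n) ℂ} {L : HalfGr n} (hA : Spans A L)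
    (hB : Spans B (orth L)) : IsFramePair A B := by
  refine isFramePair_of_injective fun v w h => ?_
  have h1 : star (A *ᵥ v) ⬝ᵥ (B *ᵥ w) = 0 := hB.mulVec_mem w _ (hA.mulVec_mem v)
  rw [← neg_eq_of_add_eq_zero_right h, dotProduct_neg, neg_eq_zero,
    dotProduct_star_self_eq_zero] at h1
  have hv := hA.eq_zero h1
  rw [hv, Matrix.mulVec_zero, zero_add] at h
  exact ⟨hv, hB.eq_zero h⟩

lemma IsFramePair.injective {A B : Matrix (Fin n ⊕ Fin n) (Fin n) ℂ} (h : IsFramePair A B)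
    (S : Matrix (Fin n) (Fin n) ℂ) : Function.Injective (A + B * S).mulVec := by
  have h1 := Matrix.mulVec_injective_iff_isUnit.2
    ((Matrix.isUnit_iff_isUnit_det _).2 (isUnit_iff_ne_zero.2 h))
  have key : ∀ v, (A + B * S) *ᵥ v = Matrix.fromCols A B *ᵥ Sum.elim v (S *ᵥ v) := fun v => by
    rw [Matrix.fromCols_mulVec, Matrix.add_mulVec, ← Matrix.mulVec_mulVec]
    rfl
  intro v w hvw
  simp only [key] at hvw
  have := h1 hvw
  funext i
  exact congrFun this (Sum.inl i)

/-- The subspaces that are transverse to the span of the columns of `B`. -/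
def chart (B : Matrix (Fin n ⊕ Fin n) (Fin n) ℂ) : Set (HalfGr n) :=
  {L | ∃ C, Spans C L ∧ IsFramePair C B}

lemma chart_of_spans {B C : Matrix (Fin n ⊕ Fin n) (Fin n) ℂ} {L : HalfGr n} (hL : L ∈ chart B)
    (hC : Spans C L) : IsFramePair C B := by
  obtain ⟨C', hC', h⟩ := hL
  obtain ⟨g, hg, rfl⟩ := hC'.exists_mul hC
  have : Matrix.fromCols (C' * g) B = Matrix.fromCols C' B * Matrix.fromBlocks g 0 0 1 := by
    rw [Matrix.fromCols_mul_fromBlocks]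
    simp
  rw [IsFramePair, this, Matrix.det_mul, Matrix.det_fromBlocks_zero₂₁, Matrix.det_one, mul_one]
  exact mul_ne_zero h hg.ne_zero

/-- The determinant of the matrix `(C, B)` as a polynomial in the entries of `C`. -/
def chartPoly (B : Matrix (Fin n ⊕ Fin n) (Fin n) ℂ) :
    MvPolynomial ((Fin n ⊕ Fin n) × Fin n) ℂ :=
  (Matrix.fromCols (Matrix.of fun a j => MvPolynomial.X (a, j)) (B.map MvPolynomial.C)).det

lemma eval_chartPoly (B : Matrix (Fin n ⊕ Fin n) (Fin n) ℂ) (A : (Fin n ⊕ Fin n) × Fin n → ℂ) :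
    MvPolynomial.eval A (chartPoly B) =
      (Matrix.fromCols (Matrix.of fun a j => A (a, j)) B).det := by
  rw [chartPoly, RingHom.map_det]
  congr 1
  ext a (j | j) <;> simp

lemma isOpen_zariski_chart (B : Matrix (Fin n ⊕ Fin n) (Fin n) ℂ) :
    IsOpen[zariskiTopology (HalfGr n)] (chart B) := by
  rw [isOpen_zariski_iff]
  intro L hL A hA
  refine ⟨chartPoly B, ?_, fun L' C hC hC' => ⟨_, isFrame_iff.1 hC, ?_⟩⟩
  · rw [eval_chartPoly]
    exact chart_of_spans hL (isFrame_iff.1 hA)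
  · rwa [eval_chartPoly] at hC'

lemma isOpen_chart (B : Matrix (Fin n ⊕ Fin n) (Fin n) ℂ) : IsOpen (chart B) :=
  isOpen_analytic_of_zariski (isOpen_zariski_chart B)

/-- The coordinate in a chart of the subspace spanned by `C`. -/
def chartCoord (A B C : Matrix (Fin n ⊕ Fin n) (Fin n) ℂ) : Matrix (Fin n) (Fin n) ℂ :=
  ((Matrix.fromCols A B)⁻¹ * C).toRows₂ * ((Matrix.fromCols A B)⁻¹ * C).toRows₁⁻¹

lemma IsFramePair.eq_add {A B : Matrix (Fin n ⊕ Fin n) (Fin n) ℂ} (h : IsFramePair A B)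
    (C : Matrix (Fin n ⊕ Fin n) (Fin n) ℂ) :
    C = A * ((Matrix.fromCols A B)⁻¹ * C).toRows₁ + B * ((Matrix.fromCols A B)⁻¹ * C).toRows₂ := by
  rw [← Matrix.fromCols_mul_fromRows, Matrix.fromRows_toRows, ← Matrix.mul_assoc,
    Matrix.mul_nonsing_inv _ (isUnit_iff_ne_zero.2 h), Matrix.one_mul]

lemma IsFramePair.isUnit_rows {A B C : Matrix (Fin n ⊕ Fin n) (Fin n) ℂ} (h : IsFramePair A B)
    (hC : IsFramePair C B) : IsUnit (((Matrix.fromCols A B)⁻¹ * C).toRows₁).det := by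
  set p := ((Matrix.fromCols A B)⁻¹ * C).toRows₁ with hp
  set r := ((Matrix.fromCols A B)⁻¹ * C).toRows₂ with hr
  have h1 : Matrix.fromCols C B = Matrix.fromCols A B * Matrix.fromBlocks p 0 r 1 := by
    rw [Matrix.fromCols_mul_fromBlocks, Matrix.mul_zero, zero_add, Matrix.mul_one, hp, hr,
      ← h.eq_add]
  rw [IsFramePair, h1, Matrix.det_mul, Matrix.det_fromBlocks_zero₁₂, Matrix.det_one,
    mul_one] at hC
  exact isUnit_iff_ne_zero.2 (right_ne_zero_of_mul hC)

/-- Write the frame as `A p + B r`; transversality makes `p` invertible, and multiplying by its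
inverse on the right normalises the frame. -/
lemma IsFramePair.spans_chartCoord {A B C : Matrix (Fin n ⊕ Fin n) (Fin n) ℂ} {L : HalfGr n}
    (h : IsFramePair A B) (hC : Spans C L) (hL : L ∈ chart B) :
    Spans (A + B * chartCoord A B C) L := by
  have hu := h.isUnit_rows (chart_of_spans hL hC)
  have := hC.mul_right (Matrix.isUnit_nonsing_inv_det _ hu)
  have h2 := h.eq_add C
  set p := ((Matrix.fromCols A B)⁻¹ * C).toRows₁ with hp
  rw [h2, Matrix.add_mul, Matrix.mul_assoc, Matrix.mul_nonsing_inv _ hu, Matrix.mul_one,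
    Matrix.mul_assoc] at this
  exact this

lemma IsFramePair.mem_chart {A B : Matrix (Fin n ⊕ Fin n) (Fin n) ℂ} {L : HalfGr n}
    (h : IsFramePair A B) {S : Matrix (Fin n) (Fin n) ℂ} (hS : Spans (A + B * S) L) :
    L ∈ chart B := by
  refine ⟨_, hS, ?_⟩
  have h1 : Matrix.fromCols (A + B * S) B = Matrix.fromCols A B * Matrix.fromBlocks 1 0 S 1 := by
    rw [Matrix.fromCols_mul_fromBlocks]
    simp
  rw [IsFramePair, h1, Matrix.det_mul, Matrix.det_fromBlocks_zero₁₂, Matrix.det_one, mul_one,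
    mul_one]
  exact h

lemma IsFramePair.chartCoord_of_spans {A B C : Matrix (Fin n ⊕ Fin n) (Fin n) ℂ} {L : HalfGr n}
    (h : IsFramePair A B) {S : Matrix (Fin n) (Fin n) ℂ} (hS : Spans (A + B * S) L)
    (hC : Spans C L) : chartCoord A B C = S := by
  obtain ⟨g, hg, rfl⟩ := hS.exists_mul hC
  have h1 : (Matrix.fromCols A B)⁻¹ * ((A + B * S) * g) = Matrix.fromRows g (S * g) := by
    have : (A + B * S) * g = Matrix.fromCols A B * Matrix.fromRows g (S * g) := by
      rw [Matrix.fromCols_mul_fromRows, Matrix.add_mul, Matrix.mul_assoc]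
    rw [this, ← Matrix.mul_assoc, Matrix.nonsing_inv_mul _ (isUnit_iff_ne_zero.2 h),
      Matrix.one_mul]
  rw [chartCoord, h1, Matrix.toRows₁_fromRows, Matrix.toRows₂_fromRows, Matrix.mul_assoc,
    Matrix.mul_nonsing_inv _ hg, Matrix.mul_one]

/-- The tangent directions: the matrices `S` such that `A + B * S` is isotropic. -/
def chartSpace (Γ : Set (Matrix (Fin n ⊕ Fin n) (Fin n ⊕ Fin n) ℂ))
    (A B : Matrix (Fin n ⊕ Fin n) (Fin n) ℂ) : Submodule ℂ (Matrix (Fin n) (Fin n) ℂ) where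
  carrier := {S | ∀ G ∈ Γ, Aᵀ * G * B * S + Sᵀ * (Bᵀ * G * A) = 0}
  add_mem' {S T} h1 h2 G hG := by
    rw [Matrix.mul_add, Matrix.transpose_add, Matrix.add_mul, add_add_add_comm, h1 G hG, h2 G hG,
      add_zero]
  zero_mem' G _ := by simp
  smul_mem' c S h G hG := by
    rw [Matrix.mul_smul, Matrix.transpose_smul, Matrix.smul_mul, ← smul_add, h G hG, smul_zero]

/-- In the Gram matrix of `A + B S` the constant term and the quadratic term vanish because the
spans of `A` and `B` are both isotropic. The remaining condition is linear in `S`, so an isotropic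
chart is a vector space. -/
lemma mem_isoGr_iff_mem_chartSpace {Γ : Set (Matrix (Fin n ⊕ Fin n) (Fin n ⊕ Fin n) ℂ)}
    {A B : Matrix (Fin n ⊕ Fin n) (Fin n) ℂ} {L L₁ L₂ : HalfGr n} (hA : Spans A L₁)
    (hB : Spans B L₂) (h1 : L₁ ∈ isoGr Γ) (h2 : L₂ ∈ isoGr Γ) {S : Matrix (Fin n) (Fin n) ℂ}
    (hS : Spans (A + B * S) L) : L ∈ isoGr Γ ↔ S ∈ chartSpace Γ A B := by
  rw [hS.mem_isoGr_iff]
  refine forall₂_congr fun G hG => ?_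
  have e1 := hA.mem_isoGr_iff.1 h1 G hG
  have e2 := hB.mem_isoGr_iff.1 h2 G hG
  have : (A + B * S)ᵀ * G * (A + B * S) =
      Aᵀ * G * A + Sᵀ * (Bᵀ * G * B) * S + (Aᵀ * G * B * S + Sᵀ * (Bᵀ * G * A)) := by
    rw [Matrix.transpose_add, Matrix.transpose_mul]
    simp only [Matrix.add_mul, Matrix.mul_add, Matrix.mul_assoc]
    abel
  rw [this, e1, e2, Matrix.mul_zero, Matrix.zero_mul, zero_add, zero_add]

end Charts

/-! ### Graphs and their closure -/

section Graphs

variable {n : ℕ}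

/-- The frame `(1, 0)` of `ℂ^n ⊕ 0`. -/
def frameFst (n : ℕ) : Matrix (Fin n ⊕ Fin n) (Fin n) ℂ := Matrix.fromRows 1 0

/-- The frame `(0, 1)` of `0 ⊕ ℂ^n`. -/
def frameSnd (n : ℕ) : Matrix (Fin n ⊕ Fin n) (Fin n) ℂ := Matrix.fromRows 0 1

lemma isFramePair_fst_snd : IsFramePair (frameFst n) (frameSnd n) := by
  have : Matrix.fromCols (frameFst n) (frameSnd n) = 1 := by
    ext (i | i) (j | j) <;> simp [frameFst, frameSnd, Matrix.one_apply]
  rw [IsFramePair, this, Matrix.det_one]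
  exact one_ne_zero

lemma fst_add_snd_mul (S : Matrix (Fin n) (Fin n) ℂ) :
    frameFst n + frameSnd n * S = Matrix.fromRows 1 S := by
  ext (i | i) j <;> simp [frameFst, frameSnd, Matrix.fromRows_mul]

/-- The vectors spanning `graphOf Q` involve the rows of `Q`, while a frame lists vectors as
columns; hence the transpose. -/
lemma spans_graphOf (Q : Matrix (Fin n) (Fin n) ℂ) :
    Spans (frameFst n + frameSnd n * Qᵀ) (graphOf Q) := by
  rw [Spans, Matrix.range_mulVecLin, fst_add_snd_mul]
  change Submodule.span ℂ _ = Submodule.span ℂ _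
  congr 2
  ext i (a | a)
  · change (1 : Matrix (Fin n) (Fin n) ℂ) a i = (Pi.single i 1 : Fin n → ℂ) a
    rw [Matrix.one_apply, Pi.single_apply]
  · simp

lemma spans_firstSummand : Spans (frameFst n) (firstSummand n) := by
  change LinearMap.range _ = LinearMap.range _
  congr 1
  ext i (a | a)
  · simp [frameFst, inclFirst, Matrix.one_apply, Pi.single_apply]
  · simp [frameFst, inclFirst]

/-- Graphs are the chart of subspaces transverse to `0 ⊕ ℂ^n`, so the general chart lemmas apply to
them. -/
lemma mem_chart_snd_iff {L : HalfGr n} : L ∈ chart (frameSnd n) ↔ ∃ Q, graphOf Q = L := by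
  constructor
  · intro hL
    obtain ⟨C, hC⟩ := exists_spans L
    have := isFramePair_fst_snd.spans_chartCoord hC hL
    refine ⟨(chartCoord (frameFst n) (frameSnd n) C)ᵀ, ?_⟩
    exact (spans_graphOf _).unique (by rwa [Matrix.transpose_transpose])
  · rintro ⟨Q, rfl⟩
    exact isFramePair_fst_snd.mem_chart (spans_graphOf Q)

/-- The subspace `0 ⊕ ℂ^n`. -/
def sndSub (n : ℕ) : Submodule ℂ (Fin n ⊕ Fin n → ℂ) where
  carrier := {x | ∀ i, x (Sum.inl i) = 0}
  add_mem' h1 h2 i := by rw [Pi.add_apply, h1 i, h2 i, add_zero]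
  zero_mem' _ := rfl
  smul_mem' c x h i := by rw [Pi.smul_apply, h i, smul_zero]

lemma frameSnd_mulVec (w : Fin n → ℂ) : frameSnd n *ᵥ w = Sum.elim (0 : Fin n → ℂ) w := by
  rw [frameSnd, Matrix.fromRows_mulVec, Matrix.zero_mulVec, Matrix.one_mulVec]

lemma mem_chart_snd_of_inf_eq_bot {L : HalfGr n} (h : L.1 ⊓ sndSub n = ⊥) :
    L ∈ chart (frameSnd n) := by
  obtain ⟨C, hC⟩ := exists_spans L
  refine ⟨C, hC, isFramePair_of_injective fun v w hvw => ?_⟩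
  rw [frameSnd_mulVec] at hvw
  have h1 : C *ᵥ v ∈ L.1 ⊓ sndSub n := by
    refine ⟨hC.mulVec_mem v, fun i => ?_⟩
    simpa using congrFun hvw (Sum.inl i)
  rw [h, Submodule.mem_bot] at h1
  rw [h1, zero_add] at hvw
  exact ⟨hC.eq_zero h1, funext fun i => by simpa using congrFun hvw (Sum.inr i)⟩

lemma inf_eq_bot_of_mem_chart_snd {L : HalfGr n} (h : L ∈ chart (frameSnd n)) :
    L.1 ⊓ sndSub n = ⊥ := by
  obtain ⟨C, hC⟩ := exists_spans L
  have hS := isFramePair_fst_snd.spans_chartCoord hC h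
  rw [fst_add_snd_mul] at hS
  rw [eq_bot_iff]
  rintro x ⟨hx, hx'⟩
  obtain ⟨v, rfl⟩ := hS.mem_iff.1 hx
  have : v = 0 := funext fun i => by simpa [Matrix.fromRows_mulVec] using hx' i
  rw [this, Matrix.mulVec_zero]
  exact Submodule.zero_mem _

end Graphs

/-! ### Closure of the isotropic graphs -/

section Closure

variable {n : ℕ} {Γ : Set (Matrix (Fin n ⊕ Fin n) (Fin n ⊕ Fin n) ℂ)}

/-- The chart is star-shaped around its centre `L₁`: a matrix `S` is joined to zero by the curve `t
• S`, which stays in the linear space `chartSpace`. -/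
lemma isPreconnected_chart_inter {A B : Matrix (Fin n ⊕ Fin n) (Fin n) ℂ} {L₁ L₂ : HalfGr n}
    (hA : Spans A L₁) (hB : Spans B L₂) (h1 : L₁ ∈ isoGr Γ) (h2 : L₂ ∈ isoGr Γ)
    (hAB : IsFramePair A B) : IsPreconnected (chart B ∩ isoGr Γ) := by
  refine isPreconnected_of_forall L₁ fun L hL => ?_
  obtain ⟨C, hC⟩ := exists_spans L
  have hS := hAB.spans_chartCoord hC hL.1
  set S := chartCoord A B C
  have m1 := (mem_isoGr_iff_mem_chartSpace hA hB h1 h2 hS).1 hL.2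
  let γ : ℂ → HalfGr n := fun t => ofInj _ (hAB.injective (t • S))
  have hγ : ∀ t, Spans (A + B * (t • S)) (γ t) := fun t => spans_ofInj _ _
  have hc : Continuous γ := continuous_affine_curve fun t => by
    have := hγ t
    rwa [Matrix.mul_smul] at this
  refine ⟨Set.range γ, ?_, ⟨0, (hγ 0).unique (by simpa using hA)⟩,
    ⟨1, (hγ 1).unique (by simpa using hS)⟩, isPreconnected_range hc⟩
  rintro _ ⟨t, rfl⟩
  exact ⟨hAB.mem_chart (hγ t), (mem_isoGr_iff_mem_chartSpace hA hB h1 h2 (hγ t)).2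
    (Submodule.smul_mem _ _ m1)⟩

/-- A chart which contains one graph is contained in the closure of the graphs. -/
lemma chart_inter_subset_closure {A B : Matrix (Fin n ⊕ Fin n) (Fin n) ℂ} {L₁ L₂ : HalfGr n}
    (hA : Spans A L₁) (hB : Spans B L₂) (h1 : L₁ ∈ isoGr Γ) (h2 : L₂ ∈ isoGr Γ)
    (hAB : IsFramePair A B) (hne : (chart B ∩ (isoGr Γ ∩ chart (frameSnd n))).Nonempty) :
    chart B ∩ isoGr Γ ⊆ closure (isoGr Γ ∩ chart (frameSnd n)) := by
  rintro L ⟨hLB, hL⟩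
  obtain ⟨L', hLB', hL', hg⟩ := hne
  obtain ⟨C, hC⟩ := exists_spans L
  obtain ⟨C', hC'⟩ := exists_spans L'
  have hS := hAB.spans_chartCoord hC hLB
  have hS' := hAB.spans_chartCoord hC' hLB'
  set S := chartCoord A B C
  set S' := chartCoord A B C'
  have m1 := (mem_isoGr_iff_mem_chartSpace hA hB h1 h2 hS).1 hL
  have m2 := (mem_isoGr_iff_mem_chartSpace hA hB h1 h2 hS').1 hL'
  -- The complex line through the coordinates of `L` and of the graph `L'`; it consists of isotropic
  -- subspaces because the chart is linear.
  let γ : ℂ → HalfGr n := fun t => ofInj _ (hAB.injective (S + t • (S' - S)))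
  have hγ : ∀ t, Spans (A + B * (S + t • (S' - S))) (γ t) := fun t => spans_ofInj _ _
  have e : ∀ t : ℂ, A + B * (S + t • (S' - S)) = (A + B * S) + t • (B * (S' - S)) := fun t => by
    rw [Matrix.mul_add, Matrix.mul_smul, add_assoc]
  have hc : Continuous γ := continuous_affine_curve fun t => by rw [← e]; exact hγ t
  have hiso : ∀ t, γ t ∈ isoGr Γ := fun t =>
    (mem_isoGr_iff_mem_chartSpace hA hB h1 h2 (hγ t)).2
      (Submodule.add_mem _ m1 (Submodule.smul_mem _ _ (Submodule.sub_mem _ m2 m1)))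
  have h0 : γ 0 = L := (hγ 0).unique (by simpa using hS)
  have h1' : γ 1 = L' := (hγ 1).unique (by simpa using hS')
  -- On this line, being a graph means that the one-variable polynomial `p` does not vanish. Since
  -- `p` is nonzero at `t = 1`, it has finitely many roots, and `L` at `t = 0` is a limit of graphs.
  let p : Polynomial ℂ := (Matrix.fromCols ((A + B * S).map Polynomial.C +
    (Polynomial.X : Polynomial ℂ) • (B * (S' - S)).map Polynomial.C)
    ((frameSnd n).map Polynomial.C)).det
  have hp : ∀ t, p.eval t = (Matrix.fromCols (A + B * (S + t • (S' - S))) (frameSnd n)).det := by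
    intro t
    rw [e, ← Polynomial.coe_evalRingHom, RingHom.map_det]
    congr 1
    ext a (j | j)
    · simp [-Matrix.map_mul, mul_comm t]
    · simp
  have hp0 : p ≠ 0 := by
    intro h
    have h3 := hp 1
    rw [h, Polynomial.eval_zero] at h3
    exact chart_of_spans (h1' ▸ hg) (hγ 1) h3.symm
  have hd : Dense {t | p.IsRoot t}ᶜ :=
    (Polynomial.finite_setOfPred_isRoot hp0).countable.dense_compl ℂ
  have h4 : γ '' {t | p.IsRoot t}ᶜ ⊆ isoGr Γ ∩ chart (frameSnd n) := by
    rintro _ ⟨t, ht, rfl⟩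
    refine ⟨hiso t, _, hγ t, ?_⟩
    rw [IsFramePair, ← hp]
    exact ht
  rw [← h0]
  exact closure_mono h4 (image_closure_subset_closure_image hc
    (Set.mem_image_of_mem γ (hd.closure_eq ▸ Set.mem_univ 0)))

lemma mem_chart_self {A B : Matrix (Fin n ⊕ Fin n) (Fin n) ℂ} {L : HalfGr n} (hA : Spans A L)
    (hB : Spans B (orth L)) : L ∈ chart B := ⟨A, hA, isFramePair_orth hA hB⟩

lemma closure_graphs_subset : closure (isoGr Γ ∩ chart (frameSnd n)) ⊆ isoGr Γ :=
  closure_minimal Set.inter_subset_left (isClosed_isoGr Γ)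

/-- The chart is open, so if it meets the closure of the graphs it already contains a graph. -/
lemma chart_inter_subset_closure_of_mem (hΓ : ∀ L ∈ isoGr Γ, orth L ∈ isoGr Γ)
    {A B : Matrix (Fin n ⊕ Fin n) (Fin n) ℂ} {L : HalfGr n}
    (hA : Spans A L) (hB : Spans B (orth L)) (hL : L ∈ isoGr Γ)
    (hne : (chart B ∩ closure (isoGr Γ ∩ chart (frameSnd n))).Nonempty) :
    chart B ∩ isoGr Γ ⊆ closure (isoGr Γ ∩ chart (frameSnd n)) := by
  refine chart_inter_subset_closure hA hB hL (hΓ L hL) (isFramePair_orth hA hB) ?_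
  obtain ⟨L', h1, h2⟩ := hne
  exact mem_closure_iff.1 h2 _ (isOpen_chart B) h1

/-- Around an isotropic point outside the closure, the Zariski open chart centred there misses the
closure entirely, since otherwise it would lie inside it up to isotropy. A non-isotropic point is
separated by the equations of `isoGr Γ`. -/
theorem isClosed_zariski_closure_graphs
    (hΓ : ∀ L ∈ isoGr Γ, orth L ∈ isoGr Γ) :
    IsClosed[zariskiTopology (HalfGr n)] (closure (isoGr Γ ∩ chart (frameSnd n))) := by
  rw [← @isOpen_compl_iff _ _ (zariskiTopology (HalfGr n)), isOpen_zariski_iff]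
  intro L hL A hA
  by_cases hiso : L ∈ isoGr Γ
  · obtain ⟨B, hB⟩ := exists_spans (orth L)
    have hA' := isFrame_iff.1 hA
    have hLB := mem_chart_self hA' hB
    obtain ⟨R, h1, h2⟩ := isOpen_zariski_iff.1 (isOpen_zariski_chart B) L hLB A hA
    refine ⟨R, h1, fun L' C hC hR hL' => hL ?_⟩
    exact chart_inter_subset_closure_of_mem hΓ hA' hB hiso ⟨L', h2 L' C hC hR, hL'⟩ ⟨hLB, hiso⟩
  · have h := isClosed_zariski_isoGr Γ
    rw [← @isOpen_compl_iff _ _ (zariskiTopology (HalfGr n)), isOpen_zariski_iff] at h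
    obtain ⟨R, h1, h2⟩ := h L hiso A hA
    exact ⟨R, h1, fun L' C hC hR hL' => h2 L' C hC hR (closure_graphs_subset hL')⟩

/-- The graphs form a connected chart, so their closure is connected and lies in the component.
Conversely, charts show that this closure is open in `isoGr Γ`, and being closed as well it contains
the component. -/
theorem closure_graphs_eq_connectedComponentIn
    (hΓ : ∀ L ∈ isoGr Γ, orth L ∈ isoGr Γ) {L₂ : HalfGr n} (h2 : Spans (frameSnd n) L₂)
    (h1 : firstSummand n ∈ isoGr Γ) (h2' : L₂ ∈ isoGr Γ) :
    closure (isoGr Γ ∩ chart (frameSnd n)) =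
      connectedComponentIn (isoGr Γ) (firstSummand n) := by
  have h0 : firstSummand n ∈ isoGr Γ ∩ chart (frameSnd n) :=
    ⟨h1, frameFst n, spans_firstSummand, isFramePair_fst_snd⟩
  apply Set.Subset.antisymm
  · have hpre := isPreconnected_chart_inter spans_firstSummand h2 h1 h2' isFramePair_fst_snd
    rw [Set.inter_comm] at hpre
    exact hpre.closure.subset_connectedComponentIn (subset_closure h0) closure_graphs_subset
  · have hpre := isPreconnected_connectedComponentIn (x := firstSummand n) (F := isoGr Γ)
    have hF := connectedComponentIn_subset (isoGr Γ) (firstSummand n)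
    let Z := closure (isoGr Γ ∩ chart (frameSnd n))
    -- The largest ambient open set whose isotropic points lie in `Z`; it covers `Z`, and with the
    -- complement of `Z` it splits the component.
    let U : Set (HalfGr n) := ⋃₀ {O | IsOpen O ∧ O ∩ isoGr Γ ⊆ Z}
    have hU : IsOpen U := isOpen_sUnion fun O hO => hO.1
    have hUZ : U ∩ isoGr Γ ⊆ Z := by
      rintro L ⟨⟨O, hO, hLO⟩, hL⟩
      exact hO.2 ⟨hLO, hL⟩
    have hZU : Z ⊆ U := by
      intro L hL
      obtain ⟨A, hA⟩ := exists_spans L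
      obtain ⟨B, hB⟩ := exists_spans (orth L)
      have hLB := mem_chart_self hA hB
      exact ⟨chart B, ⟨isOpen_chart B, chart_inter_subset_closure_of_mem hΓ hA hB
        (closure_graphs_subset hL) ⟨L, hLB, hL⟩⟩, hLB⟩
    rcases isPreconnected_iff_subset_of_disjoint.1 hpre U Zᶜ hU isClosed_closure.isOpen_compl
      (fun L _ => (em (L ∈ Z)).imp (fun h => hZU h) id)
      (by
        ext L
        simp only [Set.mem_inter_iff, Set.mem_empty_iff_false, iff_false]
        rintro ⟨h, h3, h4⟩
        exact h4 (hUZ ⟨h3, hF h⟩)) with h | h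
    · exact fun L hL => hUZ ⟨h hL, hF hL⟩
    · exact absurd (subset_closure h0) (h (mem_connectedComponentIn h1))

end Closure

/-! ### Connectedness by shears -/

section Shears

variable {n : ℕ} {Γ : Set (Matrix (Fin n ⊕ Fin n) (Fin n ⊕ Fin n) ℂ)}

/-- The curve is the image of `L` under `x ↦ x + t φ(x) w`. As `w` is not in `L + (0 ⊕ ℂ^n)`, such a
vector lies in `0 ⊕ ℂ^n` only if its coefficient of `w` vanishes; at `t = 1` this cuts the
intersection down to the kernel of `φ`. -/
lemma exists_shear {L : HalfGr n} {w φ : Fin n ⊕ Fin n → ℂ} (hw : w ∉ L.1 ⊔ sndSub n)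
    (hφ : ∃ x ∈ L.1 ⊓ sndSub n, φ ⬝ᵥ x ≠ 0) :
    ∃ γ : ℂ → HalfGr n, Continuous γ ∧ γ 0 = L ∧
      (∀ t, ∀ y ∈ (γ t).1, ∃ x ∈ L.1, y = x + (t * (φ ⬝ᵥ x)) • w) ∧
      (γ 1).1 ⊓ sndSub n < L.1 ⊓ sndSub n := by
  obtain ⟨C, hC⟩ := exists_spans L
  have hv : ∀ (t : ℂ) v, (C + t • Matrix.vecMulVec w (φ ᵥ* C)) *ᵥ v =
      C *ᵥ v + (t * (φ ⬝ᵥ (C *ᵥ v))) • w := fun t v => by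
    rw [Matrix.add_mulVec, Matrix.smul_mulVec, Matrix.vecMulVec_mulVec, Matrix.dotProduct_mulVec,
      mul_smul]
    simp
  have hwL : ∀ (c : ℂ) x, x ∈ L.1 → x + c • w ∈ sndSub n → c = 0 := by
    intro c x hx h
    by_contra hc
    apply hw
    have : w = c⁻¹ • (-x + (x + c • w)) := by
      rw [neg_add_cancel_left, smul_smul, inv_mul_cancel₀ hc, one_smul]
    rw [this]
    exact Submodule.smul_mem _ _ (Submodule.add_mem_sup (Submodule.neg_mem _ hx) h)
  have hinj : ∀ t : ℂ, Function.Injective (C + t • Matrix.vecMulVec w (φ ᵥ* C)).mulVec := by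
    intro t
    have : Function.Injective (C + t • Matrix.vecMulVec w (φ ᵥ* C)).mulVecLin := by
      rw [← LinearMap.ker_eq_bot, LinearMap.ker_eq_bot']
      intro v h0
      rw [Matrix.mulVecLin_apply, hv] at h0
      have := hwL _ _ (hC.mulVec_mem v) (h0 ▸ Submodule.zero_mem _)
      rw [this, zero_smul, add_zero] at h0
      exact hC.eq_zero h0
    exact this
  have hmem : ∀ t, ∀ y ∈ (ofInj _ (hinj t)).1, ∃ x ∈ L.1, y = x + (t * (φ ⬝ᵥ x)) • w := by
    intro t y hy
    obtain ⟨v, rfl⟩ := (spans_ofInj _ (hinj t)).mem_iff.1 hy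
    exact ⟨C *ᵥ v, hC.mulVec_mem v, hv t v⟩
  refine ⟨fun t => ofInj _ (hinj t), continuous_affine_curve fun t => spans_ofInj _ (hinj t),
    (spans_ofInj _ (hinj 0)).unique (by simpa using hC), hmem, ?_⟩
  have hle : ∀ y ∈ (ofInj _ (hinj 1)).1 ⊓ sndSub n, y ∈ L.1 ⊓ sndSub n ∧ φ ⬝ᵥ y = 0 := by
    rintro y ⟨hy, hy'⟩
    obtain ⟨x, hx, rfl⟩ := hmem 1 y hy
    have h0 := hwL _ _ hx hy'
    rw [h0, zero_smul, add_zero] at hy' ⊢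
    exact ⟨⟨hx, hy'⟩, by simpa using h0⟩
  refine lt_of_le_of_ne (fun y hy => (hle y hy).1) fun h => ?_
  obtain ⟨x, hx, hx'⟩ := hφ
  exact hx' (hle x (h ▸ hx)).2

/-- Induction on the dimension of the intersection with `0 ⊕ ℂ^n`: a shear joins `L` to a subspace
with smaller intersection, and a subspace with zero intersection is a graph. -/
theorem isPreconnected_of_shears
    (hcomp : isoGr Γ ∩ chart (frameSnd n) ⊆ connectedComponentIn (isoGr Γ) (firstSummand n))
    (hsh : ∀ L ∈ isoGr Γ, ∀ x₀ ∈ L.1 ⊓ sndSub n, x₀ ≠ 0 → ∃ w φ : Fin n ⊕ Fin n → ℂ,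
      w ∉ L.1 ⊔ sndSub n ∧ φ ⬝ᵥ x₀ ≠ 0 ∧ ∀ (L' : HalfGr n) (t : ℂ),
        (∀ y ∈ L'.1, ∃ x ∈ L.1, y = x + (t * (φ ⬝ᵥ x)) • w) → L' ∈ isoGr Γ) :
    IsPreconnected (isoGr Γ) := by
  have key : ∀ m, ∀ L ∈ isoGr Γ, Module.finrank ℂ (L.1 ⊓ sndSub n : Submodule ℂ _) = m →
      L ∈ connectedComponentIn (isoGr Γ) (firstSummand n) := by
    intro m
    induction m using Nat.strong_induction_on with
    | _ m ih =>
      intro L hL hm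
      by_cases h : L.1 ⊓ sndSub n = ⊥
      · exact hcomp ⟨hL, mem_chart_snd_of_inf_eq_bot h⟩
      · obtain ⟨x₀, hx₀, hne⟩ := Submodule.exists_mem_ne_zero_of_ne_bot h
        obtain ⟨w, φ, hw, hφ, hiso⟩ := hsh L hL x₀ hx₀ hne
        obtain ⟨γ, hc, h0, hγ, hlt⟩ := exists_shear hw ⟨x₀, hx₀, hφ⟩
        have hr : Set.range γ ⊆ isoGr Γ := by
          rintro _ ⟨t, rfl⟩
          exact hiso _ t (hγ t)
        have h1 := ih _ (hm ▸ Submodule.finrank_lt_finrank_of_lt hlt) (γ 1) (hr ⟨1, rfl⟩) rfl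
        rw [connectedComponentIn_eq h1]
        exact (isPreconnected_range hc).subset_connectedComponentIn ⟨1, rfl⟩ hr ⟨0, h0⟩
  have : isoGr Γ = connectedComponentIn (isoGr Γ) (firstSummand n) :=
    Set.Subset.antisymm (fun L hL => key _ L hL rfl) (connectedComponentIn_subset _ _)
  rw [this]
  exact isPreconnected_connectedComponentIn

end Shears

/-! ### Hermitian complements of isotropic subspaces -/

section Orth

variable {n : ℕ} {Γ : Set (Matrix (Fin n ⊕ Fin n) (Fin n ⊕ Fin n) ℂ)}

/-- Since `N` is real, `x ⬝ N y = 0` on `L` says that `N` applied to the conjugate of `y` is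
Hermitian orthogonal to `L`; dimensions agree, so the complement is `N` applied to the conjugate of
`L`. -/
lemma spans_orth {N : Matrix (Fin n ⊕ Fin n) (Fin n ⊕ Fin n) ℂ}
    {C : Matrix (Fin n ⊕ Fin n) (Fin n) ℂ} {L : HalfGr n}
    (hN : IsUnit N.det) (hreal : N.map star = N) (hC : Spans C L)
    (hL : ∀ x ∈ L.1, ∀ y ∈ L.1, x ⬝ᵥ (N *ᵥ y) = 0) :
    Spans (N * C.map star) (orth L) := by
  have hstar : ∀ v, C.map star *ᵥ v = star (C *ᵥ star v) := fun v => by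
    ext i
    simp [Matrix.mulVec, dotProduct]
  have hNstar : ∀ v, N *ᵥ star v = star (N *ᵥ v) := fun v => by
    conv_lhs => rw [← hreal]
    ext i
    simp [Matrix.mulVec, dotProduct]
  refine spans_of_injective ?_ fun v x hx => ?_
  · intro v w hvw
    simp only [← Matrix.mulVec_mulVec, hstar] at hvw
    have h1 := Matrix.mulVec_injective_iff_isUnit.2 ((Matrix.isUnit_iff_isUnit_det N).2 hN) hvw
    exact star_injective (hC.injective (star_injective h1))
  · rw [← Matrix.mulVec_mulVec, hstar, hNstar, Matrix.star_dotProduct_star, dotProduct_comm,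
      hL x hx _ (hC.mulVec_mem _), star_zero]

/-- As `N` preserves the real form `B`, the Gram matrix of the complement is the complex conjugate
of that of `L`. -/
lemma orth_mem_isoGr {N : Matrix (Fin n ⊕ Fin n) (Fin n ⊕ Fin n) ℂ} (hN : IsUnit N.det)
    (hreal : N.map star = N) (hNΓ : N ∈ Γ) (hΓ : ∀ B ∈ Γ, B.map star = B ∧ Nᵀ * B * N = B)
    {L : HalfGr n} (hL : L ∈ isoGr Γ) : orth L ∈ isoGr Γ := by
  obtain ⟨C, hC⟩ := exists_spans L
  rw [(spans_orth hN hreal hC (hL N hNΓ)).mem_isoGr_iff]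
  intro B hB
  have h := hC.mem_isoGr_iff.1 hL B hB
  have : (N * C.map star)ᵀ * B * (N * C.map star) = (C.map star)ᵀ * (Nᵀ * B * N) * C.map star := by
    rw [Matrix.transpose_mul]
    simp only [Matrix.mul_assoc]
  rw [this, (hΓ B hB).2]
  calc (C.map star)ᵀ * B * C.map star = (Cᵀ * B * C).map star := by
        conv_lhs => rw [← (hΓ B hB).1]
        ext i j
        simp [Matrix.mul_apply]
    _ = 0 := by rw [h]; ext; simp

end Orth

/-! ### The forms `J` and `K` -/

section Forms

variable {n : ℕ}

lemma matK_mul_matK : matK n * matK n = 1 := by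
  rw [matK, Matrix.fromBlocks_multiply]
  simp

lemma matK_transpose : (matK n)ᵀ = matK n := by
  rw [matK, Matrix.fromBlocks_transpose]
  simp

lemma matK_map_star : (matK n).map star = matK n := by
  rw [matK, Matrix.fromBlocks_map]
  simp

lemma isUnit_det_matK : IsUnit (matK n).det := by
  refine IsUnit.of_mul_eq_one (matK n).det ?_
  rw [← Matrix.det_mul, matK_mul_matK, Matrix.det_one]

lemma J_map_star : (Matrix.J (Fin n) ℂ).map star = Matrix.J (Fin n) ℂ := by
  rw [Matrix.J, Matrix.fromBlocks_map]
  congr 1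
  · simp
  · ext i j
    by_cases h : i = j <;> simp [h]
  · simp
  · simp

lemma J_transpose_mul_J : (Matrix.J (Fin n) ℂ)ᵀ * Matrix.J (Fin n) ℂ = 1 := by
  rw [Matrix.J_transpose, Matrix.neg_mul, Matrix.J_squared, neg_neg]

lemma lagrangianGr_eq : lagrangianGr n = isoGr {Matrix.J (Fin n) ℂ} := by
  ext L
  simp [lagrangianGr, isoGr]

lemma orthogonalGr_eq : orthogonalGr n = isoGr {matK n} := by
  ext L
  simp [orthogonalGr, isoGr]

lemma univ_eq_isoGr : (Set.univ : Set (HalfGr n)) = isoGr ∅ := by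
  ext L
  simp [isoGr]

lemma orth_mem_isoGr_J {L : HalfGr n} (hL : L ∈ isoGr {Matrix.J (Fin n) ℂ}) :
    orth L ∈ isoGr {Matrix.J (Fin n) ℂ} := by
  refine orth_mem_isoGr (Matrix.isUnit_det_J _ _) J_map_star (Set.mem_singleton _) ?_ hL
  rintro _ rfl
  exact ⟨J_map_star, by rw [J_transpose_mul_J, Matrix.one_mul]⟩

lemma orth_mem_isoGr_K {L : HalfGr n} (hL : L ∈ isoGr {matK n}) : orth L ∈ isoGr {matK n} := by
  refine orth_mem_isoGr isUnit_det_matK matK_map_star (Set.mem_singleton _) ?_ hL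
  rintro _ rfl
  exact ⟨matK_map_star, by rw [matK_transpose, matK_mul_matK, Matrix.one_mul]⟩

lemma orth_mem_isoGr_empty {L : HalfGr n} (_ : L ∈ isoGr (∅ : Set (Matrix _ _ ℂ))) :
    orth L ∈ isoGr (∅ : Set (Matrix (Fin n ⊕ Fin n) (Fin n ⊕ Fin n) ℂ)) := by
  intro B hB
  exact absurd hB (Set.notMem_empty B)

/-- The subspace `0 ⊕ ℂ^n` of `ℂ^{2n}`. -/
def secondSummand (n : ℕ) : HalfGr n :=
  ofInj (frameSnd n) fun v w h => by
    simp only [frameSnd_mulVec] at h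
    funext i
    exact congrFun h (Sum.inr i)

lemma spans_secondSummand : Spans (frameSnd n) (secondSummand n) := rfl

lemma secondSummand_val : (secondSummand n).1 = sndSub n := by
  ext x
  rw [spans_secondSummand.mem_iff]
  simp only [frameSnd_mulVec]
  constructor
  · rintro ⟨v, rfl⟩ i
    rfl
  · intro h
    refine ⟨fun i => x (Sum.inr i), ?_⟩
    ext (i | i)
    · exact (h i).symm
    · rfl

lemma firstSummand_mem_isoGr {Γ : Set (Matrix (Fin n ⊕ Fin n) (Fin n ⊕ Fin n) ℂ)}
    (h : ∀ B ∈ Γ, B.toBlocks₁₁ = 0) : firstSummand n ∈ isoGr Γ := by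
  rw [spans_firstSummand.mem_isoGr_iff]
  intro B hB
  rw [← Matrix.fromBlocks_toBlocks B, h B hB, frameFst, Matrix.transpose_fromRows,
    Matrix.fromCols_mul_fromBlocks, Matrix.fromCols_mul_fromRows]
  simp

lemma secondSummand_mem_isoGr {Γ : Set (Matrix (Fin n ⊕ Fin n) (Fin n ⊕ Fin n) ℂ)}
    (h : ∀ B ∈ Γ, B.toBlocks₂₂ = 0) : secondSummand n ∈ isoGr Γ := by
  rw [spans_secondSummand.mem_isoGr_iff]
  intro B hB
  rw [← Matrix.fromBlocks_toBlocks B, h B hB, frameSnd, Matrix.transpose_fromRows,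
    Matrix.fromCols_mul_fromBlocks, Matrix.fromCols_mul_fromRows]
  simp

/-- The shears are symplectic transvections `x ↦ x + t ω(w, x) w`, which preserve isotropy. Any
basis vector `w` with `ω(w, x₀) ≠ 0` will do: `x₀` is orthogonal to the two Lagrangians `L` and `0 ⊕
ℂ^n`, so `w` is not in their sum. -/
theorem isPreconnected_lagrangianGr : IsPreconnected (lagrangianGr n) := by
  have b1 : firstSummand n ∈ isoGr {Matrix.J (Fin n) ℂ} :=
    firstSummand_mem_isoGr fun B hB => by rw [hB, Matrix.J, Matrix.toBlocks_fromBlocks₁₁]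
  have b2 : secondSummand n ∈ isoGr {Matrix.J (Fin n) ℂ} :=
    secondSummand_mem_isoGr fun B hB => by rw [hB, Matrix.J, Matrix.toBlocks_fromBlocks₂₂]
  rw [lagrangianGr_eq]
  refine isPreconnected_of_shears ?_ ?_
  · rw [← closure_graphs_eq_connectedComponentIn (fun L => orth_mem_isoGr_J)
      spans_secondSummand b1 b2]
    exact subset_closure
  · intro L hL x₀ hx₀ hne
    set J := Matrix.J (Fin n) ℂ
    have hJx : J *ᵥ x₀ ≠ 0 := by
      intro h
      apply hne
      have : Jᵀ *ᵥ (J *ᵥ x₀) = x₀ := by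
        rw [Matrix.mulVec_mulVec, J_transpose_mul_J, Matrix.one_mulVec]
      rw [← this, h, Matrix.mulVec_zero]
    obtain ⟨i, hi⟩ := Function.ne_iff.1 hJx
    have hanti : ∀ x y : Fin n ⊕ Fin n → ℂ, x ⬝ᵥ (J *ᵥ y) = - (y ⬝ᵥ (J *ᵥ x)) := fun x y => by
      rw [Matrix.dotProduct_mulVec, ← Matrix.mulVec_transpose, Matrix.J_transpose,
        Matrix.neg_mulVec, neg_dotProduct, dotProduct_comm]
    have hw : (Pi.single i 1 : Fin n ⊕ Fin n → ℂ) ⬝ᵥ (J *ᵥ x₀) ≠ 0 := by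
      rw [single_dotProduct, one_mul]
      exact hi
    refine ⟨Pi.single i 1, (Pi.single i 1 : Fin n ⊕ Fin n → ℂ) ᵥ* J, ?_, ?_, ?_⟩
    · intro h
      obtain ⟨y, hy, z, hz, hyz⟩ := Submodule.mem_sup.1 h
      apply hw
      rw [← secondSummand_val] at hx₀ hz
      rw [← hyz, add_dotProduct, hL J rfl y hy x₀ hx₀.1, b2 J rfl z hz x₀ hx₀.2, add_zero]
    · rwa [← Matrix.dotProduct_mulVec]
    · rintro L' t hL' B rfl x hx y hy
      obtain ⟨x, hx1, rfl⟩ := hL' x hx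
      obtain ⟨y, hy1, rfl⟩ := hL' y hy
      set w : Fin n ⊕ Fin n → ℂ := Pi.single i 1
      have hww : w ⬝ᵥ (J *ᵥ w) = 0 := by
        have := hanti w w
        linear_combination this / 2
      simp only [← Matrix.dotProduct_mulVec, Matrix.mulVec_add, Matrix.mulVec_smul,
        dotProduct_add, add_dotProduct, dotProduct_smul, smul_dotProduct, smul_eq_mul]
      rw [hL J rfl x hx1 y hy1, hanti x w, hww]
      ring

/-- Every shear is allowed here. The vector `w` exists by counting dimensions: `L` meets `0 ⊕ ℂ^n`,
so their sum is not the whole space. -/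
theorem isPreconnected_halfGr : IsPreconnected (Set.univ : Set (HalfGr n)) := by
  rw [univ_eq_isoGr]
  refine isPreconnected_of_shears ?_ ?_
  · rw [← closure_graphs_eq_connectedComponentIn (fun L => orth_mem_isoGr_empty)
      spans_secondSummand (firstSummand_mem_isoGr (by simp)) (secondSummand_mem_isoGr (by simp))]
    exact subset_closure
  · intro L _ x₀ hx₀ hne
    have h1 : L.1 ⊔ sndSub n ≠ ⊤ := by
      intro h
      have h2 := Submodule.finrank_sup_add_finrank_inf_eq L.1 (sndSub n)
      rw [h, ← secondSummand_val, L.2, (secondSummand n).2, secondSummand_val] at h2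
      have h3 : 0 < Module.finrank ℂ (L.1 ⊓ sndSub n : Submodule ℂ _) :=
        Module.finrank_pos_iff.2 ⟨⟨⟨x₀, hx₀⟩, 0, fun h => hne (congrArg Subtype.val h)⟩⟩
      rw [finrank_top, Module.finrank_fintype_fun_eq_card, Fintype.card_sum, Fintype.card_fin] at h2
      omega
    obtain ⟨w, -, hw⟩ := SetLike.exists_of_lt (lt_top_iff_ne_top.2 h1)
    obtain ⟨i, hi⟩ := Function.ne_iff.1 hne
    refine ⟨w, Pi.single i 1, hw, ?_, fun L' t _ B hB => absurd hB (Set.notMem_empty B)⟩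
    rw [single_dotProduct, one_mul]
    exact hi

end Forms

/-! ### Smoothness -/

section Smooth

lemma differentiableOn_det {E m : Type*} [NormedAddCommGroup E] [NormedSpace ℂ E] [Fintype m]
    [DecidableEq m] {f : E → Matrix m m ℂ} {s : Set E}
    (h : ∀ i j, DifferentiableOn ℂ (fun x => f x i j) s) :
    DifferentiableOn ℂ (fun x => (f x).det) s := by
  simp only [Matrix.det_apply']
  have hprod : ∀ (σ : Equiv.Perm m) (u : Finset m),
      DifferentiableOn ℂ (fun x => ∏ i ∈ u, f x (σ i) i) s := by
    intro σ u
    induction u using Finset.induction_on with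
    | empty => simp
    | insert a u ha ih =>
      simp only [Finset.prod_insert ha]
      exact (h _ _).mul ih
  exact DifferentiableOn.fun_sum fun σ _ => (differentiableOn_const _).mul (hprod σ _)

/-- By Cramer's rule an entry of the inverse is a determinant with one constant row, divided by the
full determinant. -/
lemma differentiableOn_inv {E m : Type*} [NormedAddCommGroup E] [NormedSpace ℂ E] [Fintype m]
    [DecidableEq m] {f : E → Matrix m m ℂ} {s : Set E}
    (h : ∀ i j, DifferentiableOn ℂ (fun x => f x i j) s) (h0 : ∀ x ∈ s, (f x).det ≠ 0) (i j : m) :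
    DifferentiableOn ℂ (fun x => (f x)⁻¹ i j) s := by
  simp only [Matrix.inv_def, Matrix.smul_apply, Matrix.adjugate_apply, Ring.inverse_eq_inv',
    smul_eq_mul]
  refine ((differentiableOn_det h).inv h0).mul (differentiableOn_det fun a b => ?_)
  by_cases hab : a = j
  · subst hab
    simp only [Matrix.updateRow_self]
    exact differentiableOn_const _
  · simp only [Matrix.updateRow_ne hab]
    exact h a b

variable {n : ℕ}

lemma differentiableOn_chartCoord {A B : Matrix (Fin n ⊕ Fin n) (Fin n) ℂ} (h : IsFramePair A B)
    (i j : Fin n) :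
    DifferentiableOn ℂ (fun C : (Fin n ⊕ Fin n) × Fin n → ℂ =>
      chartCoord A B (Matrix.of fun a j => C (a, j)) i j)
      {C | IsFramePair (Matrix.of fun a j => C (a, j)) B} := by
  have hlin : ∀ a b, Differentiable ℂ (fun C : (Fin n ⊕ Fin n) × Fin n → ℂ =>
      ((Matrix.fromCols A B)⁻¹ * (Matrix.of fun a j => C (a, j))) a b) := by
    intro a b
    simp only [Matrix.mul_apply, Matrix.of_apply]
    fun_prop
  set M := fun C : (Fin n ⊕ Fin n) × Fin n → ℂ =>
    (Matrix.fromCols A B)⁻¹ * (Matrix.of fun a j => C (a, j)) with hM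
  change DifferentiableOn ℂ (fun C => ∑ l, (M C) (Sum.inr i) l * ((M C).toRows₁⁻¹) l j) _
  refine DifferentiableOn.fun_sum fun l _ => ?_
  refine DifferentiableOn.mul (hlin _ _).differentiableOn ?_
  refine differentiableOn_inv (f := fun C => (M C).toRows₁)
    (fun a b => (hlin (Sum.inl a) b).differentiableOn) (fun C hC => ?_) l j
  exact (h.isUnit_rows hC).ne_zero

/-- The parametrization identifies `ℂ^d` with the linear space `chartSpace` at `L`. The hypothesis
`hopen` makes `S` open in `isoGr Γ`; it is kept separate so that a single connected component can be
treated. -/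
theorem isSmoothOfDim_of_chartSpace {Γ : Set (Matrix (Fin n ⊕ Fin n) (Fin n ⊕ Fin n) ℂ)}
    (hΓ : ∀ L ∈ isoGr Γ, orth L ∈ isoGr Γ) {S : Set (HalfGr n)} {d : ℕ} (hS : S ⊆ isoGr Γ)
    (hopen : ∀ L ∈ S, ∀ A B, Spans A L → Spans B (orth L) → chart B ∩ isoGr Γ ⊆ S)
    (hdim : ∀ L ∈ S, ∀ A B, Spans A L → Spans B (orth L) →
      Module.finrank ℂ (chartSpace Γ A B) = d) : IsSmoothOfDim S d := by
  intro L hL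
  obtain ⟨A, hA⟩ := exists_spans L
  obtain ⟨B, hB⟩ := exists_spans (orth L)
  have hAB := isFramePair_orth hA hB
  have hiff := fun {L' : HalfGr n} {T} => mem_isoGr_iff_mem_chartSpace (L := L') (S := T) hA hB
    (hS hL) (hΓ L (hS hL))
  let e := LinearEquiv.ofFinrankEq (chartSpace Γ A B) (Fin d → ℂ)
    (by rw [hdim L hL A B hA hB, Module.finrank_fin_fun])
  let j : (Fin d → ℂ) →ₗ[ℂ] Matrix (Fin n) (Fin n) ℂ := (chartSpace Γ A B).subtype ∘ₗ e.symm
  have hj : Function.Injective j := (chartSpace Γ A B).injective_subtype.comp e.symm.injective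
  have hjmem : ∀ u, j u ∈ chartSpace Γ A B := fun u => (e.symm u).2
  obtain ⟨pr, hpr⟩ := j.exists_leftInverse_of_injective (LinearMap.ker_eq_bot.2 hj)
  have hpr' : ∀ u, pr (j u) = u := fun u => LinearMap.congr_fun hpr u
  have hjpr : ∀ T ∈ chartSpace Γ A B, j (pr T) = T := by
    intro T hT
    have : j (e ⟨T, hT⟩) = T := by simp [j]
    rw [← this, hpr']
  let ψ : (Fin d → ℂ) → HalfGr n := fun u => ofInj _ (hAB.injective (j u))
  have hψ : ∀ u, Spans (A + B * j u) (ψ u) := fun u => spans_ofInj _ _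
  -- The inverse `φ` must be a function of the subspace, so a frame is chosen arbitrarily;
  -- `chartCoord` does not depend on this choice.
  choose fr hfr using fun L' : HalfGr n => exists_spans L'
  let φ : HalfGr n → Fin d → ℂ := fun L' => pr (chartCoord A B (fr L'))
  have hψmem : ∀ u, ψ u ∈ S ∩ chart B := by
    intro u
    have h1 := hAB.mem_chart (hψ u)
    exact ⟨hopen L hL A B hA hB ⟨h1, (hiff (hψ u)).2 (hjmem u)⟩, h1⟩
  have hinv : Set.InvOn φ ψ Set.univ (S ∩ chart B) := by
    constructor
    · intro u _
      change pr _ = u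
      rw [hAB.chartCoord_of_spans (hψ u) (hfr _), hpr']
    · rintro L' ⟨hL', hL'B⟩
      have h1 := hAB.spans_chartCoord (hfr L') hL'B
      have h2 := hψ (φ L')
      rw [hjpr _ ((hiff h1).1 (hS hL'))] at h2
      exact h2.unique h1
  refine ⟨chart B, Set.univ, ψ, fun u c => (A + B * j u) c.1 c.2, φ, isOpen_chart B,
    mem_chart_self hA hB, isOpen_univ, ?_, hinv, ?_, fun u _ => (hψ u).isFrame, ?_⟩
  · refine hinv.bijOn (fun u _ => hψmem u) fun _ _ => Set.mem_univ _
  · have : ∀ c : (Fin n ⊕ Fin n) × Fin n, Differentiable ℂ fun u => (A + B * j u) c.1 c.2 := by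
      intro c
      simp only [Matrix.add_apply, Matrix.mul_apply]
      have hl : ∀ p q, Differentiable ℂ fun u => j u p q := fun p q =>
        (LinearMap.toContinuousLinearMap (Matrix.entryLinearMap ℂ ℂ p q ∘ₗ j)).differentiable
      fun_prop
    exact (differentiable_pi.2 this).differentiableOn
  · rintro L' ⟨_, hL'⟩ C hC
    refine ⟨{C | IsFramePair (Matrix.of fun a j => C (a, j)) B},
      fun C => pr (chartCoord A B (Matrix.of fun a j => C (a, j))), ?_, ?_, ?_, ?_⟩
    · simp only [IsFramePair, ← eval_chartPoly]
      exact isOpen_ne_fun (chartPoly B).continuous_eval continuous_const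
    · exact chart_of_spans hL' (isFrame_iff.1 hC)
    -- Expanding the linear map `pr` in matrix units reduces holomorphy to that of the entries of
    -- `chartCoord`.
    · have : ∀ T, pr T = ∑ p, ∑ q, T p q • pr (Matrix.single p q 1) := by
        intro T
        conv_lhs => rw [Matrix.matrix_eq_sum_single T]
        simp only [map_sum]
        refine Finset.sum_congr rfl fun p _ => Finset.sum_congr rfl fun q _ => ?_
        rw [← map_smul, Matrix.smul_single, smul_eq_mul, mul_one]
      refine DifferentiableOn.congr (f := fun C : (Fin n ⊕ Fin n) × Fin n → ℂ => ∑ p, ∑ q,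
        chartCoord A B (Matrix.of fun a j => C (a, j)) p q • pr (Matrix.single p q 1)) ?_
        fun C _ => this _
      exact DifferentiableOn.fun_sum fun p _ => DifferentiableOn.fun_sum fun q _ =>
        (differentiableOn_chartCoord hAB p q).smul_const _
    · rintro L₂ ⟨_, hL₂⟩ C₂ _ hC₂
      have h1 := hAB.spans_chartCoord (hfr L₂) hL₂
      change pr _ = pr _
      rw [hAB.chartCoord_of_spans h1 (isFrame_iff.1 hC₂)]

end Smooth

/-! ### Dimensions of the tangent spaces -/

section Dimension

variable {n : ℕ}

/-- The matrices with `T + ε Tᵀ = 0`. -/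
def symmSub (n : ℕ) (ε : ℂ) : Submodule ℂ (Matrix (Fin n) (Fin n) ℂ) where
  carrier := {T | T + ε • Tᵀ = 0}
  add_mem' {S T} h1 h2 := by
    change S + T + ε • (S + T)ᵀ = 0
    rw [Matrix.transpose_add, smul_add, add_add_add_comm, h1, h2, add_zero]
  zero_mem' := by simp
  smul_mem' c T h := by
    change c • T + ε • (c • T)ᵀ = 0
    rw [Matrix.transpose_smul, smul_comm, ← smul_add, h, smul_zero]

/-- With this sign the matrices are symmetric, that is, functions on unordered pairs of indices. -/
lemma finrank_symmSub_neg_one : Module.finrank ℂ (symmSub n (-1)) = n * (n + 1) / 2 := by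
  let f : (Sym2 (Fin n) → ℂ) →ₗ[ℂ] Matrix (Fin n) (Fin n) ℂ :=
    { toFun := fun g => Matrix.of fun i j => g s(i, j)
      map_add' := fun _ _ => rfl
      map_smul' := fun _ _ => rfl }
  have hf : Function.Injective f := by
    intro g h hgh
    funext z
    induction z using Sym2.ind with
    | _ i j => exact congrFun (congrFun hgh i) j
  have hr : LinearMap.range f = symmSub n (-1) := by
    ext T
    constructor
    · rintro ⟨g, rfl⟩
      change f g + (-1 : ℂ) • (f g)ᵀ = 0
      ext i j
      change g s(i, j) + (-1 : ℂ) * g s(j, i) = 0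
      rw [Sym2.eq_swap]
      ring
    · intro hT
      have hT' : T + (-1 : ℂ) • Tᵀ = 0 := hT
      refine ⟨fun z => Sym2.lift ⟨fun i j => T i j, fun i j => ?_⟩ z, ?_⟩
      · have := congrFun (congrFun hT' i) j
        simp only [Matrix.add_apply, Matrix.smul_apply, Matrix.transpose_apply, smul_eq_mul,
          Matrix.zero_apply] at this
        linear_combination this
      · ext i j
        rfl
  rw [← hr, LinearMap.finrank_range_of_inj hf, Module.finrank_fintype_fun_eq_card, Sym2.card,
    Fintype.card_fin, Nat.choose_two_right, Nat.add_sub_cancel, mul_comm]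

/-- Rank and nullity of `T ↦ T - Tᵀ`, whose kernel is the symmetric matrices and whose image is the
antisymmetric ones. -/
lemma finrank_symmSub_one : Module.finrank ℂ (symmSub n 1) + n * (n + 1) / 2 = n * n := by
  let f : Matrix (Fin n) (Fin n) ℂ →ₗ[ℂ] Matrix (Fin n) (Fin n) ℂ :=
    LinearMap.id + (-1 : ℂ) • (Matrix.transposeLinearEquiv (Fin n) (Fin n) ℂ ℂ).toLinearMap
  have hf : ∀ T, f T = T + (-1 : ℂ) • Tᵀ := fun T => rfl
  have hk : LinearMap.ker f = symmSub n (-1) := by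
    ext T
    rw [LinearMap.mem_ker, hf]
    exact Iff.rfl
  have hr : LinearMap.range f = symmSub n 1 := by
    ext T
    constructor
    · rintro ⟨g, rfl⟩
      change f g + (1 : ℂ) • (f g)ᵀ = 0
      rw [hf]
      ext i j
      simp
    · intro hT
      have hT' : T + (1 : ℂ) • Tᵀ = 0 := hT
      have h2 : Tᵀ = -T := by
        rw [one_smul] at hT'
        exact (neg_eq_of_add_eq_zero_right hT').symm
      refine ⟨(1 / 2 : ℂ) • T, ?_⟩
      rw [hf, Matrix.transpose_smul, h2]
      ext i j
      simp only [Matrix.add_apply, Matrix.smul_apply, Matrix.neg_apply, smul_eq_mul]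
      ring
  have := f.finrank_range_add_finrank_ker
  rw [hr, hk, finrank_symmSub_neg_one, Module.finrank_matrix] at this
  simpa using this

/-- A vector `v` in the kernel gives `N B v` killed by `Aᵀ`, and by `Bᵀ` because the span of `B` is
isotropic. As `A` and `B` together are a basis and `N` is invertible, `B v = 0`. -/
lemma isUnit_transpose_mul_mul {A B : Matrix (Fin n ⊕ Fin n) (Fin n) ℂ} {L₂ : HalfGr n}
    {N : Matrix (Fin n ⊕ Fin n) (Fin n ⊕ Fin n) ℂ} (hN : IsUnit N.det) (hAB : IsFramePair A B)
    (hB : Spans B L₂) (h2 : L₂ ∈ isoGr {N}) : IsUnit (Aᵀ * N * B) := by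
  rw [← Matrix.mulVec_injective_iff_isUnit]
  have : Function.Injective (Aᵀ * N * B).mulVecLin := by
    rw [← LinearMap.ker_eq_bot, LinearMap.ker_eq_bot']
    intro v hv
    have hv1 : Aᵀ *ᵥ (N *ᵥ (B *ᵥ v)) = 0 := by
      rw [Matrix.mulVec_mulVec, Matrix.mulVec_mulVec]
      exact hv
    have hv2 : Bᵀ *ᵥ (N *ᵥ (B *ᵥ v)) = 0 := by
      rw [Matrix.mulVec_mulVec, Matrix.mulVec_mulVec,
        hB.mem_isoGr_iff.1 h2 N rfl, Matrix.zero_mulVec]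
    have hP : IsUnit (Matrix.fromCols A B)ᵀ := by
      rw [Matrix.isUnit_iff_isUnit_det, Matrix.det_transpose]
      exact isUnit_iff_ne_zero.2 hAB
    have h3 : (Matrix.fromCols A B)ᵀ *ᵥ (N *ᵥ (B *ᵥ v)) = 0 := by
      rw [Matrix.transpose_fromCols, Matrix.fromRows_mulVec, hv1, hv2]
      ext (i | i) <;> rfl
    have h4 := Matrix.mulVec_injective_iff_isUnit.2 hP (h3.trans (Matrix.mulVec_zero _).symm)
    have h5 := Matrix.mulVec_injective_iff_isUnit.2 ((Matrix.isUnit_iff_isUnit_det N).2 hN)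
      (h4.trans (Matrix.mulVec_zero _).symm)
    exact hB.eq_zero h5
  exact this

/-- Left multiplication by the invertible matrix `Aᵀ N B` turns the tangent equation into `T + ε Tᵀ
= 0`, because `N` has symmetry `ε` and `ε` squares to one. -/
lemma finrank_chartSpace {A B : Matrix (Fin n ⊕ Fin n) (Fin n) ℂ} {L₂ : HalfGr n}
    {N : Matrix (Fin n ⊕ Fin n) (Fin n ⊕ Fin n) ℂ} {ε : ℂ} (hN : IsUnit N.det)
    (hε : Nᵀ = ε • N) (hε' : ε * ε = 1) (hAB : IsFramePair A B)
    (hB : Spans B L₂) (h2 : L₂ ∈ isoGr {N}) :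
    Module.finrank ℂ (chartSpace {N} A B) = Module.finrank ℂ (symmSub n ε) := by
  obtain ⟨u, hu⟩ := isUnit_transpose_mul_mul hN hAB hB h2
  let e : Matrix (Fin n) (Fin n) ℂ ≃ₗ[ℂ] Matrix (Fin n) (Fin n) ℂ :=
    LinearEquiv.ofLinearMap (LinearMap.mulLeft ℂ u.1) (LinearMap.mulLeft ℂ (u⁻¹).1)
      (by ext1; simp [← LinearMap.mulLeft_mul]) (by ext1; simp [← LinearMap.mulLeft_mul])
  have he : ∀ S, e S = Aᵀ * N * B * S := fun S => by
    rw [← hu]; rfl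
  have h1 : chartSpace {N} A B = (symmSub n ε).comap e.toLinearMap := by
    ext S
    change (∀ G ∈ ({N} : Set _), _) ↔ e S + ε • (e S)ᵀ = 0
    simp only [Set.mem_singleton_iff, forall_eq]
    rw [he]
    simp only [Matrix.transpose_mul, Matrix.transpose_transpose]
    rw [hε]
    simp only [Matrix.smul_mul, Matrix.mul_smul, smul_smul, hε', one_smul]
    simp only [Matrix.mul_assoc]
  rw [h1]
  exact (e.ofSubmodule' (symmSub n ε)).finrank_eq

/-- The factors are smooth of the expected dimension. -/
theorem isSmoothOfDim_factor (t : RepType) (n : ℕ) : IsSmoothOfDim (t.factor n) (t.dim n) := by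
  cases t with
  | one =>
    change IsSmoothOfDim (Set.univ : Set (HalfGr n)) (n ^ 2)
    refine isSmoothOfDim_of_chartSpace (fun L => orth_mem_isoGr_empty) (by rw [← univ_eq_isoGr])
      (fun _ _ _ _ _ _ => Set.subset_univ _) fun L _ A B _ _ => ?_
    have : chartSpace ∅ A B = ⊤ :=
      eq_top_iff.2 fun S _ G hG => absurd hG (Set.notMem_empty G)
    rw [this, finrank_top, Module.finrank_matrix]
    simp [sq]
  | two =>
    change IsSmoothOfDim (lagrangianGr n) (n * (n + 1) / 2)
    rw [lagrangianGr_eq]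
    refine isSmoothOfDim_of_chartSpace (fun L => orth_mem_isoGr_J) subset_rfl
      (fun _ _ _ _ _ _ => Set.inter_subset_right) fun L hL A B hA hB => ?_
    rw [finrank_chartSpace (Matrix.isUnit_det_J _ _) (ε := -1) (by simp [Matrix.J_transpose])
      (by norm_num) (isFramePair_orth hA hB) hB (orth_mem_isoGr_J hL), finrank_symmSub_neg_one]
  | three =>
    change IsSmoothOfDim (specialOrthogonalGr (2 * n)) (2 * n ^ 2 - n)
    have hsub : specialOrthogonalGr (2 * n) ⊆ isoGr {matK (2 * n)} := by
      rw [← orthogonalGr_eq]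
      exact connectedComponentIn_subset _ _
    refine isSmoothOfDim_of_chartSpace (fun L => orth_mem_isoGr_K) hsub ?_ ?_
    -- An isotropic chart is connected, so it stays in the component of its centre.
    · intro L hL A B hA hB
      rw [specialOrthogonalGr, connectedComponentIn_eq hL, orthogonalGr_eq]
      exact (isPreconnected_chart_inter hA hB (hsub hL) (orth_mem_isoGr_K (hsub hL))
        (isFramePair_orth hA hB)).subset_connectedComponentIn ⟨mem_chart_self hA hB, hsub hL⟩
        Set.inter_subset_right
    · intro L hL A B hA hB
      rw [finrank_chartSpace isUnit_det_matK (ε := 1) (by simp [matK_transpose])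
        (by norm_num) (isFramePair_orth hA hB) hB (orth_mem_isoGr_K (hsub hL))]
      have h1 := finrank_symmSub_one (n := 2 * n)
      have h2 : 2 * n * (2 * n + 1) / 2 = n * (2 * n + 1) := by
        rw [mul_assoc, Nat.mul_div_cancel_left _ two_pos]
      rw [h2] at h1
      have h3 : 2 * n * (2 * n) = n * (2 * n + 1) + (2 * n ^ 2 - n) := by
        -- Needed because the dimension is written with truncated subtraction.
        have h4 : n ≤ 2 * n ^ 2 := by nlinarith [sq_nonneg n, Nat.le_self_pow two_ne_zero n]
        zify [h4]
        ring
      omega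

end Dimension

/-! ### The symplectic complement -/

section PerpJ

variable {n : ℕ}

/-- The orthogonal complement for the symplectic form. -/
def perpJSub (L : HalfGr n) : Submodule ℂ (Fin n ⊕ Fin n → ℂ) where
  carrier := {y | ∀ x ∈ L.1, x ⬝ᵥ (Matrix.J (Fin n) ℂ *ᵥ y) = 0}
  add_mem' h1 h2 x hx := by
    rw [Matrix.mulVec_add, dotProduct_add, h1 x hx, h2 x hx, add_zero]
  zero_mem' x _ := by rw [Matrix.mulVec_zero, dotProduct_zero]
  smul_mem' c y h x hx := by rw [Matrix.mulVec_smul, dotProduct_smul, h x hx, smul_zero]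

lemma perpJSub_eq_ker {M : Matrix (Fin n ⊕ Fin n) (Fin n) ℂ} {L : HalfGr n} (h : Spans M L) :
    perpJSub L = LinearMap.ker (Mᵀ * Matrix.J (Fin n) ℂ).mulVecLin := by
  ext y
  rw [LinearMap.mem_ker, Matrix.mulVecLin_apply, ← Matrix.mulVec_mulVec]
  have key : ∀ v, (M *ᵥ v) ⬝ᵥ (Matrix.J (Fin n) ℂ *ᵥ y) =
      v ⬝ᵥ (Mᵀ *ᵥ (Matrix.J (Fin n) ℂ *ᵥ y)) := fun v => by
    rw [Matrix.dotProduct_mulVec v, Matrix.vecMul_transpose]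
  constructor
  · intro hy
    ext i
    have := hy _ (h.mulVec_mem (Pi.single i 1))
    rwa [key, single_dotProduct, one_mul] at this
  · intro hy x hx
    obtain ⟨v, rfl⟩ := h.mem_iff.1 hx
    rw [key, hy, dotProduct_zero]

/-- The orthogonal complement for the symplectic form, as a point of the Grassmannian. -/
def perpJ (L : HalfGr n) : HalfGr n :=
  ⟨perpJSub L, by
    obtain ⟨M, hM⟩ := exists_spans L
    have h1 := (Mᵀ * Matrix.J (Fin n) ℂ).mulVecLin.finrank_range_add_finrank_ker
    have h2 : Module.finrank ℂ (LinearMap.range (Mᵀ * Matrix.J (Fin n) ℂ).mulVecLin) = n := by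
      change (Mᵀ * Matrix.J (Fin n) ℂ).rank = n
      rw [Matrix.rank_mul_eq_left_of_isUnit_det _ _ (Matrix.isUnit_det_J _ _),
        Matrix.rank_transpose]
      change Module.finrank ℂ (LinearMap.range M.mulVecLin) = n
      rw [hM, L.2]
    rw [h2, ← perpJSub_eq_ker hM, Module.finrank_fintype_fun_eq_card, Fintype.card_sum,
      Fintype.card_fin] at h1
    omega⟩

lemma mem_perpJ {L : HalfGr n} {y : Fin n ⊕ Fin n → ℂ} :
    y ∈ (perpJ L).1 ↔ ∀ x ∈ L.1, x ⬝ᵥ (Matrix.J (Fin n) ℂ *ᵥ y) = 0 := Iff.rfl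

lemma eq_perpJ_of_forall {L L' : HalfGr n}
    (h : ∀ x ∈ L.1, ∀ y ∈ L'.1, x ⬝ᵥ (Matrix.J (Fin n) ℂ *ᵥ y) = 0) : L' = perpJ L := by
  refine Subtype.ext (Submodule.eq_of_le_of_finrank_eq (fun y hy x hx => h x hx y hy) ?_)
  rw [L'.2, (perpJ L).2]

lemma perpJ_eq_self {L : HalfGr n} (h : L ∈ lagrangianGr n) : perpJ L = L :=
  (eq_perpJ_of_forall h).symm

end PerpJ

/-! ### The variety of invariant Lagrangian subspaces -/

section InvariantLagrangians

variable {G : Type*} [Group G] {k : ℕ} (ρ : G →* Matrix.orthogonalGroup (Fin k) ℝ)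

/-- The matrix of the diagonal action of `g` on `ℂ^{2k}`. -/
def diagMat (g : G) : Matrix (Fin k ⊕ Fin k) (Fin k ⊕ Fin k) ℂ :=
  Matrix.fromBlocks (complexMat ρ g) 0 0 (complexMat ρ g)

/-- The bilinear forms `(x, J g y)`. -/
def formsOf : Set (Matrix (Fin k ⊕ Fin k) (Fin k ⊕ Fin k) ℂ) :=
  Set.range fun g => Matrix.J (Fin k) ℂ * diagMat ρ g

lemma complexMat_one : complexMat ρ 1 = 1 := by
  simp [complexMat]

lemma diagMat_one : diagMat ρ 1 = 1 := by
  simp [diagMat, complexMat_one]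

lemma J_mul_diagMat (g : G) : Matrix.J (Fin k) ℂ * diagMat ρ g =
    Matrix.fromBlocks 0 (-complexMat ρ g) (complexMat ρ g) 0 := by
  simp [diagMat, Matrix.J, Matrix.fromBlocks_multiply]

lemma diagMat_mul_J (g : G) : diagMat ρ g * Matrix.J (Fin k) ℂ =
    Matrix.J (Fin k) ℂ * diagMat ρ g := by
  rw [J_mul_diagMat]
  simp [diagMat, Matrix.J, Matrix.fromBlocks_multiply]

lemma complexMat_map_star (g : G) : (complexMat ρ g).map star = complexMat ρ g := by
  ext i j
  simp [complexMat]

lemma J_mem_formsOf : Matrix.J (Fin k) ℂ ∈ formsOf ρ := ⟨1, by simp [diagMat_one]⟩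

/-- The form for `g = 1` says that `L` is Lagrangian, hence equal to its own symplectic complement;
then the form for `g` says that `g x` is in this complement. Invariance thus becomes isotropy. -/
lemma invariantLagrangians_eq : invariantLagrangians ρ = isoGr (formsOf ρ) := by
  ext L
  constructor
  · rintro ⟨h1, h2⟩ _ ⟨g, rfl⟩ x hx y hy
    rw [← Matrix.mulVec_mulVec]
    exact h1 x hx _ (h2 g y hy)
  · intro h
    have h1 : L ∈ lagrangianGr k := fun x hx y hy => h _ (J_mem_formsOf ρ) x hx y hy
    refine ⟨h1, fun g x hx => ?_⟩
    rw [← perpJ_eq_self h1, mem_perpJ]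
    intro y hy
    rw [Matrix.mulVec_mulVec]
    exact h _ ⟨g, rfl⟩ y hy x hx

/-- All the forms are real, and `J` preserves them because it is orthogonal and commutes with the
diagonal action. -/
lemma orth_mem_isoGr_formsOf {L : HalfGr k} (hL : L ∈ isoGr (formsOf ρ)) :
    orth L ∈ isoGr (formsOf ρ) := by
  refine orth_mem_isoGr (Matrix.isUnit_det_J _ _) J_map_star (J_mem_formsOf ρ) ?_ hL
  rintro _ ⟨g, rfl⟩
  constructor
  · simp only [J_mul_diagMat, Matrix.fromBlocks_map, complexMat_map_star]
    congr 1
    · simp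
    · ext i j
      simp [complexMat]
    · simp
  · simp only
    rw [← Matrix.mul_assoc, J_transpose_mul_J, Matrix.one_mul, diagMat_mul_J]

/-- The Gram matrix of the graph for the form of `g` is `Q g - g Qᵀ`; the case `g = 1` is symmetry,
and the others then say that `Q` commutes with `g`. -/
lemma graphOf_mem_isoGr_iff {Q : Matrix (Fin k) (Fin k) ℂ} :
    graphOf Q ∈ isoGr (formsOf ρ) ↔ Q ∈ invariantSym ρ := by
  have key : ∀ g, (frameFst k + frameSnd k * Qᵀ)ᵀ * (Matrix.J (Fin k) ℂ * diagMat ρ g) *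
      (frameFst k + frameSnd k * Qᵀ) = Q * complexMat ρ g - complexMat ρ g * Qᵀ := by
    intro g
    rw [fst_add_snd_mul, J_mul_diagMat, Matrix.transpose_fromRows, Matrix.transpose_one,
      Matrix.transpose_transpose, Matrix.fromCols_mul_fromBlocks, Matrix.fromCols_mul_fromRows]
    simp [sub_eq_add_neg]
  rw [(spans_graphOf Q).mem_isoGr_iff]
  simp only [formsOf, Set.forall_mem_range, key, sub_eq_zero]
  constructor
  · intro h
    have h1 : Qᵀ = Q := by
      have := h 1
      rw [complexMat_one, Matrix.mul_one, Matrix.one_mul] at this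
      exact this.symm
    exact ⟨h1, fun g => by rw [h g, h1]⟩
  · rintro ⟨h1, h2⟩ g
    rw [h1.eq, h2]

lemma image_graphOf_invariantSym :
    graphOf '' invariantSym ρ = isoGr (formsOf ρ) ∩ chart (frameSnd k) := by
  ext L
  rw [Set.mem_inter_iff, mem_chart_snd_iff]
  constructor
  · rintro ⟨Q, hQ, rfl⟩
    exact ⟨(graphOf_mem_isoGr_iff ρ).2 hQ, Q, rfl⟩
  · rintro ⟨h, Q, rfl⟩
    exact ⟨Q, (graphOf_mem_isoGr_iff ρ).1 h, rfl⟩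

lemma isoGr_formsOf_subset : isoGr (formsOf ρ) ⊆ lagrangianGr k :=
  fun _ h x hx y hy => h _ (J_mem_formsOf ρ) x hx y hy

lemma closureSym_eq : closureSym ρ = closure (isoGr (formsOf ρ) ∩ chart (frameSnd k)) := by
  rw [closureSym, image_graphOf_invariantSym]
  exact Set.inter_eq_right.2 (closure_graphs_subset.trans (isoGr_formsOf_subset ρ))

theorem isClosed_zariski_closureSym : IsClosed[zariskiTopology (HalfGr k)] (closureSym ρ) := by
  rw [closureSym_eq]
  exact isClosed_zariski_closure_graphs fun L => orth_mem_isoGr_formsOf ρ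

lemma firstSummand_mem_formsOf : firstSummand k ∈ isoGr (formsOf ρ) := by
  refine firstSummand_mem_isoGr ?_
  rintro _ ⟨g, rfl⟩
  simp only [J_mul_diagMat, Matrix.toBlocks_fromBlocks₁₁]

theorem closureSym_eq_connectedComponentIn :
    closureSym ρ = connectedComponentIn (invariantLagrangians ρ) (firstSummand k) := by
  rw [closureSym_eq, invariantLagrangians_eq]
  refine closure_graphs_eq_connectedComponentIn (fun L => orth_mem_isoGr_formsOf ρ)
    spans_secondSummand (firstSummand_mem_formsOf ρ) (secondSummand_mem_isoGr ?_)
  rintro _ ⟨g, rfl⟩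
  simp only [J_mul_diagMat, Matrix.toBlocks_fromBlocks₂₂]

end InvariantLagrangians

/-! ### Linear images and symplectic complements on frames -/

section FrameMaps

variable {k m : ℕ}

lemma Spans.exists_left_inverse {M : Matrix (Fin k ⊕ Fin k) (Fin k) ℂ} {L : HalfGr k}
    (h : Spans M L) : ∃ N : Matrix (Fin k) (Fin k ⊕ Fin k) ℂ, N * M = 1 := by
  obtain ⟨B, hB⟩ := exists_spans (orth L)
  have h1 := Matrix.nonsing_inv_mul _ (isUnit_iff_ne_zero.2 (isFramePair_orth h hB))
  rw [Matrix.mul_fromCols] at h1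
  refine ⟨((Matrix.fromCols M B)⁻¹).toRows₁, ?_⟩
  ext i j
  have := congrFun (congrFun h1 (Sum.inl i)) (Sum.inl j)
  rw [Matrix.fromCols_apply_inl] at this
  refine Eq.trans this ?_
  simp [Matrix.one_apply]

/-- The matrix of the coordinates of a frame. -/
def coordMatrix (k : ℕ) :
    Matrix (Fin k ⊕ Fin k) (Fin k) (MvPolynomial ((Fin k ⊕ Fin k) × Fin k) ℂ) :=
  Matrix.of fun a j => MvPolynomial.X (a, j)

lemma map_eval_coordMatrix (B : (Fin k ⊕ Fin k) × Fin k → ℂ) :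
    (coordMatrix k).map (MvPolynomial.eval B) = Matrix.of fun a j => B (a, j) := by
  ext
  simp [coordMatrix]

/-- A constant matrix of polynomials. -/
def constMatrix (k : ℕ) {p q : Type} (E : Matrix p q ℂ) :
    Matrix p q (MvPolynomial ((Fin k ⊕ Fin k) × Fin k) ℂ) :=
  E.map MvPolynomial.C

lemma map_eval_constMatrix {p q : Type} (B : (Fin k ⊕ Fin k) × Fin k → ℂ) (E : Matrix p q ℂ) :
    (constMatrix k E).map (MvPolynomial.eval B) = E := by
  ext
  simp [constMatrix]

/-- The map induced on frames by a linear map of constant rank on `S`. -/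
lemma isFrameMapOn_map {E : Matrix (Fin m ⊕ Fin m) (Fin k ⊕ Fin k) ℂ} {S : Set (HalfGr k)}
    {f : HalfGr k → HalfGr m} (hf : ∀ L ∈ S, (f L).1 = L.1.map E.mulVecLin) :
    IsFrameMapOn S f := by
  intro L hL A hA
  have hA' := isFrame_iff.1 hA
  set M : Matrix (Fin k ⊕ Fin k) (Fin k) ℂ := Matrix.of fun a j => A (a, j)
  obtain ⟨M', hM'⟩ := exists_spans (f L)
  have h1 : ∀ j, ∃ v, E *ᵥ (M *ᵥ v) = M'.col j := fun j => by
    have : M'.col j ∈ L.1.map E.mulVecLin := by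
      rw [← hf L hL, ← Matrix.mulVec_single_one]
      exact hM'.mulVec_mem _
    obtain ⟨x, hx, hx'⟩ := this
    obtain ⟨v, rfl⟩ := hA'.mem_iff.1 hx
    exact ⟨v, hx'⟩
  choose v hv using h1
  -- The columns of `E M` are in general dependent; the constant matrix `C`, fixed at the given
  -- frame, selects combinations that form a frame of the image.
  let C : Matrix (Fin k) (Fin m) ℂ := Matrix.of fun i j => v j i
  have hC : E * M * C = M' := by
    ext a j
    have := congrFun (hv j) a
    rw [Matrix.mulVec_mulVec] at this
    exact this
  -- With a left inverse `N` of this frame, the determinant of `N E B C` is a polynomial in `B`,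
  -- equal to one at the given frame, whose non-vanishing forces `E B C` to be injective.
  obtain ⟨N, hN⟩ := hM'.exists_left_inverse
  let D : Matrix (Fin m ⊕ Fin m) (Fin m) (MvPolynomial ((Fin k ⊕ Fin k) × Fin k) ℂ) :=
    constMatrix k E * coordMatrix k * constMatrix k C
  have hD : ∀ B : (Fin k ⊕ Fin k) × Fin k → ℂ, D.map (MvPolynomial.eval B) =
      E * (Matrix.of fun a j => B (a, j)) * C := by
    intro B
    simp only [D, Matrix.map_mul, map_eval_constMatrix, map_eval_coordMatrix]
  have hdet : ∀ B : (Fin k ⊕ Fin k) × Fin k → ℂ,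
      MvPolynomial.eval B (constMatrix k N * D).det =
        (N * (E * (Matrix.of fun a j => B (a, j)) * C)).det := by
    intro B
    rw [RingHom.map_det, ← hD B, RingHom.mapMatrix_apply, Matrix.map_mul, map_eval_constMatrix]
  refine ⟨(constMatrix k N * D).det, fun c : (Fin m ⊕ Fin m) × Fin m => D c.1 c.2, ?_,
    fun L' hL' B hB hQ => ?_⟩
  · rw [hdet, hC, hN, Matrix.det_one]
    exact one_ne_zero
  · rw [hdet] at hQ
    have hB' := isFrame_iff.1 hB
    have h3 : Spans (D.map (MvPolynomial.eval B)) (f L') := by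
      rw [hD]
      refine spans_of_injective ?_ fun v => ?_
      · intro v w hvw
        refine Matrix.mulVec_injective_iff_isUnit.2
          ((Matrix.isUnit_iff_isUnit_det _).2 (isUnit_iff_ne_zero.2 hQ)) ?_
        rw [← Matrix.mulVec_mulVec, hvw, Matrix.mulVec_mulVec]
      · rw [hf L' hL', ← Matrix.mulVec_mulVec, ← Matrix.mulVec_mulVec]
        exact Submodule.mem_map_of_mem (f := E.mulVecLin) (hB'.mulVec_mem _)
    exact h3.isFrame

/-- In the basis `P` adapted to `L` a frame has blocks `p` and `r`, and up to the fixed matrix `U`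
the complement has the frame with blocks `-(p⁻¹)ᵀ rᵀ` and `1`. Multiplying by `det p` replaces the
inverse by the adjugate, so all entries are polynomials; `p` is invertible at `L`. -/
lemma isFrameMapOn_perpJ (S : Set (HalfGr k)) : IsFrameMapOn S (perpJ : HalfGr k → HalfGr k) := by
  intro L hL A hA
  have hA' := isFrame_iff.1 hA
  set M : Matrix (Fin k ⊕ Fin k) (Fin k) ℂ := Matrix.of fun a j => A (a, j)
  obtain ⟨M₂, hM₂⟩ := exists_spans (orth L)
  have hM := isFramePair_orth hA' hM₂
  set P := Matrix.fromCols M M₂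
  have hP : IsUnit P.det := isUnit_iff_ne_zero.2 hM
  set J := Matrix.J (Fin k) ℂ
  let U := J⁻¹ * (P⁻¹)ᵀ
  have hJU : Matrix.J (Fin k) ℂ * U = (P⁻¹)ᵀ := by
    rw [← Matrix.mul_assoc, Matrix.mul_nonsing_inv _ (Matrix.isUnit_det_J _ _), Matrix.one_mul]
  have hU : IsUnit U := (Matrix.isUnit_nonsing_inv_iff.2 ((Matrix.isUnit_iff_isUnit_det _).2
    (Matrix.isUnit_det_J _ _))).mul ((Matrix.isUnit_transpose _).2
      (Matrix.isUnit_nonsing_inv_iff.2 ((Matrix.isUnit_iff_isUnit_det _).2 hP)))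
  let X := constMatrix k P⁻¹ * coordMatrix k
  let D : Matrix (Fin k ⊕ Fin k) (Fin k) (MvPolynomial ((Fin k ⊕ Fin k) × Fin k) ℂ) :=
    constMatrix k U *
      Matrix.fromRows (-(X.toRows₁.adjugateᵀ * X.toRows₂ᵀ)) (X.toRows₁.det • (1 : Matrix (Fin k) (Fin k) _))
  have hX : ∀ B, X.map (MvPolynomial.eval B) = P⁻¹ * Matrix.of fun a j => B (a, j) := fun B => by
    simp only [X, Matrix.map_mul, map_eval_constMatrix, map_eval_coordMatrix]
  have hX₁ : ∀ B, X.toRows₁.map (MvPolynomial.eval B) =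
      (P⁻¹ * Matrix.of fun a j => B (a, j)).toRows₁ := fun B => by
    rw [← hX]; rfl
  have hX₂ : ∀ B, X.toRows₂.map (MvPolynomial.eval B) =
      (P⁻¹ * Matrix.of fun a j => B (a, j)).toRows₂ := fun B => by
    rw [← hX]; rfl
  have hdet : ∀ B, MvPolynomial.eval B X.toRows₁.det =
      (P⁻¹ * Matrix.of fun a j => B (a, j)).toRows₁.det := fun B => by
    rw [RingHom.map_det, RingHom.mapMatrix_apply, hX₁]
  have hadj : ∀ B, X.toRows₁.adjugate.map (MvPolynomial.eval B) =
      (P⁻¹ * Matrix.of fun a j => B (a, j)).toRows₁.adjugate := fun B => by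
    rw [← RingHom.mapMatrix_apply, RingHom.map_adjugate, RingHom.mapMatrix_apply, hX₁]
  have hD : ∀ B, D.map (MvPolynomial.eval B) = U * Matrix.fromRows
      (-((P⁻¹ * Matrix.of fun a j => B (a, j)).toRows₁.adjugateᵀ *
        (P⁻¹ * Matrix.of fun a j => B (a, j)).toRows₂ᵀ))
      ((P⁻¹ * Matrix.of fun a j => B (a, j)).toRows₁.det • (1 : Matrix (Fin k) (Fin k) ℂ)) := by
    intro B
    simp only [D, Matrix.map_mul, map_eval_constMatrix]
    congr 1
    rw [← hadj, ← hX₂, ← hdet, ← Matrix.transpose_map, ← Matrix.transpose_map,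
      ← Matrix.map_mul]
    ext (i | i) j
    · exact map_neg (MvPolynomial.eval B) _
    · by_cases h : i = j <;> simp [h]
  refine ⟨X.toRows₁.det, fun c : (Fin k ⊕ Fin k) × Fin k => D c.1 c.2, ?_,
    fun L' hL' B hB hQ => ?_⟩
  · rw [hdet]
    exact (hM.isUnit_rows hM).ne_zero
  · rw [hdet] at hQ
    have hB' := isFrame_iff.1 hB
    have h3 : Spans (D.map (MvPolynomial.eval B)) (perpJ L') := by
      rw [hD]
      set C : Matrix (Fin k ⊕ Fin k) (Fin k) ℂ := Matrix.of fun a j => B (a, j)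
      set p := (P⁻¹ * C).toRows₁ with hp
      set r := (P⁻¹ * C).toRows₂ with hr
      refine spans_of_injective ?_ fun w x hx => ?_
      · have : Function.Injective (U * Matrix.fromRows (-(p.adjugateᵀ * rᵀ))
            (p.det • (1 : Matrix (Fin k) (Fin k) ℂ))).mulVecLin := by
          rw [← LinearMap.ker_eq_bot, LinearMap.ker_eq_bot']
          intro w hw
          rw [Matrix.mulVecLin_apply, ← Matrix.mulVec_mulVec] at hw
          have h4 := Matrix.mulVec_injective_iff_isUnit.2 hU (hw.trans (Matrix.mulVec_zero _).symm)
          ext i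
          have h5 := congrFun h4 (Sum.inr i)
          rw [Matrix.fromRows_mulVec, Sum.elim_inr, Matrix.smul_mulVec, Matrix.one_mulVec,
            Pi.smul_apply, smul_eq_mul] at h5
          exact (mul_eq_zero.1 h5).resolve_left hQ
        exact this
      · obtain ⟨v, rfl⟩ := hB'.mem_iff.1 hx
        rw [dotProduct_mulVec_mulVec]
        have h4 : Cᵀ * Matrix.J (Fin k) ℂ * (U * Matrix.fromRows (-(p.adjugateᵀ * rᵀ))
            (p.det • (1 : Matrix (Fin k) (Fin k) ℂ))) = 0 := by
          have h5 : Cᵀ * (P⁻¹)ᵀ = Matrix.fromCols pᵀ rᵀ := by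
            rw [← Matrix.transpose_mul, ← Matrix.transpose_fromRows, hp, hr,
              Matrix.fromRows_toRows]
          rw [Matrix.mul_assoc, ← Matrix.mul_assoc _ U, hJU, ← Matrix.mul_assoc, h5,
            Matrix.fromCols_mul_fromRows, Matrix.mul_neg, ← Matrix.mul_assoc,
            ← Matrix.transpose_mul, Matrix.adjugate_mul]
          simp
        rw [h4, Matrix.zero_mulVec, dotProduct_zero]
    exact h3.isFrame

/-- The dimension of the image under a linear map is lower semicontinuous. -/
lemma isClosed_finrank_map_le (E : Matrix (Fin m ⊕ Fin m) (Fin k ⊕ Fin k) ℂ) (d : ℕ) :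
    IsClosed {L : HalfGr k | Module.finrank ℂ (L.1.map E.mulVecLin) ≤ d} := by
  rw [← isOpen_compl_iff, isOpen_analytic_iff]
  intro L hL A hA
  have hA' := isFrame_iff.1 hA
  rw [Set.mem_compl_iff, Set.mem_ofPred_eq, not_le] at hL
  obtain ⟨b, hb⟩ := exists_linearIndependent_of_le_finrank (Nat.succ_le_of_lt hL)
  have hb' : LinearIndependent ℂ fun j => (b j : Fin m ⊕ Fin m → ℂ) :=
    hb.map' (Submodule.subtype _) (Submodule.ker_subtype _)
  have h1 : ∀ j, ∃ v, E *ᵥ ((Matrix.of fun a j => A (a, j)) *ᵥ v) = b j := fun j => by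
    obtain ⟨x, hx, hx'⟩ := (b j).2
    obtain ⟨v, rfl⟩ := hA'.mem_iff.1 hx
    exact ⟨v, hx'⟩
  choose v hv using h1
  let Φ : ((Fin k ⊕ Fin k) × Fin k → ℂ) → Fin (d + 1) → Fin m ⊕ Fin m → ℂ :=
    fun B j => E *ᵥ ((Matrix.of fun a j => B (a, j)) *ᵥ v j)
  have hΦ : Continuous Φ := by
    refine continuous_pi fun j => continuous_pi fun i => ?_
    simp only [Φ, Matrix.mulVec, dotProduct, Matrix.of_apply]
    fun_prop
  -- If the image has dimension more than `d`, it contains `d + 1` independent vectors; they depend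
  -- continuously on the frame and independence is an open condition.
  refine ⟨Φ ⁻¹' {f | LinearIndependent ℂ f}, isOpen_setOfPred_linearIndependent.preimage hΦ, ?_, ?_⟩
  · have : Φ A = fun j => (b j : Fin m ⊕ Fin m → ℂ) := funext hv
    rw [Set.mem_preimage, this]
    exact hb'
  · intro L' B hB hB'
    have hB'' := isFrame_iff.1 hB
    rw [Set.mem_compl_iff, Set.mem_ofPred_eq, not_le]
    have hmem : ∀ j, Φ B j ∈ L'.1.map E.mulVecLin := fun j =>
      Submodule.mem_map_of_mem (f := E.mulVecLin) (hB''.mulVec_mem _)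
    have h2 : LinearIndependent ℂ fun j => (⟨Φ B j, hmem j⟩ : L'.1.map E.mulVecLin) :=
      LinearIndependent.of_comp (Submodule.subtype _) hB'
    have := h2.fintype_card_le_finrank
    rwa [Fintype.card_fin] at this

end FrameMaps

/-! ### Splitting of `ℂ^{2k}` into isotypic pieces -/

section Split

instance instFintypeTypeOne {r : ℕ} (t : Fin (r + 1) → RepType) :
    Fintype {i // t i = RepType.one} := Fintype.ofFinite _

/-- The index set of the complex irreducible representations: one for each real irreducible
representation, and a second one for those of type 1. -/
abbrev CIdx {r : ℕ} (t : Fin (r + 1) → RepType) : Type := Fin (r + 1) ⊕ {i // t i = RepType.one}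

/-- The real irreducible representation to which a complex one belongs. -/
abbrev CIdx.base {r : ℕ} {t : Fin (r + 1) → RepType} : CIdx t → Fin (r + 1) :=
  Sum.elim id Subtype.val

/-- A splitting of `ℂ^{2k}` into copies `F a s` of `ℂ^{2m}`, with projections `E a s`, that is
adapted to the action of `G` and to the symplectic form. -/
structure SplitData {G : Type*} [Group G] {k : ℕ} (ρ : G →* Matrix.orthogonalGroup (Fin k) ℝ)
    {r : ℕ} (t : Fin (r + 1) → RepType) (m : Fin (r + 1) → ℕ) where
  d : Fin (r + 1) → ℕ
  d_pos : ∀ i, 0 < d i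
  F : ∀ a : CIdx t, Fin (d a.base) →
    Matrix (Fin k ⊕ Fin k) (Fin (m a.base) ⊕ Fin (m a.base)) ℂ
  E : ∀ a : CIdx t, Fin (d a.base) →
    Matrix (Fin (m a.base) ⊕ Fin (m a.base)) (Fin k ⊕ Fin k) ℂ
  E_mul_F_self : ∀ a s, E a s * F a s = 1
  E_mul_F_of_ne : ∀ a s s', s ≠ s' → E a s * F a s' = 0
  E_mul_F_of_ne' : ∀ a b s s', a ≠ b → E a s * F b s' = 0
  sum_F_mul_E : ∑ a, ∑ s, F a s * E a s = 1
  stable : ∀ L ∈ isoGr (formsOf ρ), ∀ (a : CIdx t) (s s' : Fin (d a.base)), ∀ x ∈ L.1, (F a s * E a s') *ᵥ x ∈ L.1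
  diagMat_mul_F : ∀ (g : G) (a : CIdx t) (s : Fin (d a.base)), ∃ D : Fin (d a.base) → ℂ, diagMat ρ g * F a s = ∑ s', D s' • F a s'
  F_snd : ∀ (a : CIdx t) (s : Fin (d a.base)), ∀ x ∈ (secondSummand (m a.base)).1, F a s *ᵥ x ∈ (secondSummand k).1
  E_fst : ∀ (a : CIdx t) (s : Fin (d a.base)), ∀ x ∈ (firstSummand k).1, E a s *ᵥ x ∈ (firstSummand (m a.base)).1
  pair_one : ∀ i (h : t i = .one), ∃ c : Fin (d i) → Fin (d i) → ℂ, (∃ s s', c s s' ≠ 0) ∧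
    ∀ s s', (F (.inl i) s)ᵀ * Matrix.J (Fin k) ℂ * F (.inr ⟨i, h⟩) s' =
      c s s' • Matrix.J (Fin (m i)) ℂ
  pair_two : ∀ i, t i = .two → ∃ c : Fin (d i) → Fin (d i) → ℂ, (∃ s s', c s s' ≠ 0) ∧
    ∀ s s', (F (.inl i) s)ᵀ * Matrix.J (Fin k) ℂ * F (.inl i) s' = c s s' • Matrix.J (Fin (m i)) ℂ
  pair_three : ∀ i, t i = .three → ∃ c : Fin (d i) → Fin (d i) → ℂ, (∃ s s', c s s' ≠ 0) ∧
    ∀ s s', (F (.inl i) s)ᵀ * Matrix.J (Fin k) ℂ * F (.inl i) s' = c s s' • matK (m i)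
  pair_base : ∀ a b : CIdx t, a.base ≠ b.base → ∀ s s',
    (F a s)ᵀ * Matrix.J (Fin k) ℂ * F b s' = 0
  pair_inl : ∀ i, t i = .one → ∀ s s',
    (F (.inl i) s)ᵀ * Matrix.J (Fin k) ℂ * F (.inl i) s' = 0
  pair_inr : ∀ i s s', (F (.inr i) s)ᵀ * Matrix.J (Fin k) ℂ * F (.inr i) s' = 0

namespace SplitData

variable {G : Type*} [Group G] {k : ℕ} {ρ : G →* Matrix.orthogonalGroup (Fin k) ℝ}
  {r : ℕ} {t : Fin (r + 1) → RepType} {m : Fin (r + 1) → ℕ} (D : SplitData ρ t m)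

/-- The index of the first copy. -/
def s₀ (i : Fin (r + 1)) : Fin (D.d i) := ⟨0, D.d_pos i⟩

/-- The multiplicity space of a subspace. -/
def piece (L : Submodule ℂ (Fin k ⊕ Fin k → ℂ)) (a : CIdx t) :
    Submodule ℂ (Fin (m a.base) ⊕ Fin (m a.base) → ℂ) :=
  L.map (D.E a (D.s₀ a.base)).mulVecLin

/-- The subspace is stable under the elementary operators. -/
def IsStable (L : Submodule ℂ (Fin k ⊕ Fin k → ℂ)) : Prop :=
  ∀ a s s', ∀ x ∈ L, (D.F a s * D.E a s') *ᵥ x ∈ L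

lemma sum_F_E_mulVec (x : Fin k ⊕ Fin k → ℂ) :
    ∑ a, ∑ s, D.F a s *ᵥ (D.E a s *ᵥ x) = x := by
  conv_rhs => rw [← Matrix.one_mulVec x, ← D.sum_F_mul_E]
  simp only [Matrix.sum_mulVec, Matrix.mulVec_mulVec]

lemma E_F_self (a : CIdx t) (s) (y : Fin (m a.base) ⊕ Fin (m a.base) → ℂ) :
    D.E a s *ᵥ (D.F a s *ᵥ y) = y := by
  rw [Matrix.mulVec_mulVec, D.E_mul_F_self, Matrix.one_mulVec]

lemma E_sum_F (y : ∀ a : CIdx t, Fin (D.d a.base) → Fin (m a.base) ⊕ Fin (m a.base) → ℂ)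
    (a : CIdx t) (s) : D.E a s *ᵥ (∑ b, ∑ s', D.F b s' *ᵥ y b s') = y a s := by
  classical
  rw [Matrix.mulVec_sum, Finset.sum_eq_single a]
  · rw [Matrix.mulVec_sum, Finset.sum_eq_single s]
    · exact D.E_F_self a s _
    · intro s' _ hs
      rw [Matrix.mulVec_mulVec, D.E_mul_F_of_ne a s s' hs.symm, Matrix.zero_mulVec]
    · simp
  · intro b _ hb
    rw [Matrix.mulVec_sum]
    refine Finset.sum_eq_zero fun s' _ => ?_
    rw [Matrix.mulVec_mulVec, D.E_mul_F_of_ne' a b s s' hb.symm, Matrix.zero_mulVec]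
  · simp

-- `piece` is read off from the copy `s₀`; the matrix unit from copy `s` to copy `s₀` preserves `L`,
-- so all copies yield the same subspace.
variable {D} in
lemma IsStable.E_mem {L : Submodule ℂ (Fin k ⊕ Fin k → ℂ)} (h : D.IsStable L)
    (a : CIdx t) (s) {x} (hx : x ∈ L) : D.E a s *ᵥ x ∈ D.piece L a := by
  refine ⟨_, h a (D.s₀ _) s x hx, ?_⟩
  rw [Matrix.mulVecLin_apply, ← Matrix.mulVec_mulVec, D.E_F_self]

variable {D} in
lemma IsStable.F_mem {L : Submodule ℂ (Fin k ⊕ Fin k → ℂ)} (h : D.IsStable L)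
    (a : CIdx t) (s) {y} (hy : y ∈ D.piece L a) : D.F a s *ᵥ y ∈ L := by
  obtain ⟨x, hx, rfl⟩ := hy
  rw [Matrix.mulVecLin_apply, Matrix.mulVec_mulVec]
  exact h a s _ x hx

-- A stable subspace is the direct sum over all copies of its multiplicity spaces; the projections
-- `E` and inclusions `F` are the two directions.
variable {D} in
lemma IsStable.finrank_eq {L : Submodule ℂ (Fin k ⊕ Fin k → ℂ)} (h : D.IsStable L) :
    Module.finrank ℂ L = ∑ a : CIdx t, D.d a.base * Module.finrank ℂ (D.piece L a) := by
  let e : L ≃ₗ[ℂ] (∀ a : CIdx t, Fin (D.d a.base) → D.piece L a) :=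
    { toFun := fun x a s => ⟨D.E a s *ᵥ x.1, h.E_mem a s x.2⟩
      map_add' := fun x y => by
        funext a s
        exact Subtype.ext (Matrix.mulVec_add (D.E a s) x.1 y.1)
      map_smul' := fun c x => by
        funext a s
        exact Subtype.ext (Matrix.mulVec_smul (D.E a s) c x.1)
      invFun := fun y => ⟨∑ a, ∑ s, D.F a s *ᵥ (y a s).1,
        Submodule.sum_mem _ fun a _ => Submodule.sum_mem _ fun s _ => h.F_mem a s (y a s).2⟩
      left_inv := fun x => Subtype.ext (D.sum_F_E_mulVec x.1)
      right_inv := fun y => by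
        funext a s
        exact Subtype.ext (D.E_sum_F (fun a s => (y a s).1) a s) }
  rw [e.finrank_eq, Module.finrank_pi_fintype]
  refine Finset.sum_congr rfl fun a _ => ?_
  rw [Module.finrank_pi_fintype, Finset.sum_const, Finset.card_univ, Fintype.card_fin, smul_eq_mul]

/-- The dimension formula applied to the whole space, whose multiplicity spaces are everything. -/
lemma sum_d_mul_m : ∑ a : CIdx t, D.d a.base * m a.base = k := by
  have h : D.IsStable ⊤ := fun _ _ _ _ _ => Submodule.mem_top
  have h1 := h.finrank_eq
  have h2 : ∀ a : CIdx t, D.piece ⊤ a = ⊤ := fun a =>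
    eq_top_iff.2 fun y _ => ⟨D.F a (D.s₀ _) *ᵥ y, Submodule.mem_top, D.E_F_self a _ y⟩
  have h4 : ∀ a : CIdx t, Module.finrank ℂ (D.piece ⊤ a) = m a.base + m a.base := fun a => by
    rw [h2, finrank_top, Module.finrank_fintype_fun_eq_card, Fintype.card_sum, Fintype.card_fin]
  rw [finrank_top, Module.finrank_fintype_fun_eq_card, Fintype.card_sum, Fintype.card_fin] at h1
  have h3 : k + k = (∑ a : CIdx t, D.d a.base * m a.base) +
      ∑ a : CIdx t, D.d a.base * m a.base := by
    rw [h1, ← Finset.sum_add_distrib]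
    exact Finset.sum_congr rfl fun a _ => by rw [h4, mul_add]
  omega

lemma isStable_of_mem {L : HalfGr k} (hL : L ∈ isoGr (formsOf ρ)) : D.IsStable L.1 :=
  D.stable L hL

/-- For a graph, the multiplicity space meets `0 ⊕ ℂ^m` only in zero, which bounds its dimension.
The bound is a closed condition and passes to the closure. -/
lemma finrank_piece_le {L : HalfGr k} (hL : L ∈ closureSym ρ) (a : CIdx t) :
    Module.finrank ℂ (D.piece L.1 a) ≤ m a.base := by
  rw [closureSym_eq] at hL
  refine closure_minimal (fun L hL => ?_) (isClosed_finrank_map_le (D.E a (D.s₀ _)) _) hL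
  change Module.finrank ℂ (D.piece L.1 a) ≤ m a.base
  have hst := D.isStable_of_mem hL.1
  have h0 : D.piece L.1 a ⊓ (secondSummand (m a.base)).1 = ⊥ := by
    rw [eq_bot_iff]
    rintro y ⟨hy, hy'⟩
    have h1 : D.F a (D.s₀ _) *ᵥ y ∈ L.1 ⊓ sndSub k :=
      ⟨hst.F_mem a _ hy, by rw [← secondSummand_val]; exact D.F_snd a _ y hy'⟩
    rw [inf_eq_bot_of_mem_chart_snd hL.2, Submodule.mem_bot] at h1
    rw [← D.E_F_self a (D.s₀ _) y, h1, Matrix.mulVec_zero]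
    exact Submodule.zero_mem _
  have h2 := Submodule.finrank_sup_add_finrank_inf_eq (D.piece L.1 a) (secondSummand (m a.base)).1
  rw [h0, finrank_bot, (secondSummand (m a.base)).2] at h2
  have h3 := Submodule.finrank_le (D.piece L.1 a ⊔ (secondSummand (m a.base)).1)
  rw [Module.finrank_fintype_fun_eq_card, Fintype.card_sum, Fintype.card_fin] at h3
  omega

lemma mem_isoGr_of_mem {L : HalfGr k} (hL : L ∈ closureSym ρ) : L ∈ isoGr (formsOf ρ) := by
  rw [closureSym_eq] at hL
  exact closure_graphs_subset hL

/-- The upper bounds, weighted by the `d`, add up to exactly the dimension `k` of `L`, so each is an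
equality. -/
lemma finrank_piece {L : HalfGr k} (hL : L ∈ closureSym ρ) (a : CIdx t) :
    Module.finrank ℂ (D.piece L.1 a) = m a.base := by
  have h1 := (D.isStable_of_mem (mem_isoGr_of_mem hL)).finrank_eq
  replace h1 := h1.symm.trans (L.2.trans D.sum_d_mul_m.symm)
  have h2 := (Finset.sum_eq_sum_iff_of_le fun b _ =>
    Nat.mul_le_mul_left (D.d b.base) (D.finrank_piece_le hL b)).1 h1 a (Finset.mem_univ a)
  exact Nat.eq_of_mul_eq_mul_left (D.d_pos _) h2

open Classical in
/-- The multiplicity space as a point of a Grassmannian. -/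
def part (a : CIdx t) (L : HalfGr k) : HalfGr (m a.base) :=
  if h : Module.finrank ℂ (D.piece L.1 a) = m a.base then ⟨D.piece L.1 a, h⟩
  -- A default value, never reached on `closureSym ρ`.
  else firstSummand _

lemma part_val (a : CIdx t) {L : HalfGr k} (hL : L ∈ closureSym ρ) :
    (D.part a L).1 = D.piece L.1 a := by
  have h : D.part a L = ⟨D.piece L.1 a, D.finrank_piece hL a⟩ := dif_pos (D.finrank_piece hL a)
  rw [h]

lemma isFrameMapOn_part (a : CIdx t) : IsFrameMapOn (closureSym ρ) (D.part a) :=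
  isFrameMapOn_map fun _ hL => D.part_val a hL

lemma exists_glue (L : ∀ a : CIdx t, HalfGr (m a.base)) :
    ∃ P : HalfGr k, (∀ y, y ∈ P.1 ↔ ∀ a s, D.E a s *ᵥ y ∈ (L a).1) := by
  let Q : Submodule ℂ (Fin k ⊕ Fin k → ℂ) :=
    ⨅ a, ⨅ s, (L a).1.comap (D.E a s).mulVecLin
  have hQ : ∀ y, y ∈ Q ↔ ∀ a s, D.E a s *ᵥ y ∈ (L a).1 := fun y => by
    simp [Q, Submodule.mem_iInf]
  have hF : ∀ (a : CIdx t) s y, y ∈ (L a).1 → D.F a s *ᵥ y ∈ Q := by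
    intro a s y hy
    rw [hQ]
    intro b s'
    by_cases hab : b = a
    · subst hab
      by_cases hs : s' = s
      · subst hs
        rwa [D.E_F_self]
      · rw [Matrix.mulVec_mulVec, D.E_mul_F_of_ne _ _ _ hs, Matrix.zero_mulVec]
        exact Submodule.zero_mem _
    · rw [Matrix.mulVec_mulVec, D.E_mul_F_of_ne' _ _ _ _ hab, Matrix.zero_mulVec]
      exact Submodule.zero_mem _
  have hst : D.IsStable Q := by
    intro a s s' x hx
    rw [← Matrix.mulVec_mulVec]
    exact hF a s _ ((hQ x).1 hx a s')
  have hp : ∀ a : CIdx t, D.piece Q a = (L a).1 := by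
    intro a
    ext y
    constructor
    · rintro ⟨x, hx, rfl⟩
      exact (hQ x).1 hx a _
    · intro hy
      exact ⟨_, hF a (D.s₀ _) y hy, D.E_F_self a _ y⟩
  have hfin : Module.finrank ℂ Q = k := by
    rw [hst.finrank_eq]
    refine Eq.trans ?_ D.sum_d_mul_m
    exact Finset.sum_congr rfl fun a _ => by rw [hp, (L a).2]
  exact ⟨⟨Q, hfin⟩, hQ⟩

/-- The subspace with given multiplicity spaces. -/
def glue (L : ∀ a : CIdx t, HalfGr (m a.base)) : HalfGr k := (D.exists_glue L).choose

lemma mem_glue {L : ∀ a : CIdx t, HalfGr (m a.base)} {y : Fin k ⊕ Fin k → ℂ} :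
    y ∈ (D.glue L).1 ↔ ∀ a s, D.E a s *ᵥ y ∈ (L a).1 := (D.exists_glue L).choose_spec y

/-- The columns of the products of `F a s` with a frame of `L a`, over all `a` and `s`, form a frame
of the glued subspace; they are linear in the coordinates. The bijection `e` only numbers them from
`0` to `k - 1`. -/
lemma isFrameMapOn_glue (S : Set (∀ a : CIdx t, HalfGr (m a.base))) :
    IsFrameMapOn S D.glue := by
  have hcard : Fintype.card (Fin k) =
      Fintype.card (Σ a : CIdx t, Fin (D.d a.base) × Fin (m a.base)) := by
    rw [Fintype.card_fin, Fintype.card_sigma]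
    simp only [Fintype.card_prod, Fintype.card_fin]
    exact D.sum_d_mul_m.symm
  let e := Fintype.equivOfCardEq hcard
  intro L hL A hA
  refine ⟨1, fun c : (Fin k ⊕ Fin k) × Fin k => ∑ b, MvPolynomial.C
    (D.F (e c.2).1 (e c.2).2.1 c.1 b) * MvPolynomial.X ⟨(e c.2).1, (b, (e c.2).2.2)⟩, by simp,
    fun L' _ B hB _ => ?_⟩
  have hB' : ∀ a, Spans (Matrix.of fun b j => B ⟨a, (b, j)⟩) (L' a) := fun a => isFrame_iff.1 (hB a)
  rw [isFrame_iff]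
  set M : Matrix (Fin k ⊕ Fin k) (Fin k) ℂ := Matrix.of fun x j =>
    MvPolynomial.eval B (∑ b, MvPolynomial.C (D.F (e j).1 (e j).2.1 x b) *
      MvPolynomial.X ⟨(e j).1, (b, (e j).2.2)⟩) with hM
  have key : ∀ v, M *ᵥ v = ∑ a, ∑ s, D.F a s *ᵥ ((Matrix.of fun b j => B ⟨a, (b, j)⟩) *ᵥ
      fun j => v (e.symm ⟨a, (s, j)⟩)) := by
    intro v
    ext x
    have h1 : (M *ᵥ v) x = ∑ p : (Σ a : CIdx t, Fin (D.d a.base) × Fin (m a.base)),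
        M x (e.symm p) * v (e.symm p) := by
      rw [Matrix.mulVec, dotProduct]
      exact (Equiv.sum_comp e.symm fun j => M x j * v j).symm
    rw [h1, Fintype.sum_sigma, Finset.sum_apply]
    refine Finset.sum_congr rfl fun a _ => ?_
    rw [Fintype.sum_prod_type, Finset.sum_apply]
    refine Finset.sum_congr rfl fun s _ => ?_
    rw [Matrix.mulVec_mulVec, Matrix.mulVec, dotProduct]
    refine Finset.sum_congr rfl fun j _ => ?_
    congr 1
    simp only [hM, Matrix.of_apply, map_sum, map_mul, MvPolynomial.eval_C, MvPolynomial.eval_X,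
      Matrix.mul_apply]
    rw [Equiv.apply_symm_apply]
  refine spans_of_injective ?_ fun v => ?_
  · have : Function.Injective M.mulVecLin := by
      rw [← LinearMap.ker_eq_bot, LinearMap.ker_eq_bot']
      intro v hv
      rw [Matrix.mulVecLin_apply, key] at hv
      have h2 : ∀ (a : CIdx t) s, (fun j => v (e.symm ⟨a, (s, j)⟩)) = 0 := by
        intro a s
        apply (hB' a).eq_zero
        rw [← D.E_sum_F (fun a s => (Matrix.of fun b j => B ⟨a, (b, j)⟩) *ᵥ
          fun j => v (e.symm ⟨a, (s, j)⟩)) a s, hv, Matrix.mulVec_zero]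
      funext j
      have := congrFun (h2 (e j).1 (e j).2.1) (e j).2.2
      simpa using this
    exact this
  · rw [D.mem_glue]
    intro a s
    rw [key, D.E_sum_F]
    exact (hB' a).mulVec_mem _

end SplitData

end Split

/-! ### The isomorphism with a product -/

section Product

/-- The factor of the given type in `𝔾^{m,2m}`. -/
def RepType.variety : RepType → (m : ℕ) → Set (HalfGr m)
  | .one, _ => Set.univ
  | .two, m => lagrangianGr m
  | .three, m => specialOrthogonalGr m

lemma RepType.factor_eq (t : RepType) (n : ℕ) : t.factor n = t.variety (t.half n) := by
  cases t <;> rfl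

lemma firstSummand_mem_lagrangianGr (m : ℕ) : firstSummand m ∈ lagrangianGr m := by
  rw [lagrangianGr_eq]
  exact firstSummand_mem_isoGr fun B hB => by
    rw [Set.mem_singleton_iff.1 hB, Matrix.J, Matrix.toBlocks_fromBlocks₁₁]

lemma firstSummand_mem_orthogonalGr (m : ℕ) : firstSummand m ∈ orthogonalGr m := by
  rw [orthogonalGr_eq]
  exact firstSummand_mem_isoGr fun B hB => by
    rw [Set.mem_singleton_iff.1 hB, matK, Matrix.toBlocks_fromBlocks₁₁]

lemma RepType.firstSummand_mem_variety (t : RepType) (m : ℕ) : firstSummand m ∈ t.variety m := by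
  cases t
  · exact Set.mem_univ _
  · exact firstSummand_mem_lagrangianGr m
  · exact mem_connectedComponentIn (firstSummand_mem_orthogonalGr m)

lemma RepType.isPreconnected_variety (t : RepType) (m : ℕ) : IsPreconnected (t.variety m) := by
  cases t
  · exact isPreconnected_halfGr
  · exact isPreconnected_lagrangianGr
  · exact isPreconnected_connectedComponentIn

lemma firstSummand_mem_closureSym {G : Type*} [Group G] {k : ℕ}
    (ρ : G →* Matrix.orthogonalGroup (Fin k) ℝ) : firstSummand k ∈ closureSym ρ := by
  rw [closureSym_eq_connectedComponentIn, invariantLagrangians_eq]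
  exact mem_connectedComponentIn (firstSummand_mem_formsOf ρ)

lemma isPreconnected_closureSym {G : Type*} [Group G] {k : ℕ}
    (ρ : G →* Matrix.orthogonalGroup (Fin k) ℝ) : IsPreconnected (closureSym ρ) := by
  rw [closureSym_eq_connectedComponentIn]
  exact isPreconnected_connectedComponentIn

lemma dotProduct_mulVec_of_eq_smul {p q : Type*} [Fintype p] [Fintype q] {M B : Matrix p q ℂ}
    {c : ℂ} {x : p → ℂ} {y : q → ℂ} (h : M = c • B) (hxy : x ⬝ᵥ (B *ᵥ y) = 0) :
    x ⬝ᵥ (M *ᵥ y) = 0 := by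
  rw [h, Matrix.smul_mulVec, dotProduct_smul, hxy, smul_zero]

lemma dotProduct_transpose_J_mulVec {k : ℕ} {p q : Type*} [Fintype p] [Fintype q]
    (A : Matrix (Fin k ⊕ Fin k) p ℂ) (B : Matrix (Fin k ⊕ Fin k) q ℂ) (x : p → ℂ) (y : q → ℂ) :
    x ⬝ᵥ ((Aᵀ * Matrix.J (Fin k) ℂ * B) *ᵥ y) = -(y ⬝ᵥ ((Bᵀ * Matrix.J (Fin k) ℂ * A) *ᵥ x)) := by
  have h : Aᵀ * Matrix.J (Fin k) ℂ * B = -(Bᵀ * Matrix.J (Fin k) ℂ * A)ᵀ := by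
    rw [Matrix.transpose_mul, Matrix.transpose_mul, Matrix.transpose_transpose,
      Matrix.J_transpose, Matrix.neg_mul, Matrix.mul_neg, neg_neg, Matrix.mul_assoc]
  rw [h, Matrix.neg_mulVec, dotProduct_neg, Matrix.mulVec_transpose, dotProduct_comm,
    ← Matrix.dotProduct_mulVec]

lemma HalfGr.ext_of_le {n : ℕ} {L L' : HalfGr n} (h : L.1 ≤ L'.1) : L = L' :=
  Subtype.ext (Submodule.eq_of_le_of_finrank_eq h (L.2.trans L'.2.symm))

namespace SplitData

variable {G : Type*} [Group G] {k : ℕ} {ρ : G →* Matrix.orthogonalGroup (Fin k) ℝ}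
  {r : ℕ} {t : Fin (r + 1) → RepType} {m : Fin (r + 1) → ℕ} (D : SplitData ρ t m)

lemma F_mem_glue {L : ∀ a : CIdx t, HalfGr (m a.base)} (a : CIdx t) (s) {y} (hy : y ∈ (L a).1) :
    D.F a s *ᵥ y ∈ (D.glue L).1 := by
  rw [D.mem_glue]
  intro b s'
  by_cases hab : b = a
  · subst hab
    by_cases hs : s' = s
    · subst hs
      rwa [D.E_F_self]
    · rw [Matrix.mulVec_mulVec, D.E_mul_F_of_ne _ _ _ hs, Matrix.zero_mulVec]
      exact Submodule.zero_mem _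
  · rw [Matrix.mulVec_mulVec, D.E_mul_F_of_ne' _ _ _ _ hab, Matrix.zero_mulVec]
    exact Submodule.zero_mem _

/-- For the type 1, the second multiplicity space is determined by the first. -/
def expand (L : ∀ i, HalfGr (m i)) : ∀ a : CIdx t, HalfGr (m a.base)
  | .inl i => L i
  | .inr i => perpJ (L i.1)

lemma isFrameMapOn_expand (S : Set (∀ i, HalfGr (m i))) :
    IsFrameMapOn S (expand (t := t) (m := m)) := by
  refine isFrameMapOn_pi fun a => ?_
  rcases a with i | i
  · exact isFrameMapOn_apply i S
  · exact (isFrameMapOn_perpJ Set.univ).comp (isFrameMapOn_apply i.1 S) (Set.mapsTo_univ _ _)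

/-- The subspace of `ℂ^{2k}` defined by a family of multiplicity spaces. -/
def ofParts (L : ∀ i, HalfGr (m i)) : HalfGr k := D.glue (expand L)

lemma isFrameMapOn_ofParts (S : Set (∀ i, HalfGr (m i))) : IsFrameMapOn S D.ofParts :=
  (D.isFrameMapOn_glue Set.univ).comp (isFrameMapOn_expand S) (Set.mapsTo_univ _ _)

/-- The multiplicity spaces of a subspace. -/
def toParts (L : HalfGr k) : ∀ i, HalfGr (m i) := fun i => D.part (.inl i) L

lemma isFrameMapOn_toParts : IsFrameMapOn (closureSym ρ) D.toParts :=
  isFrameMapOn_pi fun i => D.isFrameMapOn_part (.inl i)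

lemma dotProduct_F (a b : CIdx t) (s s') (x : Fin (m a.base) ⊕ Fin (m a.base) → ℂ)
    (y : Fin (m b.base) ⊕ Fin (m b.base) → ℂ) :
    (D.F a s *ᵥ x) ⬝ᵥ (Matrix.J (Fin k) ℂ *ᵥ (D.F b s' *ᵥ y)) =
      x ⬝ᵥ (((D.F a s)ᵀ * Matrix.J (Fin k) ℂ * D.F b s') *ᵥ y) :=
  dotProduct_mulVec_mulVec _ _ _ _ _

lemma J_isotropic {L : HalfGr k} (hL : L ∈ isoGr (formsOf ρ)) {x y : Fin k ⊕ Fin k → ℂ}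
    (hx : x ∈ L.1) (hy : y ∈ L.1) : x ⬝ᵥ (Matrix.J (Fin k) ℂ *ᵥ y) = 0 :=
  hL _ (J_mem_formsOf ρ) x hx y hy

/-- Put `x` and `y` in two copies whose pairing has a nonzero scalar: the isotropy of `L` then gives
that of the multiplicity spaces. -/
lemma isotropic_of_pair {L : HalfGr k} (hL : L ∈ isoGr (formsOf ρ)) {a b : CIdx t}
    {B : Matrix (Fin (m a.base) ⊕ Fin (m a.base)) (Fin (m b.base) ⊕ Fin (m b.base)) ℂ}
    (h : ∃ c : Fin (D.d a.base) → Fin (D.d b.base) → ℂ, (∃ s s', c s s' ≠ 0) ∧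
      ∀ s s', (D.F a s)ᵀ * Matrix.J (Fin k) ℂ * D.F b s' = c s s' • B)
    {x y} (hx : x ∈ D.piece L.1 a) (hy : y ∈ D.piece L.1 b) : x ⬝ᵥ (B *ᵥ y) = 0 := by
  obtain ⟨c, ⟨s, s', hc⟩, h⟩ := h
  have hst := D.isStable_of_mem hL
  have h1 := J_isotropic hL (hst.F_mem a s hx) (hst.F_mem b s' hy)
  rw [D.dotProduct_F, h, Matrix.smul_mulVec, dotProduct_smul] at h1
  exact (smul_eq_zero.1 h1).resolve_left hc

lemma part_firstSummand (a : CIdx t) : D.part a (firstSummand k) = firstSummand _ := by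
  refine HalfGr.ext_of_le ?_
  rw [D.part_val a (firstSummand_mem_closureSym ρ)]
  rintro _ ⟨x, hx, rfl⟩
  exact D.E_fst a _ x hx

lemma mapsTo_toParts :
    Set.MapsTo D.toParts (closureSym ρ) (Set.univ.pi fun i => (t i).variety (m i)) := by
  intro L hL i _
  change D.part (.inl i) L ∈ (t i).variety (m i)
  rcases h : t i with _ | _ | _
  · exact Set.mem_univ _
  · intro x hx y hy
    rw [D.part_val _ hL] at hx hy
    exact D.isotropic_of_pair (a := .inl i) (b := .inl i) (mem_isoGr_of_mem hL)
      (D.pair_two i h) hx hy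
  -- Isotropy only gives a point of `𝕆^m`. Its component is found by continuity: `closureSym ρ` is
  -- connected and its base point goes to the base point.
  · have h1 : Set.MapsTo (D.part (.inl i)) (closureSym ρ) (orthogonalGr (m i)) := by
      intro L hL x hx y hy
      rw [D.part_val _ hL] at hx hy
      exact D.isotropic_of_pair (a := .inl i) (b := .inl i) (mem_isoGr_of_mem hL)
        (D.pair_three i h) hx hy
    have h2 := (isPreconnected_closureSym ρ).image _ (D.isFrameMapOn_part (.inl i)).continuousOn
    exact h2.subset_connectedComponentIn
      ⟨_, firstSummand_mem_closureSym ρ, D.part_firstSummand (.inl i)⟩ h1.image_subset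
      ⟨L, hL, rfl⟩

lemma pair_expand {L : ∀ i, HalfGr (m i)} (hL : ∀ i, L i ∈ (t i).variety (m i)) (a b : CIdx t)
    (s s') {x y} (hx : x ∈ (expand L a).1) (hy : y ∈ (expand L b).1) :
    x ⬝ᵥ (((D.F a s)ᵀ * Matrix.J (Fin k) ℂ * D.F b s') *ᵥ y) = 0 := by
  by_cases hab : a.base = b.base
  swap
  · rw [D.pair_base a b hab, Matrix.zero_mulVec, dotProduct_zero]
  rcases a with i | ⟨i, hi⟩ <;> rcases b with j | ⟨j, hj⟩ <;> obtain rfl : i = j := hab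
  · have hLi := hL i
    rcases h : t i with _ | _ | _ <;> rw [h] at hLi
    · rw [D.pair_inl i h, Matrix.zero_mulVec, dotProduct_zero]
    · obtain ⟨c, -, hc⟩ := D.pair_two i h
      exact dotProduct_mulVec_of_eq_smul (hc s s') (hLi x hx y hy)
    · obtain ⟨c, -, hc⟩ := D.pair_three i h
      exact dotProduct_mulVec_of_eq_smul (hc s s') (connectedComponentIn_subset _ _ hLi x hx y hy)
  · obtain ⟨c, -, hc⟩ := D.pair_one i hj
    exact dotProduct_mulVec_of_eq_smul (hc s s') (mem_perpJ.1 hy x hx)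
  · obtain ⟨c, -, hc⟩ := D.pair_one i hi
    rw [dotProduct_transpose_J_mulVec, neg_eq_zero]
    exact dotProduct_mulVec_of_eq_smul (hc s' s) (mem_perpJ.1 hx y hy)
  · rw [D.pair_inr, Matrix.zero_mulVec, dotProduct_zero]

/-- Isotropy reduces to that between single copies, `pair_expand`. Invariance holds because each
group element only mixes copies of the same constituent. -/
lemma ofParts_mem_isoGr {L : ∀ i, HalfGr (m i)} (hL : ∀ i, L i ∈ (t i).variety (m i)) :
    D.ofParts L ∈ isoGr (formsOf ρ) := by
  rw [← invariantLagrangians_eq]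
  refine ⟨fun x hx y hy => ?_, fun g x hx => ?_⟩
  · have hx' := D.mem_glue.1 hx
    have hy' := D.mem_glue.1 hy
    rw [← D.sum_F_E_mulVec x, ← D.sum_F_E_mulVec y]
    simp only [sum_dotProduct, Matrix.mulVec_sum, dotProduct_sum, D.dotProduct_F]
    exact Finset.sum_eq_zero fun a _ => Finset.sum_eq_zero fun s _ => Finset.sum_eq_zero fun b _ =>
      Finset.sum_eq_zero fun s' _ => D.pair_expand hL _ _ _ _ (hx' _ _) (hy' _ _)
  · have hx' := D.mem_glue.1 hx
    change diagMat ρ g *ᵥ x ∈ (D.ofParts L).1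
    rw [← D.sum_F_E_mulVec x, Matrix.mulVec_sum]
    refine Submodule.sum_mem _ fun a _ => ?_
    rw [Matrix.mulVec_sum]
    refine Submodule.sum_mem _ fun s _ => ?_
    obtain ⟨c, hc⟩ := D.diagMat_mul_F g a s
    rw [Matrix.mulVec_mulVec, hc, Matrix.sum_mulVec]
    refine Submodule.sum_mem _ fun s' _ => ?_
    rw [Matrix.smul_mulVec]
    exact Submodule.smul_mem _ _ (D.F_mem_glue a s' (hx' a s))

lemma ofParts_firstSummand : D.ofParts (fun i => firstSummand (m i)) = firstSummand k := by
  refine (HalfGr.ext_of_le fun x hx => D.mem_glue.2 fun a s => ?_).symm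
  have h1 : expand (t := t) (fun i => firstSummand (m i)) a = firstSummand (m a.base) := by
    rcases a with i | i
    · rfl
    · exact perpJ_eq_self (firstSummand_mem_lagrangianGr _)
  rw [h1]
  exact D.E_fst a s x hx

/-- The product of the factors is connected, so its image is a connected set of invariant
Lagrangians through `ℂ^k ⊕ 0`, and `closureSym ρ` is the component of that point. -/
lemma mapsTo_ofParts :
    Set.MapsTo D.ofParts (Set.univ.pi fun i => (t i).variety (m i)) (closureSym ρ) := by
  have h1 : IsPreconnected (Set.univ.pi fun i => (t i).variety (m i)) :=
    isPreconnected_univ_pi fun i => (t i).isPreconnected_variety (m i)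
  have h2 := h1.image _ (D.isFrameMapOn_ofParts _).continuousOn_pi
  rw [closureSym_eq_connectedComponentIn, invariantLagrangians_eq]
  intro L hL
  refine h2.subset_connectedComponentIn
    ⟨_, fun i _ => (t i).firstSummand_mem_variety _, D.ofParts_firstSummand⟩ ?_ ⟨L, hL, rfl⟩
  rintro _ ⟨L, hL, rfl⟩
  exact D.ofParts_mem_isoGr fun i => hL i trivial

/-- Both subspaces have dimension `k`, so one inclusion is enough. In type 1 the second multiplicity
space pairs to zero with the first, hence is in its symplectic complement. -/
lemma ofParts_toParts {L : HalfGr k} (hL : L ∈ closureSym ρ) : D.ofParts (D.toParts L) = L := by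
  refine (HalfGr.ext_of_le fun x hx => D.mem_glue.2 fun a s => ?_).symm
  have hst := D.isStable_of_mem (mem_isoGr_of_mem hL)
  rcases a with i | ⟨i, hi⟩
  · change _ ∈ (D.part (.inl i) L).1
    rw [D.part_val _ hL]
    exact hst.E_mem _ s hx
  · refine mem_perpJ.2 fun y hy => ?_
    change y ∈ (D.part (.inl i) L).1 at hy
    rw [D.part_val _ hL] at hy
    exact D.isotropic_of_pair (a := .inl i) (b := .inr ⟨i, hi⟩) (mem_isoGr_of_mem hL)
      (D.pair_one i hi) hy (hst.E_mem _ s hx)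

lemma toParts_ofParts {L : ∀ i, HalfGr (m i)}
    (hL : L ∈ Set.univ.pi fun i => (t i).variety (m i)) : D.toParts (D.ofParts L) = L := by
  funext i
  refine HalfGr.ext_of_le ?_
  change (D.part (.inl i) (D.ofParts L)).1 ≤ _
  rw [D.part_val _ (D.mapsTo_ofParts hL)]
  rintro _ ⟨x, hx, rfl⟩
  exact D.mem_glue.1 hx (.inl i) _

theorem areIsomorphic (D : SplitData ρ t m) :
    AreIsomorphic (closureSym ρ) (Set.univ.pi fun i => (t i).variety (m i)) :=
  ⟨{ toFun := D.mapsTo_toParts.restrict _ _ _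
     invFun := D.mapsTo_ofParts.restrict _ _ _
     left_inv := fun L => Subtype.ext (D.ofParts_toParts L.2)
     right_inv := fun L => Subtype.ext (D.toParts_ofParts L.2) },
    D.isFrameMapOn_toParts.isMorphism D.mapsTo_toParts,
    (D.isFrameMapOn_ofParts _).isMorphism D.mapsTo_ofParts⟩

end SplitData

end Product

/-! ### Splittings of `ℂ^{2k}` from splittings of `ℂ^k` -/

section Base

/-- A splitting of `ℂ^k` into copies `f a s` of `ℂ^m`, with projections `e a s`, that is
adapted to the action of `G` and to the standard bilinear form. -/
structure SplitBase {G : Type*} [Group G] {k : ℕ} (ρ : G →* Matrix.orthogonalGroup (Fin k) ℝ)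
    {r : ℕ} (t : Fin (r + 1) → RepType) (m : Fin (r + 1) → ℕ) where
  d : Fin (r + 1) → ℕ
  d_pos : ∀ i, 0 < d i
  f : ∀ a : CIdx t, Fin (d a.base) → Matrix (Fin k) (Fin (m a.base)) ℂ
  e : ∀ a : CIdx t, Fin (d a.base) → Matrix (Fin (m a.base)) (Fin k) ℂ
  e_mul_f_self : ∀ a s, e a s * f a s = 1
  e_mul_f_of_ne : ∀ a s s', s ≠ s' → e a s * f a s' = 0
  e_mul_f_of_ne' : ∀ a b s s', a ≠ b → e a s * f b s' = 0
  sum_f_mul_e : ∑ a, ∑ s, f a s * e a s = 1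
  f_mul_e_mem : ∀ (a : CIdx t) (s s' : Fin (d a.base)),
    f a s * e a s' ∈ Submodule.span ℂ (Set.range (complexMat ρ))
  complexMat_mul_f : ∀ (g : G) (a : CIdx t) (s : Fin (d a.base)),
    ∃ D : Fin (d a.base) → ℂ, complexMat ρ g * f a s = ∑ s', D s' • f a s'
  β : ∀ i, Matrix (Fin (m i)) (Fin (m i)) ℂ
  pair_one : ∀ i (h : t i = .one), ∃ c : Fin (d i) → Fin (d i) → ℂ, (∃ s s', c s s' ≠ 0) ∧
    ∀ s s', (f (.inl i) s)ᵀ * f (.inr ⟨i, h⟩) s' = c s s' • β i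
  pair_two : ∀ i, t i = .two → (β i)ᵀ = β i ∧
    ∃ c : Fin (d i) → Fin (d i) → ℂ, (∃ s s', c s s' ≠ 0) ∧
      ∀ s s', (f (.inl i) s)ᵀ * f (.inl i) s' = c s s' • β i
  pair_three : ∀ i, t i = .three → (β i)ᵀ = -β i ∧
    ∃ c : Fin (d i) → Fin (d i) → ℂ, (∃ s s', c s s' ≠ 0) ∧
      ∀ s s', (f (.inl i) s)ᵀ * f (.inl i) s' = c s s' • β i
  pair_base : ∀ a b : CIdx t, a.base ≠ b.base → ∀ s s', (f a s)ᵀ * f b s' = 0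
  pair_inl : ∀ i, t i = .one → ∀ s s', (f (.inl i) s)ᵀ * f (.inl i) s' = 0
  pair_inr : ∀ i s s', (f (.inr i) s)ᵀ * f (.inr i) s' = 0

/-- The diagonal action on `ℂ^{2k}` of a matrix. -/
def doubleMat (k : ℕ) :
    Matrix (Fin k) (Fin k) ℂ →ₗ[ℂ] Matrix (Fin k ⊕ Fin k) (Fin k ⊕ Fin k) ℂ where
  toFun X := Matrix.fromBlocks X 0 0 X
  map_add' X Y := by rw [Matrix.fromBlocks_add, add_zero]
  map_smul' c X := by rw [RingHom.id_apply, Matrix.fromBlocks_smul, smul_zero]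

lemma doubleMat_apply {k : ℕ} (X : Matrix (Fin k) (Fin k) ℂ) :
    doubleMat k X = Matrix.fromBlocks X 0 0 X := rfl

lemma doubleMat_mulVec_mem {G : Type*} [Group G] {k : ℕ}
    {ρ : G →* Matrix.orthogonalGroup (Fin k) ℝ} {L : HalfGr k} (hL : L ∈ isoGr (formsOf ρ))
    {X : Matrix (Fin k) (Fin k) ℂ} (hX : X ∈ Submodule.span ℂ (Set.range (complexMat ρ)))
    {x : Fin k ⊕ Fin k → ℂ} (hx : x ∈ L.1) : doubleMat k X *ᵥ x ∈ L.1 := by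
  rw [← invariantLagrangians_eq] at hL
  induction hX using Submodule.span_induction with
  | mem X hX =>
    obtain ⟨g, rfl⟩ := hX
    exact hL.2 g x hx
  | zero =>
    rw [map_zero, Matrix.zero_mulVec]
    exact Submodule.zero_mem _
  | add X Y _ _ hX hY =>
    rw [map_add, Matrix.add_mulVec]
    exact Submodule.add_mem _ hX hY
  | smul c X _ hX =>
    rw [map_smul, Matrix.smul_mulVec]
    exact Submodule.smul_mem _ _ hX

/-- The matrices `A` and `A'` are coordinate changes in the second summand that absorb `β`. What
remains is a sign: `ε = 1` gives `J` and `ε = -1` gives `K`. -/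
lemma double_pair {k m : ℕ} {P Q : Matrix (Fin k) (Fin m) ℂ} {A A' β : Matrix (Fin m) (Fin m) ℂ}
    {c ε : ℂ} (h : Pᵀ * Q = c • β) (h' : β * A' = ε • 1) (h'' : Aᵀ * β = 1) :
    (Matrix.fromBlocks P 0 0 (P * A))ᵀ * Matrix.J (Fin k) ℂ * Matrix.fromBlocks Q 0 0 (Q * A') =
      c • Matrix.fromBlocks 0 (-(ε • 1)) 1 0 := by
  have h1 : Pᵀ * (Q * A') = c • ε • (1 : Matrix (Fin m) (Fin m) ℂ) := by
    rw [← Matrix.mul_assoc, h, Matrix.smul_mul, h']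
  have h2 : Aᵀ * (Pᵀ * Q) = c • (1 : Matrix (Fin m) (Fin m) ℂ) := by
    rw [h, Matrix.mul_smul, h'']
  simp only [Matrix.J, Matrix.fromBlocks_transpose, Matrix.fromBlocks_multiply,
    Matrix.transpose_zero, Matrix.mul_zero, Matrix.zero_mul, add_zero, zero_add, Matrix.mul_neg,
    Matrix.mul_one, Matrix.neg_mul, Matrix.transpose_mul, Matrix.mul_assoc, neg_zero, h1, h2,
    Matrix.fromBlocks_smul, smul_zero, smul_neg]

lemma J_eq_fromBlocks (m : ℕ) : Matrix.J (Fin m) ℂ =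
    Matrix.fromBlocks 0 (-((1 : ℂ) • (1 : Matrix (Fin m) (Fin m) ℂ))) 1 0 := by
  rw [one_smul, Matrix.J]

lemma matK_eq_fromBlocks (m : ℕ) : matK m =
    Matrix.fromBlocks 0 (-((-1 : ℂ) • (1 : Matrix (Fin m) (Fin m) ℂ))) 1 0 := by
  rw [neg_one_smul, neg_neg, matK]

namespace SplitBase

variable {G : Type*} [Group G] {k : ℕ} {ρ : G →* Matrix.orthogonalGroup (Fin k) ℝ}
  {r : ℕ} {t : Fin (r + 1) → RepType} {m : Fin (r + 1) → ℕ} (D : SplitBase ρ t m)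

/-- The images of the `f b s'` span `ℂ^k`, so the image of `v` is orthogonal to everything and the
dot product is non-degenerate. -/
lemma eq_zero_of_pair (a : CIdx t) (s) (v : Fin (m a.base) → ℂ)
    (h : ∀ b s', ((D.f b s')ᵀ * D.f a s) *ᵥ v = 0) : v = 0 := by
  have h1 : (D.f a s)ᵀ *ᵥ (D.f a s *ᵥ v) = 0 := by rw [Matrix.mulVec_mulVec, h]
  have h2 : D.f a s *ᵥ v = 0 := by
    have h3 : ∀ y, y ⬝ᵥ (D.f a s *ᵥ v) = 0 := fun y => by
      have h4 : y = ∑ b, ∑ s', D.f b s' *ᵥ (D.e b s' *ᵥ y) := by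
        conv_lhs => rw [← Matrix.one_mulVec y, ← D.sum_f_mul_e]
        simp only [Matrix.sum_mulVec, Matrix.mulVec_mulVec]
      rw [h4]
      simp only [sum_dotProduct]
      refine Finset.sum_eq_zero fun b _ => Finset.sum_eq_zero fun s' _ => ?_
      rw [Matrix.dotProduct_mulVec, Matrix.vecMul_mulVec, ← Matrix.dotProduct_mulVec]
      rw [h, dotProduct_zero]
    exact dotProduct_eq_zero _ fun y => by rw [dotProduct_comm]; exact h3 y
  rw [← Matrix.one_mulVec v, ← D.e_mul_f_self a s, ← Matrix.mulVec_mulVec, h2, Matrix.mulVec_zero]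

/-- All other pairings with this block vanish, so a vector in the kernel of `β` would be orthogonal
to the whole of `ℂ^k`. -/
lemma isUnit_β (i : Fin (r + 1)) : IsUnit (D.β i) := by
  rw [← Matrix.mulVec_injective_iff_isUnit]
  have hker : ∀ v, D.β i *ᵥ v = 0 → v = 0 := by
    intro v hv
    have hsmul : ∀ c : ℂ, (c • D.β i) *ᵥ v = 0 := fun c => by
      rw [Matrix.smul_mulVec, hv, smul_zero]
    have hself : ∀ c : Fin (D.d i) → Fin (D.d i) → ℂ, t i ≠ .one →
        (∀ s s', (D.f (.inl i) s)ᵀ * D.f (.inl i) s' = c s s' • D.β i) → v = 0 := by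
      intro c hi hc
      refine D.eq_zero_of_pair (.inl i) ⟨0, D.d_pos i⟩ v fun b s' => ?_
      by_cases hb : b.base = i
      · rcases b with j | j
        · obtain rfl : j = i := hb
          exact (congrArg (· *ᵥ v) (hc s' _)).trans (hsmul _)
        · exact absurd ((congrArg t hb).symm.trans j.2) hi
      · exact (congrArg (· *ᵥ v) (D.pair_base b (.inl i) hb s' _)).trans (Matrix.zero_mulVec v)
    rcases h : t i with _ | _ | _
    · obtain ⟨c, -, hc⟩ := D.pair_one i h
      refine D.eq_zero_of_pair (.inr ⟨i, h⟩) ⟨0, D.d_pos i⟩ v fun b s' => ?_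
      by_cases hb : b.base = i
      · rcases b with j | ⟨j, hj⟩
        · obtain rfl : j = i := hb
          exact (congrArg (· *ᵥ v) (hc s' _)).trans (hsmul _)
        · obtain rfl : j = i := hb
          exact (congrArg (· *ᵥ v) (D.pair_inr _ _ _)).trans (Matrix.zero_mulVec v)
      · exact (congrArg (· *ᵥ v) (D.pair_base b (.inr ⟨i, h⟩) hb s' _)).trans
          (Matrix.zero_mulVec v)
    · obtain ⟨-, c, -, hc⟩ := D.pair_two i h
      exact hself c (by rw [h]; exact RepType.noConfusion) hc
    · obtain ⟨-, c, -, hc⟩ := D.pair_three i h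
      exact hself c (by rw [h]; exact RepType.noConfusion) hc
  intro v w hvw
  exact sub_eq_zero.1 (hker _ (by rw [Matrix.mulVec_sub, hvw, sub_self]))

lemma transpose_inv_mul_β (i : Fin (r + 1)) : (((D.β i)⁻¹)ᵀ)ᵀ * D.β i = 1 := by
  rw [Matrix.transpose_transpose]
  exact Matrix.nonsing_inv_mul _ ((Matrix.isUnit_iff_isUnit_det _).1 (D.isUnit_β i))

/-- The change of coordinates of the second copy. -/
def twist : ∀ a : CIdx t, Matrix (Fin (m a.base)) (Fin (m a.base)) ℂ
  | .inl i => ((D.β i)⁻¹)ᵀ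
  | .inr i => (D.β i.1)⁻¹

/-- The inverse of the change of coordinates of the second copy. -/
def untwist : ∀ a : CIdx t, Matrix (Fin (m a.base)) (Fin (m a.base)) ℂ
  | .inl i => (D.β i)ᵀ
  | .inr i => D.β i.1

lemma β_mul_inv (i : Fin (r + 1)) : D.β i * (D.β i)⁻¹ = 1 :=
  Matrix.mul_nonsing_inv _ ((Matrix.isUnit_iff_isUnit_det _).1 (D.isUnit_β i))

lemma inv_mul_β (i : Fin (r + 1)) : (D.β i)⁻¹ * D.β i = 1 :=
  Matrix.nonsing_inv_mul _ ((Matrix.isUnit_iff_isUnit_det _).1 (D.isUnit_β i))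

lemma twist_mul_untwist (a : CIdx t) : D.twist a * D.untwist a = 1 := by
  rcases a with i | i
  · exact (Matrix.transpose_mul _ _).symm.trans 
      ((congrArg Matrix.transpose (D.β_mul_inv i)).trans Matrix.transpose_one)
  · exact D.inv_mul_β _

lemma untwist_mul_twist (a : CIdx t) : D.untwist a * D.twist a = 1 :=
  mul_eq_one_comm.1 (D.twist_mul_untwist a)

/-- The copies of `ℂ^{2m}` in `ℂ^{2k}`. -/
def bigF (a : CIdx t) (s : Fin (D.d a.base)) :
    Matrix (Fin k ⊕ Fin k) (Fin (m a.base) ⊕ Fin (m a.base)) ℂ :=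
  Matrix.fromBlocks (D.f a s) 0 0 (D.f a s * D.twist a)

/-- The projections of `ℂ^{2k}` to the copies of `ℂ^{2m}`. -/
def bigE (a : CIdx t) (s : Fin (D.d a.base)) :
    Matrix (Fin (m a.base) ⊕ Fin (m a.base)) (Fin k ⊕ Fin k) ℂ :=
  Matrix.fromBlocks (D.e a s) 0 0 (D.untwist a * D.e a s)

lemma bigE_mul_bigF (a b : CIdx t) (s s') : D.bigE a s * D.bigF b s' =
    Matrix.fromBlocks (D.e a s * D.f b s') 0 0
      (D.untwist a * (D.e a s * D.f b s') * D.twist b) := by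
  simp only [bigE, bigF, Matrix.fromBlocks_multiply, Matrix.mul_zero, Matrix.zero_mul, add_zero,
    zero_add, Matrix.mul_assoc]

lemma bigF_mul_bigE (a : CIdx t) (s s') : D.bigF a s * D.bigE a s' =
    doubleMat k (D.f a s * D.e a s') := by
  have : D.f a s * D.twist a * (D.untwist a * D.e a s') = D.f a s * D.e a s' := by
    rw [Matrix.mul_assoc, ← Matrix.mul_assoc (D.twist a), D.twist_mul_untwist, Matrix.one_mul]
  simp only [bigE, bigF, Matrix.fromBlocks_multiply, Matrix.mul_zero, Matrix.zero_mul, add_zero,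
    zero_add, this, doubleMat_apply]

lemma bigF_transpose_mul_J_mul_bigF (a b : CIdx t) (s s') :
    (D.bigF a s)ᵀ * Matrix.J (Fin k) ℂ * D.bigF b s' =
      Matrix.fromBlocks 0 (-((D.f a s)ᵀ * D.f b s' * D.twist b))
        ((D.twist a)ᵀ * ((D.f a s)ᵀ * D.f b s')) 0 := by
  simp only [bigF, Matrix.J, Matrix.fromBlocks_transpose, Matrix.fromBlocks_multiply,
    Matrix.transpose_zero, Matrix.mul_zero, Matrix.zero_mul, add_zero, zero_add, Matrix.mul_neg,
    Matrix.mul_one, Matrix.neg_mul, Matrix.transpose_mul, Matrix.mul_assoc, neg_zero]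

lemma bigF_pair_eq_zero {a b : CIdx t} {s s'} (h : (D.f a s)ᵀ * D.f b s' = 0) :
    (D.bigF a s)ᵀ * Matrix.J (Fin k) ℂ * D.bigF b s' = 0 := by
  rw [bigF_transpose_mul_J_mul_bigF, h, Matrix.zero_mul, Matrix.mul_zero, neg_zero,
    Matrix.fromBlocks_zero]

/-- The splitting of `ℂ^{2k}`. -/
def toSplitData : SplitData ρ t m where
  d := D.d
  d_pos := D.d_pos
  F := D.bigF
  E := D.bigE
  E_mul_F_self a s := by
    rw [bigE_mul_bigF, D.e_mul_f_self, Matrix.mul_one, D.untwist_mul_twist, Matrix.fromBlocks_one]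
  E_mul_F_of_ne a s s' h := by
    rw [bigE_mul_bigF, D.e_mul_f_of_ne a s s' h, Matrix.mul_zero, Matrix.zero_mul,
      Matrix.fromBlocks_zero]
  E_mul_F_of_ne' a b s s' h := by
    rw [bigE_mul_bigF, D.e_mul_f_of_ne' a b s s' h, Matrix.mul_zero, Matrix.zero_mul,
      Matrix.fromBlocks_zero]
  sum_F_mul_E := by
    simp only [bigF_mul_bigE, ← map_sum]
    rw [D.sum_f_mul_e, doubleMat_apply, Matrix.fromBlocks_one]
  stable L hL a s s' x hx := by
    rw [bigF_mul_bigE]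
    exact doubleMat_mulVec_mem hL (D.f_mul_e_mem a s s') hx
  diagMat_mul_F g a s := by
    obtain ⟨c, hc⟩ := D.complexMat_mul_f g a s
    refine ⟨c, ?_⟩
    have h1 : diagMat ρ g * D.bigF a s = Matrix.fromBlocks (complexMat ρ g * D.f a s) 0 0
        (complexMat ρ g * D.f a s * D.twist a) := by
      simp only [diagMat, bigF, Matrix.fromBlocks_multiply, Matrix.mul_zero, Matrix.zero_mul,
        add_zero, zero_add, Matrix.mul_assoc]
    rw [h1, hc, Matrix.sum_mul]
    ext (x | x) (y | y) <;> simp [bigF, Matrix.sum_apply]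
  F_snd a s x hx := by
    obtain ⟨v, rfl⟩ := spans_secondSummand.mem_iff.1 hx
    rw [spans_secondSummand.mem_iff]
    refine ⟨(D.f a s * D.twist a) *ᵥ v, ?_⟩
    simp [frameSnd, bigF, Matrix.fromRows_mulVec, Matrix.fromBlocks_mulVec]
  E_fst a s x hx := by
    obtain ⟨v, rfl⟩ := spans_firstSummand.mem_iff.1 hx
    rw [spans_firstSummand.mem_iff]
    refine ⟨D.e a s *ᵥ v, ?_⟩
    simp [frameFst, bigE, Matrix.fromRows_mulVec, Matrix.fromBlocks_mulVec]
  pair_one i h := by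
    obtain ⟨c, hc, h1⟩ := D.pair_one i h
    refine ⟨c, hc, fun s s' => ?_⟩
    rw [J_eq_fromBlocks (m i)]
    exact double_pair (h1 s s') ((D.β_mul_inv i).trans (one_smul ℂ _).symm) (D.transpose_inv_mul_β i)
  pair_two i h := by
    obtain ⟨hβ, c, hc, h1⟩ := D.pair_two i h
    refine ⟨c, hc, fun s s' => ?_⟩
    rw [J_eq_fromBlocks (m i)]
    -- In type 2, `β` is symmetric, so the twist leaves the symplectic sign unchanged.
    have h2 : D.β i * ((D.β i)⁻¹)ᵀ = (1 : ℂ) • 1 := by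
      rw [Matrix.transpose_nonsing_inv, hβ, D.β_mul_inv, one_smul]
    exact double_pair (h1 s s') h2 (D.transpose_inv_mul_β i)
  pair_three i h := by
    obtain ⟨hβ, c, hc, h1⟩ := D.pair_three i h
    refine ⟨c, hc, fun s s' => ?_⟩
    rw [matK_eq_fromBlocks (m i)]
    -- In type 3, `β` is antisymmetric; the extra sign turns `J` into `K`.
    have h2 : D.β i * ((D.β i)⁻¹)ᵀ = (-1 : ℂ) • 1 := by
      rw [neg_one_smul, ← Matrix.transpose_one, ← D.inv_mul_β i, Matrix.transpose_mul, hβ,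
        Matrix.neg_mul, neg_neg]
    exact double_pair (h1 s s') h2 (D.transpose_inv_mul_β i)
  pair_base a b h s s' := D.bigF_pair_eq_zero (D.pair_base a b h s s')
  pair_inl i h s s' := D.bigF_pair_eq_zero (D.pair_inl i h s s')
  pair_inr i s s' := D.bigF_pair_eq_zero (D.pair_inr i s s')

end SplitBase

end Base

/-! ### Schur's lemma and invariant bilinear forms -/

section Schur

variable {G : Type*} [Group G]

/-- A bilinear form on a product of two representations is invariant. -/
def IsInvariantForm {F U U' : Type*} [Field F] [AddCommGroup U] [Module F U] [AddCommGroup U']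
    [Module F U'] (π : Representation F G U) (π' : Representation F G U')
    (B : U →ₗ[F] U' →ₗ[F] F) : Prop :=
  ∀ g x y, B (π g x) (π' g y) = B x y

/-! ### Schur's lemma over a field -/

section Field

variable {F U U' U'' : Type*} [Field F] [AddCommGroup U] [Module F U] [AddCommGroup U']
  [Module F U'] [AddCommGroup U''] [Module F U'']
  {π : Representation F G U} {π' : Representation F G U'} {π'' : Representation F G U''}

lemma injective_of_equivariant (hπ : π.IsIrreducible) {f : U →ₗ[F] U'}
    (hf : ∀ g x, f (π g x) = π' g (f x)) (h : f ≠ 0) : Function.Injective f := by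
  refine (Representation.IsIrreducible.injective_or_eq_zero
    (f.intertwiningMap_of_isIntertwiningMap π π' hf)).resolve_right fun h0 => h ?_
  ext x
  exact DFunLike.congr_fun h0 x

lemma surjective_of_equivariant (hπ' : π'.IsIrreducible) {f : U →ₗ[F] U'}
    (hf : ∀ g x, f (π g x) = π' g (f x)) (h : f ≠ 0) : Function.Surjective f := by
  refine (Representation.IsIrreducible.surjective_or_eq_zero
    (f.intertwiningMap_of_isIntertwiningMap π π' hf)).resolve_right fun h0 => h ?_
  ext x
  exact DFunLike.congr_fun h0 x

lemma nonempty_equiv_of_bijective {f : U →ₗ[F] U'} (hf : ∀ g x, f (π g x) = π' g (f x))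
    (h : Function.Bijective f) : Nonempty (π.Equiv π') :=
  ⟨(f.intertwiningMap_of_isIntertwiningMap π π' hf).ofBijective h⟩

lemma nonempty_equiv_of_ne_zero (hπ : π.IsIrreducible) (hπ' : π'.IsIrreducible) {f : U →ₗ[F] U'}
    (hf : ∀ g x, f (π g x) = π' g (f x)) (h : f ≠ 0) : Nonempty (π.Equiv π') :=
  nonempty_equiv_of_bijective hf
    ⟨injective_of_equivariant hπ hf h, surjective_of_equivariant hπ' hf h⟩

lemma nontrivial_of_irreducible (hπ : π.IsIrreducible) : Nontrivial U := by
  by_contra h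
  rw [not_nontrivial_iff_subsingleton] at h
  refine bot_ne_top (α := Subrepresentation π) (Subrepresentation.toSubmodule_injective ?_)
  exact Subsingleton.elim _ _

lemma IsInvariantForm.flip {B : U →ₗ[F] U' →ₗ[F] F} (h : IsInvariantForm π π' B) :
    IsInvariantForm π' π B.flip := fun g x y => h g y x

lemma IsInvariantForm.dual {B : U →ₗ[F] U' →ₗ[F] F} (h : IsInvariantForm π π' B) (g : G) (x : U) :
    (show Module.Dual F U' from B (π g x)) = π'.dual g (B x) := by
  refine LinearMap.ext fun y => ?_
  change B (π g x) y = B x (π' g⁻¹ y)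
  rw [← h g x (π' g⁻¹ y), ← Module.End.mul_apply, ← map_mul, mul_inv_cancel, map_one,
    Module.End.one_apply]

lemma IsInvariantForm.injective (hπ : π.IsIrreducible) {B : U →ₗ[F] U' →ₗ[F] F}
    (h : IsInvariantForm π π' B) (hB : B ≠ 0) : Function.Injective B :=
  injective_of_equivariant (π' := π'.dual) hπ h.dual hB

lemma flip_ne_zero {B : U →ₗ[F] U' →ₗ[F] F} (hB : B ≠ 0) : B.flip ≠ 0 := fun h => hB <| by
  ext x y
  exact LinearMap.congr_fun (LinearMap.congr_fun h y) x

/-- Two invariant forms differ by an equivariant map if one of them is non-degenerate. -/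
lemma IsInvariantForm.exists_comp [FiniteDimensional F U] [FiniteDimensional F U']
    (hπ : π.IsIrreducible) (hπ' : π'.IsIrreducible) {B₀ : U →ₗ[F] U' →ₗ[F] F}
    (h₀ : IsInvariantForm π π' B₀) (hB₀ : B₀ ≠ 0) {B : U'' →ₗ[F] U' →ₗ[F] F}
    (h : IsInvariantForm π'' π' B) :
    ∃ f : U'' →ₗ[F] U, (∀ g x, f (π'' g x) = π g (f x)) ∧ ∀ x, B x = B₀ (f x) := by
  have hinj := h₀.injective hπ hB₀
  have hinj' := h₀.flip.injective hπ' (flip_ne_zero hB₀)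
  -- `B₀` embeds each space in the dual of the other, so the dimensions agree and `B₀` is an
  -- isomorphism onto the dual.
  have h1 : Module.finrank F U ≤ Module.finrank F U' := by
    rw [← Subspace.dual_finrank_eq (K := F) (V := U')]
    exact LinearMap.finrank_le_finrank_of_injective (f := B₀) hinj
  have h2 : Module.finrank F U' ≤ Module.finrank F U := by
    rw [← Subspace.dual_finrank_eq (K := F) (V := U)]
    exact LinearMap.finrank_le_finrank_of_injective (f := B₀.flip) hinj'
  let e : U ≃ₗ[F] (U' →ₗ[F] F) := LinearEquiv.ofInjectiveOfFinrankEq B₀ hinj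
    ((le_antisymm h1 h2).trans (Subspace.dual_finrank_eq (K := F) (V := U')).symm)
  have he : ∀ x, e x = B₀ x := fun x => rfl
  refine ⟨e.symm.toLinearMap ∘ₗ B, fun g x => e.injective ?_, fun x => ?_⟩
  · rw [LinearMap.comp_apply, LinearEquiv.coe_coe, LinearEquiv.apply_symm_apply, he]
    refine (h.dual g x).trans (Eq.trans ?_ (h₀.dual g _).symm)
    congr 1
    exact (e.apply_symm_apply _).symm
  · exact (e.apply_symm_apply _).symm

end Field

variable {U U' : Type*} [AddCommGroup U] [Module ℂ U] [AddCommGroup U'] [Module ℂ U']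
  {π : Representation ℂ G U} {π' : Representation ℂ G U'}

lemma exists_smul_of_equivariant [FiniteDimensional ℂ U] (hπ : π.IsIrreducible) {f : U →ₗ[ℂ] U}
    (hf : ∀ g x, f (π g x) = π g (f x)) : ∃ c : ℂ, ∀ x, f x = c • x := by
  obtain ⟨c, hc⟩ :=
    (Representation.IsIrreducible.algebraMap_intertwiningMap_bijective_of_isAlgClosed
      (k := ℂ) (ρ := π)).2 (f.intertwiningMap_of_isIntertwiningMap π π hf)
  exact ⟨c, fun x => (DFunLike.congr_fun hc x).symm⟩

lemma IsInvariantForm.exists_smul [FiniteDimensional ℂ U] [FiniteDimensional ℂ U']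
    (hπ : π.IsIrreducible) (hπ' : π'.IsIrreducible) {B₀ B : U →ₗ[ℂ] U' →ₗ[ℂ] ℂ}
    (h₀ : IsInvariantForm π π' B₀) (hB₀ : B₀ ≠ 0) (h : IsInvariantForm π π' B) :
    ∃ c : ℂ, ∀ x y, B x y = c * B₀ x y := by
  obtain ⟨f, hf, hB⟩ := h₀.exists_comp hπ hπ' hB₀ h
  obtain ⟨c, hc⟩ := exists_smul_of_equivariant hπ hf
  refine ⟨c, fun x y => ?_⟩
  rw [hB, hc, map_smul, LinearMap.smul_apply, smul_eq_mul]

/-! ### Averaging and Schur orthogonality -/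

variable [Fintype G]

/-- The sum of the conjugates of a linear map. -/
def sumConj {F U U' : Type*} [Field F] [AddCommGroup U] [Module F U] [AddCommGroup U']
    [Module F U'] (π : Representation F G U) (π' : Representation F G U') (X : U →ₗ[F] U') :
    U →ₗ[F] U' := ∑ g, π' g ∘ₗ X ∘ₗ π g⁻¹

lemma sumConj_apply {F U U' : Type*} [Field F] [AddCommGroup U] [Module F U] [AddCommGroup U']
    [Module F U'] (π : Representation F G U) (π' : Representation F G U') (X : U →ₗ[F] U') (x : U) :
    sumConj π π' X x = ∑ g, π' g (X (π g⁻¹ x)) := by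
  simp [sumConj, LinearMap.sum_apply]

lemma sumConj_equivariant {F U U' : Type*} [Field F] [AddCommGroup U] [Module F U]
    [AddCommGroup U'] [Module F U'] (π : Representation F G U) (π' : Representation F G U')
    (X : U →ₗ[F] U') (h : G) (x : U) :
    sumConj π π' X (π h x) = π' h (sumConj π π' X x) := by
  rw [sumConj_apply, sumConj_apply, map_sum, ← Equiv.sum_comp (Equiv.mulLeft h)]
  refine Finset.sum_congr rfl fun g _ => ?_
  rw [Equiv.coe_mulLeft, mul_inv_rev, map_mul, map_mul, Module.End.mul_apply,
    Module.End.mul_apply, ← Module.End.mul_apply (π h⁻¹), ← map_mul, inv_mul_cancel, map_one,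
    Module.End.one_apply]

/-- The sum is the average of the rank-one map `x ↦ l(x) w`, evaluated at `v`; this average is
equivariant and so vanishes by Schur's lemma. -/
lemma sum_coeff_smul_of_isEmpty (hπ : π.IsIrreducible) (hπ' : π'.IsIrreducible)
    (h : IsEmpty (π.Equiv π')) (l : U →ₗ[ℂ] ℂ) (v : U) (w : U') :
    ∑ g, l (π g⁻¹ v) • π' g w = 0 := by
  have h1 : sumConj π π' (l.smulRight w) = 0 := by
    by_contra h2
    obtain ⟨e⟩ := nonempty_equiv_of_ne_zero hπ hπ' (sumConj_equivariant π π' _) h2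
    exact h.false e
  have h2 := sumConj_apply π π' (l.smulRight w) v
  rw [h1, LinearMap.zero_apply] at h2
  rw [h2]
  exact Finset.sum_congr rfl fun g _ => by rw [LinearMap.smulRight_apply, map_smul]

/-- Here the average of the rank-one map is a scalar, which is computed from its trace: each of the
conjugates has trace `l w`. -/
lemma sum_coeff_smul_self [FiniteDimensional ℂ U] (hπ : π.IsIrreducible) (l : U →ₗ[ℂ] ℂ)
    (v w : U) : (Module.finrank ℂ U : ℂ) • ∑ g, l (π g⁻¹ v) • π g w =
      ((Fintype.card G : ℂ) * l w) • v := by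
  obtain ⟨c, hc⟩ := exists_smul_of_equivariant hπ (sumConj_equivariant π π (l.smulRight w))
  have h1 : LinearMap.trace ℂ U (sumConj π π (l.smulRight w)) = (Fintype.card G : ℂ) * l w := by
    rw [sumConj, map_sum]
    have : ∀ g, LinearMap.trace ℂ U (π g ∘ₗ l.smulRight w ∘ₗ π g⁻¹) = l w := by
      intro g
      rw [LinearMap.trace_comp_comm', LinearMap.comp_assoc]
      have h2 : π g⁻¹ ∘ₗ π g = LinearMap.id := by
        rw [← Module.End.mul_eq_comp, ← map_mul, inv_mul_cancel, map_one]
        rfl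
      rw [h2, LinearMap.comp_id, LinearMap.trace_smulRight]
    rw [Finset.sum_congr rfl fun g _ => this g, Finset.sum_const, Finset.card_univ, nsmul_eq_mul]
  have h2 : sumConj π π (l.smulRight w) = c • LinearMap.id := LinearMap.ext hc
  rw [h2, map_smul, LinearMap.trace_id, smul_eq_mul] at h1
  have h3 := sumConj_apply π π (l.smulRight w) v
  rw [hc] at h3
  have h4 : ∑ g, l (π g⁻¹ v) • π g w = c • v := by
    rw [h3]
    exact Finset.sum_congr rfl fun g _ => by rw [LinearMap.smulRight_apply, map_smul]
  rw [h4, smul_smul, ← h1, mul_comm]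

end Schur

/-! ### Splittings of `ℂ^k` from complex irreducible representations -/

section Reps

universe u

lemma RepType.eq_one_or (t : RepType) : t = .one ∨ t = .two ∨ t = .three := by
  cases t
  · exact .inl rfl
  · exact .inr (.inl rfl)
  · exact .inr (.inr rfl)

/-- A decomposition of `ℂ^k` into complex irreducible representations: `T a μ` are the embeddings of
the irreducible representation `τ a`, and `u a` is a basis of `τ a`. -/
structure SplitReps {G : Type*} [Group G] {k : ℕ} (ρ : G →* Matrix.orthogonalGroup (Fin k) ℝ)
    {r : ℕ} (t : Fin (r + 1) → RepType) (m : Fin (r + 1) → ℕ) where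
  U : CIdx t → Type u
  [addCommGroup : ∀ a, AddCommGroup (U a)]
  [module : ∀ a, Module ℂ (U a)]
  [finiteDimensional : ∀ a, FiniteDimensional ℂ (U a)]
  τ : ∀ a, Representation ℂ G (U a)
  irreducible : ∀ a, (τ a).IsIrreducible
  not_iso : ∀ a b, a ≠ b → IsEmpty ((τ a).Equiv (τ b))
  d : Fin (r + 1) → ℕ
  u : ∀ a, Module.Basis (Fin (d a.base)) ℂ (U a)
  T : ∀ a, Fin (m a.base) → U a →ₗ[ℂ] (Fin k → ℂ)
  equivariant : ∀ a μ g x, T a μ (τ a g x) = complexMat ρ g *ᵥ T a μ x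
  span_eq_top : ⊤ ≤ ⨆ a, ⨆ μ, LinearMap.range (T a μ)
  sum_eq : ∑ a : CIdx t, d a.base * m a.base = k
  form_one : ∀ i (h : t i = .one), ∃ B : U (.inl i) →ₗ[ℂ] U (.inr ⟨i, h⟩) →ₗ[ℂ] ℂ,
    B ≠ 0 ∧ IsInvariantForm (τ (.inl i)) (τ (.inr ⟨i, h⟩)) B
  form_two : ∀ i, t i = .two → ∃ B : U (.inl i) →ₗ[ℂ] U (.inl i) →ₗ[ℂ] ℂ,
    B ≠ 0 ∧ IsInvariantForm (τ (.inl i)) (τ (.inl i)) B ∧ ∀ x y, B x y = B y x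
  form_three : ∀ i, t i = .three → ∃ B : U (.inl i) →ₗ[ℂ] U (.inl i) →ₗ[ℂ] ℂ,
    B ≠ 0 ∧ IsInvariantForm (τ (.inl i)) (τ (.inl i)) B ∧ ∀ x y, B x y = -B y x

namespace SplitReps

attribute [instance] addCommGroup module finiteDimensional

variable {G : Type*} [Group G] {k : ℕ} {ρ : G →* Matrix.orthogonalGroup (Fin k) ℝ}
  {r : ℕ} {t : Fin (r + 1) → RepType} {m : Fin (r + 1) → ℕ} (D : SplitReps.{u} ρ t m)

lemma d_pos (i : Fin (r + 1)) : 0 < D.d i := by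
  have := nontrivial_of_irreducible (D.irreducible (.inl i))
  have h : Nonempty (Fin (D.d i)) := (D.u (.inl i)).index_nonempty
  exact Fin.pos_iff_nonempty.2 h

/-- The index set of the basis of `ℂ^k`. -/
abbrev Idx : Type := Σ a : CIdx t, Fin (D.d a.base) × Fin (m a.base)

/-- The vectors of the basis of `ℂ^k`. -/
def vec (j : D.Idx) : Fin k → ℂ := D.T j.1 j.2.2 (D.u j.1 j.2.1)

lemma top_le_span_vec : ⊤ ≤ Submodule.span ℂ (Set.range D.vec) := by
  refine D.span_eq_top.trans (iSup_le fun a => iSup_le fun μ => ?_)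
  rintro _ ⟨x, rfl⟩
  rw [← (D.u a).sum_repr x, map_sum]
  refine Submodule.sum_mem _ fun s _ => ?_
  rw [map_smul]
  exact Submodule.smul_mem _ _ (Submodule.subset_span ⟨⟨a, (s, μ)⟩, rfl⟩)

lemma card_idx : Fintype.card D.Idx = Module.finrank ℂ (Fin k → ℂ) := by
  rw [Module.finrank_fin_fun, Fintype.card_sigma]
  simp only [Fintype.card_prod, Fintype.card_fin]
  exact D.sum_eq

/-- The basis of `ℂ^k`. -/
def basis : Module.Basis D.Idx ℂ (Fin k → ℂ) :=
  basisOfTopLeSpanOfCardEqFinrank D.vec D.top_le_span_vec D.card_idx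

lemma basis_apply (j : D.Idx) : D.basis j = D.vec j := by
  rw [basis, coe_basisOfTopLeSpanOfCardEqFinrank]

/-- The embeddings of the multiplicity spaces. -/
def f (a : CIdx t) (s : Fin (D.d a.base)) : Matrix (Fin k) (Fin (m a.base)) ℂ :=
  Matrix.of fun x μ => D.vec ⟨a, (s, μ)⟩ x

/-- The projections to the multiplicity spaces. -/
def e (a : CIdx t) (s : Fin (D.d a.base)) : Matrix (Fin (m a.base)) (Fin k) ℂ :=
  Matrix.of fun μ x => D.basis.repr (Pi.single x 1) ⟨a, (s, μ)⟩

lemma e_mulVec (a : CIdx t) (s) (y : Fin k → ℂ) (μ) :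
    (D.e a s *ᵥ y) μ = D.basis.repr y ⟨a, (s, μ)⟩ := by
  conv_rhs => rw [pi_eq_sum_univ' y]
  simp only [map_sum, map_smul, Finsupp.coe_finsetSum, Finset.sum_apply, Finsupp.smul_apply]
  rw [Matrix.mulVec, dotProduct]
  refine Finset.sum_congr rfl fun x _ => ?_
  rw [e, Matrix.of_apply, smul_eq_mul, mul_comm]

lemma f_mulVec (a : CIdx t) (s) (v : Fin (m a.base) → ℂ) :
    D.f a s *ᵥ v = ∑ μ, v μ • D.vec ⟨a, (s, μ)⟩ := by
  ext x
  rw [Matrix.mulVec, dotProduct, Finset.sum_apply]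
  exact Finset.sum_congr rfl fun μ _ => mul_comm _ _

lemma e_mul_f_apply (a b : CIdx t) (s s') (μ ν) :
    (D.e a s * D.f b s') μ ν = D.basis.repr (D.basis ⟨b, (s', ν)⟩) ⟨a, (s, μ)⟩ := by
  rw [← D.e_mulVec, basis_apply]
  rfl

lemma e_mul_f_self (a : CIdx t) (s) : D.e a s * D.f a s = 1 := by
  ext μ ν
  rw [e_mul_f_apply, Module.Basis.repr_self, Finsupp.single_apply, Matrix.one_apply]
  refine if_congr ?_ rfl rfl
  simp [eq_comm]

lemma e_mul_f_of_ne (a : CIdx t) (s s') (h : s ≠ s') : D.e a s * D.f a s' = 0 := by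
  ext μ ν
  rw [e_mul_f_apply, Module.Basis.repr_self, Finsupp.single_apply, if_neg, Matrix.zero_apply]
  simp [h.symm]

lemma e_mul_f_of_ne' (a b : CIdx t) (s s') (h : a ≠ b) : D.e a s * D.f b s' = 0 := by
  ext μ ν
  rw [e_mul_f_apply, Module.Basis.repr_self, Finsupp.single_apply, if_neg, Matrix.zero_apply]
  intro h'
  exact h (congrArg Sigma.fst h').symm

lemma sum_f_mul_e : ∑ a, ∑ s, D.f a s * D.e a s = 1 := by
  refine Matrix.ext_of_mulVec_single fun x => ?_
  rw [Matrix.one_mulVec]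
  conv_rhs => rw [← D.basis.sum_repr (Pi.single x 1), Fintype.sum_sigma]
  simp only [Matrix.sum_mulVec, Fintype.sum_prod_type, ← Matrix.mulVec_mulVec, f_mulVec, e_mulVec,
    basis_apply]

lemma complexMat_mulVec_vec (g : G) (a : CIdx t) (s) (μ) : complexMat ρ g *ᵥ D.vec ⟨a, (s, μ)⟩ =
    ∑ s', (D.u a).repr (D.τ a g (D.u a s)) s' • D.vec ⟨a, (s', μ)⟩ := by
  rw [vec, ← D.equivariant]
  conv_lhs => rw [← (D.u a).sum_repr (D.τ a g (D.u a s)), map_sum]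
  exact Finset.sum_congr rfl fun s' _ => map_smul _ _ _

lemma complexMat_mul_f (g : G) (a : CIdx t) (s) : complexMat ρ g * D.f a s =
    ∑ s', (D.u a).repr (D.τ a g (D.u a s)) s' • D.f a s' := by
  refine Matrix.ext_of_mulVec_single fun μ => ?_
  rw [← Matrix.mulVec_mulVec, Matrix.sum_mulVec, Matrix.mulVec_single_one]
  refine (D.complexMat_mulVec_vec g a s μ).trans (Finset.sum_congr rfl fun s' _ => ?_)
  rw [Matrix.smul_mulVec, Matrix.mulVec_single_one]
  rfl

/-- Schur orthogonality: a suitable combination of group elements acts as a matrix unit on the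
constituent `a` and as zero on all the others. Invariant subspaces are therefore stable under these
matrix units. -/
lemma f_mul_e_mem [Finite G] (a : CIdx t) (s s' : Fin (D.d a.base)) :
    D.f a s * D.e a s' ∈ Submodule.span ℂ (Set.range (complexMat ρ)) := by
  have := Fintype.ofFinite G
  set l : D.U a →ₗ[ℂ] ℂ := (D.u a).coord s'
  set n : ℂ := (Module.finrank ℂ (D.U a) : ℂ) with hn
  -- The matrix coefficients of `τ a` at the inverse elements, normalised by the dimension over the
  -- order of the group.
  set c : G → ℂ := fun g => (Fintype.card G : ℂ)⁻¹ * n * l (D.τ a g⁻¹ (D.u a s))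
  have hG : (Fintype.card G : ℂ) ≠ 0 := Nat.cast_ne_zero.2 Fintype.card_ne_zero
  have hself : ∀ w, ∑ g, c g • D.τ a g w = l w • D.u a s := by
    intro w
    have h1 := sum_coeff_smul_self (D.irreducible a) l (D.u a s) w
    simp only [c, ← smul_smul]
    rw [← Finset.smul_sum, ← Finset.smul_sum]
    simp only [smul_smul] at h1 ⊢
    rw [← hn] at h1
    rw [← smul_smul, h1, smul_smul, ← mul_assoc, inv_mul_cancel₀ hG, one_mul]
  have hne : ∀ b, a ≠ b → ∀ w, ∑ g, c g • D.τ b g w = 0 := by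
    intro b hab w
    simp only [c, ← smul_smul]
    rw [← Finset.smul_sum, ← Finset.smul_sum, sum_coeff_smul_of_isEmpty (D.irreducible a)
      (D.irreducible b) (D.not_iso a b hab), smul_zero, smul_zero]
  have hT : ∀ b ν w, (∑ g, c g • complexMat ρ g) *ᵥ D.T b ν w =
      D.T b ν (∑ g, c g • D.τ b g w) := by
    intro b ν w
    rw [Matrix.sum_mulVec, map_sum]
    refine Finset.sum_congr rfl fun g _ => ?_
    rw [Matrix.smul_mulVec, map_smul, D.equivariant]
  have key : D.f a s * D.e a s' = ∑ g, c g • complexMat ρ g := by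
    refine Matrix.toLin'.injective (D.basis.ext fun j => ?_)
    rw [Matrix.toLin'_apply, Matrix.toLin'_apply, ← Matrix.mulVec_mulVec, f_mulVec]
    simp only [e_mulVec, Module.Basis.repr_self]
    rw [basis_apply, vec, hT]
    obtain ⟨b, r, ν⟩ := j
    by_cases hab : a = b
    · subst hab
      rw [hself, map_smul, Finset.sum_eq_single ν]
      · have : l (D.u a r) = if r = s' then 1 else 0 := by
          simp [l, Module.Basis.coord_apply, Finsupp.single_apply]
        rw [this, Finsupp.single_apply]
        congr 1
        exact if_congr (by simp) rfl rfl
      · intro μ _ hμ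
        rw [Finsupp.single_apply, if_neg, zero_smul]
        intro h
        simp at h
        exact hμ h.2.symm
      · simp
    · rw [hne b hab, map_zero]
      refine Finset.sum_eq_zero fun μ _ => ?_
      rw [Finsupp.single_apply, if_neg, zero_smul]
      intro h
      exact hab (congrArg Sigma.fst h).symm
  rw [key]
  exact Submodule.sum_mem _ fun g _ => Submodule.smul_mem _ _ (Submodule.subset_span ⟨g, rfl⟩)

/-- The two representations are dual to each other. -/
def Paired (a b : CIdx t) : Prop :=
  ∃ B : D.U a →ₗ[ℂ] D.U b →ₗ[ℂ] ℂ, B ≠ 0 ∧ IsInvariantForm (D.τ a) (D.τ b) B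

-- Two constituents dual to the same `b` would be isomorphic, since the two forms differ by a
-- nonzero equivariant map.
variable {D} in
lemma Paired.eq {a a' b : CIdx t} (h : D.Paired a b) (h' : D.Paired a' b) : a = a' := by
  obtain ⟨B, hB, h⟩ := h
  obtain ⟨B', hB', h'⟩ := h'
  by_contra hne
  obtain ⟨f, hf, hBf⟩ := h.exists_comp (D.irreducible a) (D.irreducible b) hB h'
  have hf0 : f ≠ 0 := by
    rintro rfl
    refine hB' (LinearMap.ext fun x => ?_)
    rw [hBf, LinearMap.zero_apply, map_zero, LinearMap.zero_apply]
  obtain ⟨e⟩ := nonempty_equiv_of_ne_zero (D.irreducible a') (D.irreducible a) hf hf0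
  exact (D.not_iso a' a (Ne.symm hne)).false e

lemma paired_one (i) (h : t i = .one) : D.Paired (.inl i) (.inr ⟨i, h⟩) := D.form_one i h

lemma paired_one' (i) (h : t i = .one) : D.Paired (.inr ⟨i, h⟩) (.inl i) := by
  obtain ⟨B, hB, h⟩ := D.form_one i h
  exact ⟨B.flip, flip_ne_zero hB, h.flip⟩

lemma exists_paired (b : CIdx t) : ∃ a : CIdx t, a.base = b.base ∧ D.Paired a b := by
  rcases b with i | ⟨i, hi⟩
  · rcases h : t i with _ | _ | _
    · exact ⟨.inr ⟨i, h⟩, rfl, D.paired_one' i h⟩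
    · obtain ⟨B, hB, h, -⟩ := D.form_two i h
      exact ⟨.inl i, rfl, B, hB, h⟩
    · obtain ⟨B, hB, h, -⟩ := D.form_three i h
      exact ⟨.inl i, rfl, B, hB, h⟩
  · exact ⟨.inl i, rfl, D.paired_one i hi⟩

/-- The pull-back of the standard bilinear form. -/
def pullback (a b : CIdx t) (μ : Fin (m a.base)) (ν : Fin (m b.base)) : D.U a →ₗ[ℂ] D.U b →ₗ[ℂ] ℂ :=
  (dotProductBilin ℂ ℂ).compl₁₂ (D.T a μ) (D.T b ν)

lemma pullback_apply (a b : CIdx t) (μ ν) (x y) :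
    D.pullback a b μ ν x y = D.T a μ x ⬝ᵥ D.T b ν y := rfl

lemma complexMat_transpose_mul (g : G) : (complexMat ρ g)ᵀ * complexMat ρ g = 1 := by
  have h := (Matrix.mem_orthogonalGroup_iff' _ _).1 (ρ g).2
  rw [complexMat, ← Matrix.transpose_map]
  have h2 := congrArg (fun M : Matrix (Fin k) (Fin k) ℝ => M.map Complex.ofRealHom) h
  rw [Matrix.map_mul, Matrix.map_one _ (map_zero _) (map_one _)] at h2
  exact h2

lemma isInvariantForm_pullback (a b : CIdx t) (μ ν) :
    IsInvariantForm (D.τ a) (D.τ b) (D.pullback a b μ ν) := by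
  intro g x y
  rw [pullback_apply, pullback_apply, D.equivariant, D.equivariant, Matrix.dotProduct_mulVec,
    Matrix.vecMul_mulVec, complexMat_transpose_mul, Matrix.vecMul_one]

lemma f_transpose_mul_f_apply (a b : CIdx t) (s s' μ ν) :
    ((D.f a s)ᵀ * D.f b s') μ ν = D.pullback a b μ ν (D.u a s) (D.u b s') := rfl

/-- The pull-back of the dot product to two constituents is invariant, as the action is orthogonal;
without an invariant form it has to vanish. -/
lemma f_transpose_mul_f_eq_zero {a b : CIdx t} (h : ¬ D.Paired a b) (s s') :
    (D.f a s)ᵀ * D.f b s' = 0 := by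
  ext μ ν
  rw [f_transpose_mul_f_apply, Matrix.zero_apply]
  by_contra h1
  refine h ⟨D.pullback a b μ ν, fun h2 => h1 ?_, D.isInvariantForm_pullback a b μ ν⟩
  rw [h2, LinearMap.zero_apply, LinearMap.zero_apply]

/-- The pull-backs are multiples of a given form. -/
lemma exists_pullback_eq {a b : CIdx t} {B : D.U a →ₗ[ℂ] D.U b →ₗ[ℂ] ℂ} (hB : B ≠ 0)
    (h : IsInvariantForm (D.τ a) (D.τ b) B) :
    ∃ β : Matrix (Fin (m a.base)) (Fin (m b.base)) ℂ,
      ∀ μ ν x y, D.pullback a b μ ν x y = β μ ν * B x y := by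
  choose β hβ using fun μ ν => h.exists_smul (D.irreducible a) (D.irreducible b) hB
    (D.isInvariantForm_pullback a b μ ν)
  exact ⟨Matrix.of β, hβ⟩

lemma exists_ne_zero {a b : CIdx t} {B : D.U a →ₗ[ℂ] D.U b →ₗ[ℂ] ℂ} (hB : B ≠ 0) :
    ∃ s s', B (D.u a s) (D.u b s') ≠ 0 := by
  by_contra! h
  exact hB ((D.u a).ext fun s => (D.u b).ext fun s' => h s s')

lemma exists_pairing {a b : CIdx t} {B : D.U a →ₗ[ℂ] D.U b →ₗ[ℂ] ℂ}
    {β : Matrix (Fin (m a.base)) (Fin (m b.base)) ℂ} (hB : B ≠ 0)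
    (h : ∀ μ ν x y, D.pullback a b μ ν x y = β μ ν * B x y) :
    ∃ c : Fin (D.d a.base) → Fin (D.d b.base) → ℂ, (∃ s s', c s s' ≠ 0) ∧
      ∀ s s', (D.f a s)ᵀ * D.f b s' = c s s' • β := by
  refine ⟨fun s s' => B (D.u a s) (D.u b s'), D.exists_ne_zero hB, fun s s' => ?_⟩
  ext μ ν
  rw [f_transpose_mul_f_apply, h, mul_comm]
  rfl

/-- For a form with the symmetry `ε`, the matrix of multiples has the same symmetry. -/
lemma transpose_eq_of_symm {a : CIdx t} {B : D.U a →ₗ[ℂ] D.U a →ₗ[ℂ] ℂ}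
    {β : Matrix (Fin (m a.base)) (Fin (m a.base)) ℂ} (hB : B ≠ 0)
    (h : ∀ μ ν x y, D.pullback a a μ ν x y = β μ ν * B x y) {ε : ℂ}
    (hs : ∀ x y, B x y = ε * B y x) : βᵀ = ε • β := by
  obtain ⟨s, s', hss⟩ := D.exists_ne_zero hB
  ext μ ν
  have h1 := h ν μ (D.u a s) (D.u a s')
  rw [pullback_apply, dotProduct_comm, ← pullback_apply, h, hs (D.u a s')] at h1
  have h2 : ε * β μ ν = β ν μ := by
    apply mul_right_cancel₀ hss
    rw [← h1]
    ring
  exact h2.symm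

/-- A single matrix covers the three types, so that `β` can be chosen as one function of `i`. -/
lemma exists_β (i : Fin (r + 1)) : ∃ β : Matrix (Fin (m i)) (Fin (m i)) ℂ,
    (∀ h : t i = .one, ∃ c : Fin (D.d i) → Fin (D.d i) → ℂ, (∃ s s', c s s' ≠ 0) ∧
      ∀ s s', (D.f (.inl i) s)ᵀ * D.f (.inr ⟨i, h⟩) s' = c s s' • β) ∧
    (t i = .two → βᵀ = β ∧ ∃ c : Fin (D.d i) → Fin (D.d i) → ℂ, (∃ s s', c s s' ≠ 0) ∧
      ∀ s s', (D.f (.inl i) s)ᵀ * D.f (.inl i) s' = c s s' • β) ∧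
    (t i = .three → βᵀ = -β ∧ ∃ c : Fin (D.d i) → Fin (D.d i) → ℂ, (∃ s s', c s s' ≠ 0) ∧
      ∀ s s', (D.f (.inl i) s)ᵀ * D.f (.inl i) s' = c s s' • β) := by
  obtain h | h | h := (t i).eq_one_or
  · obtain ⟨B, hB, hinv⟩ := D.form_one i h
    obtain ⟨β, hβ⟩ := D.exists_pullback_eq hB hinv
    exact ⟨β, fun _ => D.exists_pairing hB hβ, fun h' => RepType.noConfusion (h.symm.trans h'),
      fun h' => RepType.noConfusion (h.symm.trans h')⟩
  · obtain ⟨B, hB, hinv, hs⟩ := D.form_two i h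
    obtain ⟨β, hβ⟩ := D.exists_pullback_eq hB hinv
    refine ⟨β, fun h' => RepType.noConfusion (h.symm.trans h'), fun _ => ⟨?_, D.exists_pairing hB hβ⟩,
      fun h' => RepType.noConfusion (h.symm.trans h')⟩
    refine (D.transpose_eq_of_symm hB hβ fun x y => ?_).trans (one_smul ℂ _)
    rw [one_mul, hs]
  · obtain ⟨B, hB, hinv, hs⟩ := D.form_three i h
    obtain ⟨β, hβ⟩ := D.exists_pullback_eq hB hinv
    refine ⟨β, fun h' => RepType.noConfusion (h.symm.trans h'), fun h' => RepType.noConfusion (h.symm.trans h'),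
      fun _ => ⟨?_, D.exists_pairing hB hβ⟩⟩
    refine (D.transpose_eq_of_symm hB hβ (ε := -1) fun x y => ?_).trans
      (neg_one_smul ℂ _)
    rw [hs, neg_one_mul]

/-- The splitting of `ℂ^k`. -/
def toSplitBase [Finite G] : SplitBase ρ t m where
  d := D.d
  d_pos := D.d_pos
  f := D.f
  e := D.e
  e_mul_f_self := D.e_mul_f_self
  e_mul_f_of_ne := D.e_mul_f_of_ne
  e_mul_f_of_ne' := D.e_mul_f_of_ne'
  sum_f_mul_e := D.sum_f_mul_e
  f_mul_e_mem := D.f_mul_e_mem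
  complexMat_mul_f g a s := ⟨_, D.complexMat_mul_f g a s⟩
  β i := (D.exists_β i).choose
  pair_one i := (D.exists_β i).choose_spec.1
  pair_two i := (D.exists_β i).choose_spec.2.1
  pair_three i := (D.exists_β i).choose_spec.2.2
  -- The unique partner of `b` belongs to the same real representation as `b`.
  pair_base a b h := D.f_transpose_mul_f_eq_zero fun h1 => by
    obtain ⟨a', ha', h2⟩ := D.exists_paired b
    exact h ((congrArg CIdx.base (h1.eq h2)).trans ha')
  pair_inl i h := D.f_transpose_mul_f_eq_zero fun h1 =>
    Sum.inl_ne_inr (h1.eq (D.paired_one' i h))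
  pair_inr i := D.f_transpose_mul_f_eq_zero fun h1 =>
    Sum.inr_ne_inl (h1.eq (D.paired_one i.1 i.2))

end SplitReps

end Reps

/-! ### Complexifications -/

section Irreducible

/-- Irreducibility is invariant under semilinear equivalences. -/
lemma irreducible_of_semilinearEquiv {G F U U' : Type*} [Group G] [Field F] [AddCommGroup U]
    [Module F U] [AddCommGroup U'] [Module F U'] {s s' : F →+* F} [RingHomInvPair s s']
    [RingHomInvPair s' s] {π : Representation F G U} {π' : Representation F G U'}
    (e : U ≃ₛₗ[s] U') (he : ∀ g x, e (π g x) = π' g (e x)) (h : π.IsIrreducible) :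
    π'.IsIrreducible := by
  have he' : ∀ g y, e.symm (π' g y) = π g (e.symm y) := fun g y => e.injective (by
    rw [he, e.apply_symm_apply, e.apply_symm_apply])
  let i : Subrepresentation π' ≃o Subrepresentation π :=
    { toFun := fun N => ⟨N.toSubmodule.comap (e : U →ₛₗ[s] U'), fun g x hx => by
        change e (π g x) ∈ N.toSubmodule
        rw [he]
        exact N.apply_mem_toSubmodule g hx⟩
      invFun := fun N => ⟨N.toSubmodule.comap (e.symm : U' →ₛₗ[s'] U), fun g x hx => by
        change e.symm (π' g x) ∈ N.toSubmodule
        rw [he']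
        exact N.apply_mem_toSubmodule g hx⟩
      left_inv := fun N => Subrepresentation.toSubmodule_injective <| by
        ext x
        change e (e.symm x) ∈ N.toSubmodule ↔ _
        rw [e.apply_symm_apply]
      right_inv := fun N => Subrepresentation.toSubmodule_injective <| by
        ext x
        change e.symm (e x) ∈ N.toSubmodule ↔ _
        rw [e.symm_apply_apply]
      map_rel_iff' := by
        intro N N'
        constructor
        · intro h x hx
          have := h (show e.symm x ∈ _ from by
            change e (e.symm x) ∈ N.toSubmodule
            rw [e.apply_symm_apply]
            exact hx)
          change e (e.symm x) ∈ N'.toSubmodule at this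
          rwa [e.apply_symm_apply] at this
        · exact fun h x hx => h hx }
  exact i.isSimpleOrder

end Irreducible

section Complexification

variable {G : Type*} [Group G] {W : Type*} [AddCommGroup W] [Module ℝ W]

lemma complexify_tmul (σ : Representation ℝ G W) (g : G) (z : ℂ) (w : W) :
    complexify σ g (z ⊗ₜ w) = z ⊗ₜ σ g w := rfl

lemma conjMap_tmul (z : ℂ) (w : W) : conjMap W (z ⊗ₜ w) = (starRingEnd ℂ z) ⊗ₜ w := rfl

lemma conjMap_conjMap (x : ℂ ⊗[ℝ] W) : conjMap W (conjMap W x) = x := by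
  induction x using TensorProduct.induction_on with
  | zero => simp
  | tmul z w => rw [conjMap_tmul, conjMap_tmul, Complex.conj_conj]
  | add x y hx hy => rw [map_add, map_add, hx, hy]

lemma conjMap_complexify (σ : Representation ℝ G W) (g : G) (x : ℂ ⊗[ℝ] W) :
    conjMap W (complexify σ g x) = complexify σ g (conjMap W x) := by
  induction x using TensorProduct.induction_on with
  | zero => simp
  | tmul z w => rfl
  | add x y hx hy => simp only [map_add, hx, hy]

/-- The real part of a vector of the complexification. -/
def rePart (W : Type*) [AddCommGroup W] [Module ℝ W] : ℂ ⊗[ℝ] W →ₗ[ℝ] W :=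
  (TensorProduct.lid ℝ W).toLinearMap ∘ₗ LinearMap.rTensor W Complex.reLm

/-- The imaginary part of a vector of the complexification. -/
def imPart (W : Type*) [AddCommGroup W] [Module ℝ W] : ℂ ⊗[ℝ] W →ₗ[ℝ] W :=
  (TensorProduct.lid ℝ W).toLinearMap ∘ₗ LinearMap.rTensor W Complex.imLm

lemma rePart_tmul (z : ℂ) (w : W) : rePart W (z ⊗ₜ w) = z.re • w := rfl

lemma imPart_tmul (z : ℂ) (w : W) : imPart W (z ⊗ₜ w) = z.im • w := rfl

lemma tmul_re_add_im (x : ℂ ⊗[ℝ] W) :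
    (1 : ℂ) ⊗ₜ[ℝ] rePart W x + Complex.I ⊗ₜ[ℝ] imPart W x = x := by
  induction x using TensorProduct.induction_on with
  | zero => simp
  | tmul z w =>
    rw [rePart_tmul, imPart_tmul, TensorProduct.tmul_smul, TensorProduct.tmul_smul,
      TensorProduct.smul_tmul', TensorProduct.smul_tmul', ← TensorProduct.add_tmul]
    congr 1
    apply Complex.ext <;> simp
  | add x y hx hy =>
    conv_rhs => rw [← hx, ← hy]
    rw [map_add, map_add, TensorProduct.tmul_add, TensorProduct.tmul_add]
    abel

lemma rePart_complexify (σ : Representation ℝ G W) (g : G) (x : ℂ ⊗[ℝ] W) :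
    rePart W (complexify σ g x) = σ g (rePart W x) := by
  induction x using TensorProduct.induction_on with
  | zero => simp
  | tmul z w => rw [complexify_tmul, rePart_tmul, rePart_tmul, map_smul]
  | add x y hx hy => simp only [map_add, hx, hy]

lemma imPart_complexify (σ : Representation ℝ G W) (g : G) (x : ℂ ⊗[ℝ] W) :
    imPart W (complexify σ g x) = σ g (imPart W x) := by
  induction x using TensorProduct.induction_on with
  | zero => simp
  | tmul z w => rw [complexify_tmul, imPart_tmul, imPart_tmul, map_smul]
  | add x y hx hy => simp only [map_add, hx, hy]

/-! #### The conjugate of a subrepresentation -/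

section Conj

variable {σ : Representation ℝ G W} (S : Subrepresentation (complexify σ))

/-- The complex conjugate of a subrepresentation. -/
def conjSub : Subrepresentation (complexify σ) where
  toSubmodule := S.toSubmodule.comap (conjMap W)
  apply_mem_toSubmodule g x hx := by
    rw [Submodule.mem_comap, conjMap_complexify]
    exact S.apply_mem_toSubmodule g hx

lemma mem_conjSub {x : ℂ ⊗[ℝ] W} : x ∈ (conjSub S).toSubmodule ↔ conjMap W x ∈ S.toSubmodule :=
  Iff.rfl

lemma conjMap_mem_conjSub {x : ℂ ⊗[ℝ] W} (hx : x ∈ S.toSubmodule) :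
    conjMap W x ∈ (conjSub S).toSubmodule := by
  rwa [mem_conjSub, conjMap_conjMap]

lemma toSubmodule_conjSub : (conjSub S).toSubmodule = S.toSubmodule.map (conjMap W) := by
  ext x
  constructor
  · exact fun hx => ⟨_, hx, conjMap_conjMap x⟩
  · rintro ⟨y, hy, rfl⟩
    exact conjMap_mem_conjSub S hy

/-- Complex conjugation, from a subrepresentation to its conjugate. -/
def conjEquiv : S.toSubmodule ≃ₛₗ[starRingEnd ℂ] (conjSub S).toSubmodule where
  toFun x := ⟨conjMap W x.1, conjMap_mem_conjSub S x.2⟩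
  map_add' x y := Subtype.ext (map_add (conjMap W) x.1 y.1)
  map_smul' c x := Subtype.ext ((conjMap W).map_smulₛₗ c x.1)
  invFun x := ⟨conjMap W x.1, x.2⟩
  left_inv x := Subtype.ext (conjMap_conjMap x.1)
  right_inv x := Subtype.ext (conjMap_conjMap x.1)

lemma coe_conjEquiv (x : S.toSubmodule) : (conjEquiv S x : ℂ ⊗[ℝ] W) = conjMap W x.1 := rfl

lemma coe_conjEquiv_symm (x : (conjSub S).toSubmodule) :
    ((conjEquiv S).symm x : ℂ ⊗[ℝ] W) = conjMap W x.1 := rfl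

lemma conjEquiv_equivariant (g : G) (x : S.toSubmodule) :
    conjEquiv S (S.toRepresentation g x) = (conjSub S).toRepresentation g (conjEquiv S x) :=
  Subtype.ext (conjMap_complexify σ g x.1)

lemma conjEquiv_symm_equivariant (g : G) (x : (conjSub S).toSubmodule) :
    (conjEquiv S).symm ((conjSub S).toRepresentation g x) =
      S.toRepresentation g ((conjEquiv S).symm x) :=
  Subtype.ext (conjMap_complexify σ g x.1)

variable {S} in
lemma irreducible_conjSub (h : S.toRepresentation.IsIrreducible) :
    (conjSub S).toRepresentation.IsIrreducible :=
  irreducible_of_semilinearEquiv (conjEquiv S) (conjEquiv_equivariant S) h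

/-- The conjugate of a basis. -/
def conjBasis {ι : Type*} [Fintype ι] (b : Module.Basis ι ℂ S.toSubmodule) :
    Module.Basis ι ℂ (conjSub S).toSubmodule :=
  Module.Basis.ofEquivFun
    { toFun := fun x i => starRingEnd ℂ (b.repr ((conjEquiv S).symm x) i)
      map_add' := fun x y => by
        funext i
        simp
      map_smul' := fun c x => by
        funext i
        simp [LinearEquiv.map_smulₛₗ]
      invFun := fun v => conjEquiv S (b.equivFun.symm fun i => starRingEnd ℂ (v i))
      left_inv := fun x => by
        simp only [Complex.conj_conj]
        change conjEquiv S (b.equivFun.symm (b.equivFun _)) = x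
        rw [LinearEquiv.symm_apply_apply, LinearEquiv.apply_symm_apply]
      right_inv := fun v => by
        funext i
        change starRingEnd ℂ (b.equivFun ((conjEquiv S).symm (conjEquiv S (b.equivFun.symm
          fun i => starRingEnd ℂ (v i)))) i) = v i
        rw [LinearEquiv.symm_apply_apply, LinearEquiv.apply_symm_apply, Complex.conj_conj] }

lemma conjBasis_repr {ι : Type*} [Fintype ι] (b : Module.Basis ι ℂ S.toSubmodule)
    (x : (conjSub S).toSubmodule) (i : ι) :
    (conjBasis S b).repr x i = starRingEnd ℂ (b.repr ((conjEquiv S).symm x) i) := rfl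

lemma conjBasis_apply {ι : Type*} [Fintype ι] (b : Module.Basis ι ℂ S.toSubmodule)
    (i : ι) : conjBasis S b i = conjEquiv S (b i) := by
  classical
  apply (conjBasis S b).repr.injective
  ext j
  rw [Module.Basis.repr_self, conjBasis_repr, LinearEquiv.symm_apply_apply,
    Module.Basis.repr_self, Finsupp.single_apply]
  split_ifs <;> simp

variable [FiniteDimensional ℝ W]

lemma finrank_conjSub :
    Module.finrank ℂ (conjSub S).toSubmodule = Module.finrank ℂ S.toSubmodule := by
  rw [Module.finrank_eq_card_basis (conjBasis S (Module.finBasis ℂ S.toSubmodule)),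
    Fintype.card_fin]

lemma character_conjSub (g : G) : (conjSub S).toRepresentation.character g =
    starRingEnd ℂ (S.toRepresentation.character g) := by
  let b := Module.finBasis ℂ S.toSubmodule
  rw [Representation.character, Representation.character,
    LinearMap.trace_eq_matrix_trace ℂ (conjBasis S b), LinearMap.trace_eq_matrix_trace ℂ b,
    Matrix.trace, Matrix.trace, map_sum]
  refine Finset.sum_congr rfl fun i _ => ?_
  rw [Matrix.diag_apply, Matrix.diag_apply, LinearMap.toMatrix_apply, LinearMap.toMatrix_apply,
    conjBasis_repr, conjBasis_apply, conjEquiv_symm_equivariant, LinearEquiv.symm_apply_apply]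

end Conj

/-! #### The invariant form of the complexification -/

variable [FiniteDimensional ℝ W] [Finite G]

/-- Average the dot product of some basis over the group; positivity survives. -/
lemma exists_invariant_inner (σ : Representation ℝ G W) : ∃ b : W →ₗ[ℝ] W →ₗ[ℝ] ℝ,
    (∀ x y, b x y = b y x) ∧ IsInvariantForm σ σ b ∧ ∀ x, x ≠ 0 → 0 < b x x := by
  have := Fintype.ofFinite G
  let e := (Module.finBasis ℝ W).equivFun
  let b₀ : W →ₗ[ℝ] W →ₗ[ℝ] ℝ := (dotProductBilin ℝ ℝ).compl₁₂ e.toLinearMap e.toLinearMap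
  have hb₀ : ∀ x y, b₀ x y = e x ⬝ᵥ e y := fun x y => rfl
  have hpos : ∀ x, x ≠ 0 → 0 < b₀ x x := by
    intro x hx
    rw [hb₀]
    have h1 : e x ≠ 0 := fun h => hx (by simpa using h)
    obtain ⟨i, hi⟩ := Function.ne_iff.1 h1
    exact Finset.sum_pos' (fun j _ => mul_self_nonneg _) ⟨i, Finset.mem_univ _, mul_self_pos.2 hi⟩
  refine ⟨∑ g, b₀.compl₁₂ (σ g) (σ g), fun x y => ?_, fun h x y => ?_, fun x hx => ?_⟩
  · simp only [LinearMap.sum_apply, LinearMap.compl₁₂_apply, hb₀]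
    exact Finset.sum_congr rfl fun g _ => dotProduct_comm _ _
  · simp only [LinearMap.sum_apply, LinearMap.compl₁₂_apply]
    rw [← Equiv.sum_comp (Equiv.mulRight h) fun g => b₀ (σ g x) (σ g y)]
    refine Finset.sum_congr rfl fun g _ => ?_
    rw [Equiv.coe_mulRight, map_mul, Module.End.mul_apply, Module.End.mul_apply]
  · simp only [LinearMap.sum_apply, LinearMap.compl₁₂_apply]
    refine Finset.sum_pos (fun g _ => hpos _ fun h => hx ?_) Finset.univ_nonempty
    have := congrArg (σ g⁻¹) h
    rwa [map_zero, ← Module.End.mul_apply, ← map_mul, inv_mul_cancel, map_one,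
      Module.End.one_apply] at this

/-- The complex bilinear extension of an invariant inner product. On a vector with real part `u` and
imaginary part `v`, paired with its conjugate, it is `b u u + b v v`, which is the source of all
later non-vanishing. -/
lemma exists_invariant_form (σ : Representation ℝ G W) :
    ∃ B : (ℂ ⊗[ℝ] W) →ₗ[ℂ] (ℂ ⊗[ℝ] W) →ₗ[ℂ] ℂ, (∀ x y, B x y = B y x) ∧
      IsInvariantForm (complexify σ) (complexify σ) B ∧
      ∀ x, x ≠ 0 → ∃ c : ℝ, 0 < c ∧ B (conjMap W x) x = c := by
  obtain ⟨b, hs, hinv, hpos⟩ := exists_invariant_inner σ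
  let B : (ℂ ⊗[ℝ] W) →ₗ[ℂ] (ℂ ⊗[ℝ] W) →ₗ[ℂ] ℂ := LinearMap.BilinForm.baseChange ℂ b
  have hB : ∀ z w z' w', B (z ⊗ₜ w) (z' ⊗ₜ w') = b w w' • (z * z') := fun z w z' w' =>
    LinearMap.BilinForm.baseChange_tmul b z w z' w'
  refine ⟨B, fun x y => ?_, fun g x y => ?_, fun x hx => ?_⟩
  · rw [← tmul_re_add_im x, ← tmul_re_add_im y]
    simp only [map_add, LinearMap.add_apply, hB, hs (rePart W y), hs (imPart W y)]
    ring_nf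
  · rw [← tmul_re_add_im x, ← tmul_re_add_im y]
    simp only [map_add, LinearMap.add_apply, complexify_tmul, hB, hinv g]
  · set u := rePart W x with hu
    set v := imPart W x with hv
    have hnn : ∀ w, 0 ≤ b w w := fun w => by
      by_cases h : w = 0
      · rw [h, map_zero]
      · exact (hpos w h).le
    refine ⟨b u u + b v v, ?_, ?_⟩
    · by_cases h : u = 0
      · have h' : v ≠ 0 := fun h' => hx (by
          rw [← tmul_re_add_im x, ← hu, ← hv, h, h', TensorProduct.tmul_zero,
            TensorProduct.tmul_zero, add_zero])
        exact add_pos_of_nonneg_of_pos (hnn u) (hpos v h')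
      · exact add_pos_of_pos_of_nonneg (hpos u h) (hnn v)
    · rw [← tmul_re_add_im x, ← hu, ← hv]
      simp only [map_add, LinearMap.add_apply, conjMap_tmul, hB, hs v u]
      apply Complex.ext <;> simp



end Complexification

/-! ### Isomorphisms between subrepresentations of complexifications -/

section Compare

variable {G : Type*} [Group G]

lemma equiv_equivariant {F U U' : Type*} [Field F] [AddCommGroup U] [Module F U] [AddCommGroup U']
    [Module F U'] {π : Representation F G U} {π' : Representation F G U'} (e : π.Equiv π') (g : G)
    (x : U) : e (π g x) = π' g (e x) :=
  LinearMap.congr_fun (e.isIntertwining' g) x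

/-- The conjugate subrepresentation has the conjugate character, so an isomorphism makes the
character real. -/
lemma isEmpty_equiv_conjSub {W : Type*} [AddCommGroup W] [Module ℝ W] [FiniteDimensional ℝ W]
    {σ : Representation ℝ G W} {S : Subrepresentation (complexify σ)}
    (h : ¬ HasRealCharacter S.toRepresentation) :
    IsEmpty (S.toRepresentation.Equiv (conjSub S).toRepresentation) := by
  refine ⟨fun e => h fun g => ?_⟩
  have h1 := congrFun (Representation.char_iso e) g
  rw [character_conjSub] at h1
  exact Complex.conj_eq_iff_im.1 h1.symm

/-- A representation with an invariant real structure is realizable over `ℝ`. -/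
lemma isRealizableOverReal_of_involution {U : Type*} [AddCommGroup U] [Module ℂ U]
    [FiniteDimensional ℂ U] (τ : Representation ℂ G U) (j : U →ₛₗ[starRingEnd ℂ] U)
    (hj : ∀ x, j (j x) = x) (hτ : ∀ g x, j (τ g x) = τ g (j x)) : IsRealizableOverReal τ := by
  -- The fixed points of the conjugate-linear involution are the required real form.
  let R : Submodule ℝ U :=
    { carrier := {x | j x = x}
      add_mem' := fun {x y} hx hy => by
        change j (x + y) = x + y
        rw [map_add, hx, hy]
      zero_mem' := map_zero j
      smul_mem' := fun c x hx => by
        change j (c • x) = c • x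
        rw [← Complex.coe_smul, map_smulₛₗ, Complex.conj_ofReal, hx] }
  have hR : ∀ x, x ∈ R ↔ j x = x := fun x => Iff.rfl
  let b := (Module.finBasis ℝ R).equivFun
  have hmem : ∀ g, ∀ x ∈ R, τ g x ∈ R := fun g x hx => by
    rw [hR, hτ, (hR x).1 hx]
  let τR : G → R →ₗ[ℝ] R := fun g => ((τ g).restrictScalars ℝ).restrict (hmem g)
  let σ : Representation ℝ G (Fin (Module.finrank ℝ R) → ℝ) :=
    { toFun := fun g => b.toLinearMap ∘ₗ τR g ∘ₗ b.symm.toLinearMap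
      map_one' := by
        refine LinearMap.ext fun x => ?_
        change b (τR 1 (b.symm x)) = x
        have : τR 1 (b.symm x) = b.symm x := Subtype.ext (by
          change τ 1 (b.symm x).1 = _
          rw [map_one, Module.End.one_apply])
        rw [this, b.apply_symm_apply]
      map_mul' := fun g h => by
        refine LinearMap.ext fun x => ?_
        change b (τR (g * h) (b.symm x)) = b (τR g (b.symm (b (τR h (b.symm x)))))
        rw [b.symm_apply_apply]
        congr 1
        refine Subtype.ext ?_
        change τ (g * h) (b.symm x).1 = τ g (τ h (b.symm x).1)
        rw [map_mul, Module.End.mul_apply] }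
  let l : (Fin (Module.finrank ℝ R) → ℝ) →ₗ[ℝ] U := R.subtype ∘ₗ b.symm.toLinearMap
  let f : (ℂ ⊗[ℝ] (Fin (Module.finrank ℝ R) → ℝ)) →ₗ[ℂ] U := l.liftBaseChange ℂ
  have hf : ∀ z v, f (z ⊗ₜ v) = z • (b.symm v : U) := fun z v => rfl
  have hfx : ∀ x, f x = (b.symm (rePart _ x) : U) + Complex.I • (b.symm (imPart _ x) : U) := by
    intro x
    conv_lhs => rw [← tmul_re_add_im x]
    rw [map_add, hf, hf, one_smul]
  refine ⟨_, σ, nonempty_equiv_of_bijective (f := f) (fun g x => ?_) ⟨?_, fun x => ?_⟩⟩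
  · induction x using TensorProduct.induction_on with
    | zero => simp
    | tmul z v =>
      rw [complexify_tmul, hf, hf, map_smul]
      congr 1
      change ((b.symm (b (τR g (b.symm v))) : R) : U) = _
      rw [b.symm_apply_apply]
      rfl
    | add x y hx hy => simp only [map_add, hx, hy]
  · rw [← LinearMap.ker_eq_bot, LinearMap.ker_eq_bot']
    intro x hx
    rw [hfx] at hx
    set p := b.symm (rePart _ x) with hp
    set q := b.symm (imPart _ x) with hq
    have h1 : (p : U) - Complex.I • (q : U) = 0 := by
      have h2 := congrArg j hx
      rw [map_add, map_smulₛₗ, (hR _).1 p.2, (hR _).1 q.2, Complex.conj_I, map_zero,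
        neg_smul, ← sub_eq_add_neg] at h2
      exact h2
    have h2 : (p : U) = 0 := by
      have h3 : (2 : ℂ) • (p : U) = 0 := by
        rw [two_smul]
        calc (p : U) + p = (p + Complex.I • (q : U)) + (p - Complex.I • (q : U)) := by abel
          _ = 0 := by rw [hx, h1, add_zero]
      exact (smul_eq_zero.1 h3).resolve_left two_ne_zero
    have h3 : (q : U) = 0 := by
      rw [h2, zero_add] at hx
      exact (smul_eq_zero.1 hx).resolve_left Complex.I_ne_zero
    rw [Submodule.coe_eq_zero] at h2 h3
    rw [hp, LinearEquiv.map_eq_zero_iff] at h2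
    rw [hq, LinearEquiv.map_eq_zero_iff] at h3
    rw [← tmul_re_add_im x, h2, h3, TensorProduct.tmul_zero, TensorProduct.tmul_zero, add_zero]
  -- The real and imaginary parts of `x` with respect to `j`.
  · have hp : (2⁻¹ : ℂ) • (x + j x) ∈ R := by
      rw [hR, map_smulₛₗ, map_add, hj, map_inv₀, map_ofNat, add_comm]
    have hq : ((2⁻¹ : ℂ) * -Complex.I) • (x - j x) ∈ R := by
      rw [hR, map_smulₛₗ, map_sub, hj, map_mul, map_neg, Complex.conj_I, map_inv₀, map_ofNat,
        neg_neg, mul_neg, neg_smul, ← smul_neg, neg_sub]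
    refine ⟨1 ⊗ₜ b ⟨_, hp⟩ + Complex.I ⊗ₜ b ⟨_, hq⟩, ?_⟩
    rw [map_add, hf, hf, b.symm_apply_apply, b.symm_apply_apply, one_smul, smul_smul]
    have : Complex.I * (2⁻¹ * -Complex.I) = (2⁻¹ : ℂ) := by
      linear_combination (-2⁻¹ : ℂ) * Complex.I_mul_I
    rw [this, ← smul_add, add_add_sub_cancel, ← two_smul ℂ, smul_smul, inv_mul_cancel₀ two_ne_zero,
      one_smul]

variable [Finite G]

/-- There is an equivariant projection to a subrepresentation. -/
lemma exists_equivariant_projection {E : Type*} [AddCommGroup E] [Module ℂ E]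
    {π : Representation ℂ G E} (S : Subrepresentation π) :
    ∃ p : E →ₗ[ℂ] S.toSubmodule, (∀ g x, p (π g x) = S.toRepresentation g (p x)) ∧
      ∀ x : S.toSubmodule, p x = x := by
  have := Fintype.ofFinite G
  obtain ⟨q, hq⟩ := LinearMap.exists_leftInverse_of_injective S.toSubmodule.subtype
    (Submodule.ker_subtype _)
  have hG : (Fintype.card G : ℂ) ≠ 0 := Nat.cast_ne_zero.2 Fintype.card_ne_zero
  refine ⟨(Fintype.card G : ℂ)⁻¹ • sumConj π S.toRepresentation q, fun g x => ?_, fun x => ?_⟩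
  · rw [LinearMap.smul_apply, sumConj_equivariant, LinearMap.smul_apply, map_smul]
  · rw [LinearMap.smul_apply, sumConj_apply]
    have h1 : ∀ g, S.toRepresentation g (q (π g⁻¹ x)) = x := fun g => by
      have h2 : q (π g⁻¹ x) = S.toRepresentation g⁻¹ x :=
        LinearMap.congr_fun hq (S.toRepresentation g⁻¹ x)
      rw [h2, ← Module.End.mul_apply, ← map_mul, mul_inv_cancel, map_one, Module.End.one_apply]
    rw [Finset.sum_congr rfl fun g _ => h1 g, Finset.sum_const, Finset.card_univ,
      ← Nat.cast_smul_eq_nsmul ℂ, smul_smul, inv_mul_cancel₀ hG, one_smul]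

/-- An isomorphism of constituents extends, by an equivariant projection, to a map between the
complexifications. The real and imaginary parts of its restriction to `W` are intertwiners from `W`
to `W'`, hence zero. -/
lemma isEmpty_equiv_of_isEmpty {W W' : Type*} [AddCommGroup W] [Module ℝ W] [AddCommGroup W']
    [Module ℝ W'] {σ : Representation ℝ G W} {σ' : Representation ℝ G W'} (hσ : σ.IsIrreducible)
    (hσ' : σ'.IsIrreducible) (h : IsEmpty (σ.Equiv σ')) (S : Subrepresentation (complexify σ))
    (S' : Subrepresentation (complexify σ')) (hS : S.toRepresentation.IsIrreducible) :
    IsEmpty (S.toRepresentation.Equiv S'.toRepresentation) := by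
  refine ⟨fun e => ?_⟩
  obtain ⟨p, hp, hp'⟩ := exists_equivariant_projection S
  let f : (ℂ ⊗[ℝ] W) →ₗ[ℂ] (ℂ ⊗[ℝ] W') :=
    S'.toSubmodule.subtype ∘ₗ e.toLinearMap ∘ₗ p
  have hf : ∀ g x, f (complexify σ g x) = complexify σ' g (f x) := fun g x => by
    change ((e (p (complexify σ g x)) : S'.toSubmodule) : ℂ ⊗[ℝ] W') = _
    rw [hp]
    exact congrArg Subtype.val (equiv_equivariant e g (p x))
  let ι : W →ₗ[ℝ] ℂ ⊗[ℝ] W := TensorProduct.mk ℝ ℂ W 1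
  have hι : ∀ g w, ι (σ g w) = complexify σ g (ι w) := fun g w => rfl
  have hzero : ∀ P : (ℂ ⊗[ℝ] W') →ₗ[ℝ] W', (∀ g x, P (complexify σ' g x) = σ' g (P x)) →
      ∀ w, P (f (ι w)) = 0 := by
    intro P hP w
    have h0 : P ∘ₗ f.restrictScalars ℝ ∘ₗ ι = 0 := by
      by_contra hne
      obtain ⟨e'⟩ := nonempty_equiv_of_ne_zero hσ hσ' (f := P ∘ₗ f.restrictScalars ℝ ∘ₗ ι)
        (fun g x => by
          simp only [LinearMap.comp_apply, LinearMap.coe_restrictScalars]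
          rw [hι, hf, hP]) hne
      exact h.false e'
    exact LinearMap.congr_fun h0 w
  have hf0 : f = 0 := by
    refine LinearMap.ext fun x => ?_
    have hw : ∀ w, f (ι w) = 0 := fun w => by
      rw [← tmul_re_add_im (f (ι w)), hzero _ (rePart_complexify σ') w,
        hzero _ (imPart_complexify σ') w, TensorProduct.tmul_zero, TensorProduct.tmul_zero, add_zero]
    have h1 : x = ι (rePart W x) + Complex.I • ι (imPart W x) := by
      conv_lhs => rw [← tmul_re_add_im x]
      congr 1
      rw [TensorProduct.mk_apply, TensorProduct.smul_tmul', smul_eq_mul, mul_one]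
    rw [h1, map_add, map_smul, hw, hw, smul_zero, add_zero, LinearMap.zero_apply]
  have := nontrivial_of_irreducible hS
  obtain ⟨x, hx⟩ := exists_ne (0 : S.toSubmodule)
  apply hx
  have h1 : f x = 0 := by rw [hf0, LinearMap.zero_apply]
  change ((e (p x) : S'.toSubmodule) : ℂ ⊗[ℝ] W') = 0 at h1
  rw [hp', Submodule.coe_eq_zero] at h1
  exact e.toLinearEquiv.map_eq_zero_iff.1 h1

variable {W : Type*} [AddCommGroup W] [Module ℝ W] [FiniteDimensional ℝ W]
  {σ : Representation ℝ G W} {S : Subrepresentation (complexify σ)}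

/-- A real character equals its conjugate, and by orthonormality irreducible representations with
the same character are isomorphic. -/
lemma nonempty_equiv_conjSub (hS : S.toRepresentation.IsIrreducible)
    (h : HasRealCharacter S.toRepresentation) :
    Nonempty (S.toRepresentation.Equiv (conjSub S).toRepresentation) := by
  have := Fintype.ofFinite G
  have hG : (Nat.card G : ℂ) ≠ 0 := Nat.cast_ne_zero.2 Nat.card_pos.ne'
  have := invertibleOfNonzero hG
  have := irreducible_conjSub hS
  have h1 := Representation.char_orthonormal S.toRepresentation S.toRepresentation
  have h2 := Representation.char_orthonormal (conjSub S).toRepresentation S.toRepresentation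
  have h3 : (conjSub S).toRepresentation.character = S.toRepresentation.character := by
    funext g
    rw [character_conjSub]
    exact Complex.conj_eq_iff_im.2 (h g)
  rw [h3, h1, if_pos ⟨Representation.Equiv.refl _⟩] at h2
  by_contra h4
  rw [if_neg h4] at h2
  exact one_ne_zero h2

/-- For an irreducible representation of quaternionic type, the invariant form is
antisymmetric. -/
lemma exists_antisymmetric_form (hS : S.toRepresentation.IsIrreducible)
    (hreal : ¬ IsRealizableOverReal S.toRepresentation)
    (e : S.toRepresentation.Equiv (conjSub S).toRepresentation) :
    ∃ B : S.toSubmodule →ₗ[ℂ] S.toSubmodule →ₗ[ℂ] ℂ, B ≠ 0 ∧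
      IsInvariantForm S.toRepresentation S.toRepresentation B ∧ ∀ x y, B x y = -B y x := by
  obtain ⟨b, hs, hinv, hpos⟩ := exists_invariant_form σ
  have he : ∀ g x, e (S.toRepresentation g x) = (conjSub S).toRepresentation g (e x) := fun g x =>
    equiv_equivariant e g x
  let B : S.toSubmodule →ₗ[ℂ] S.toSubmodule →ₗ[ℂ] ℂ :=
    b.compl₁₂ ((conjSub S).toSubmodule.subtype ∘ₗ e.toLinearMap) S.toSubmodule.subtype
  have hB : ∀ x y, B x y = b (e x).1 y.1 := fun x y => rfl
  have hBinv : IsInvariantForm S.toRepresentation S.toRepresentation B := fun g x y => by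
    rw [hB, hB, he]
    exact hinv g _ _
  -- Composing `e` with conjugation gives a conjugate-linear equivariant map of `S` to itself;
  -- positivity makes `B x (j x)` positive for nonzero `x`.
  let j : S.toSubmodule →ₛₗ[starRingEnd ℂ] S.toSubmodule :=
    ((conjEquiv S).symm : (conjSub S).toSubmodule →ₛₗ[starRingEnd ℂ] S.toSubmodule).comp
      e.toLinearMap
  have hj : ∀ x, j x = (conjEquiv S).symm (e x) := fun x => rfl
  have hje : ∀ x, (e x).1 = conjMap W (j x).1 := fun x => by
    rw [hj, coe_conjEquiv_symm, conjMap_conjMap]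
  have hjτ : ∀ g x, j (S.toRepresentation g x) = S.toRepresentation g (j x) := fun g x => by
    rw [hj, he, conjEquiv_symm_equivariant, hj]
  have hj0 : ∀ x, x ≠ 0 → j x ≠ 0 := fun x hx h => hx (by
    rw [hj, LinearEquiv.map_eq_zero_iff] at h
    exact e.toLinearEquiv.map_eq_zero_iff.1 h)
  have hBj : ∀ x, x ≠ 0 → ∃ c : ℝ, 0 < c ∧ B x (j x) = c := fun x hx => by
    rw [hB, hje]
    exact hpos _ fun h => hj0 x hx (Subtype.ext h)
  have := nontrivial_of_irreducible hS
  obtain ⟨x₀, hx₀⟩ := exists_ne (0 : S.toSubmodule)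
  have hB0 : B ≠ 0 := by
    obtain ⟨c, hc, h⟩ := hBj x₀ hx₀
    intro h0
    rw [h0, LinearMap.zero_apply, LinearMap.zero_apply] at h
    exact hc.ne (by exact_mod_cast h)
  refine ⟨B, hB0, hBinv, ?_⟩
  -- Invariant forms are unique up to a scalar, so the flipped form is `ε` times the form, and
  -- flipping twice gives `ε² = 1`.
  obtain ⟨ε, hε⟩ := hBinv.exists_smul hS hS hB0 hBinv.flip
  simp only [LinearMap.flip_apply] at hε
  have hε2 : ε * ε = 1 := by
    obtain ⟨c, hc, h⟩ := hBj x₀ hx₀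
    have h2 : B x₀ (j x₀) ≠ 0 := by
      rw [h]
      exact_mod_cast hc.ne'
    have h3 := hε (j x₀) x₀
    rw [hε x₀ (j x₀), ← mul_assoc] at h3
    exact mul_right_cancel₀ h2 (by rw [one_mul]; exact h3.symm)
  rcases mul_self_eq_one_iff.1 hε2 with h1 | h1
  swap
  · intro x y
    rw [hε y x, h1, neg_one_mul]
  exfalso
  have hsymm : ∀ x y, B x y = B y x := fun x y => by rw [hε y x, h1, one_mul]
  -- Symmetry has to be excluded. By Schur's lemma the square of `j` is a scalar `c`; symmetry shows
  -- that `c` is a quotient of two positive numbers, and `j` divided by the square root of `c` is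
  -- then a real structure.
  obtain ⟨c, hc⟩ := exists_smul_of_equivariant hS
    (f := (j.comp j : S.toSubmodule →ₗ[ℂ] S.toSubmodule)) fun g x => by
      change j (j (S.toRepresentation g x)) = S.toRepresentation g (j (j x))
      rw [hjτ, hjτ]
  have hc' : ∀ x, j (j x) = c • x := hc
  obtain ⟨a₁, ha₁, h₁⟩ := hpos x₀.1 fun h => hx₀ (Subtype.ext h)
  obtain ⟨a₂, ha₂, h₂⟩ := hBj x₀ hx₀
  have hcc : starRingEnd ℂ c * a₁ = a₂ := by
    rw [← h₂, hsymm, hB, hje, hc', ← h₁]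
    rw [Submodule.coe_smul, map_smulₛₗ, map_smul, LinearMap.smul_apply, smul_eq_mul]
  have hcr : c = ((a₂ / a₁ : ℝ) : ℂ) := by
    have : starRingEnd ℂ c = ((a₂ / a₁ : ℝ) : ℂ) := by
      rw [Complex.ofReal_div, eq_div_iff (by exact_mod_cast ha₁.ne'), hcc]
    rw [← Complex.conj_conj c, this, Complex.conj_ofReal]
  have hpos' : 0 < a₂ / a₁ := div_pos ha₂ ha₁
  set s : ℝ := Real.sqrt (a₂ / a₁) with hs'
  have hss : s * s = a₂ / a₁ := Real.mul_self_sqrt hpos'.le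
  have hs0 : (s : ℂ) ≠ 0 := by exact_mod_cast (Real.sqrt_pos.2 hpos').ne'
  refine hreal (isRealizableOverReal_of_involution S.toRepresentation ((s : ℂ)⁻¹ • j)
    (fun x => ?_) fun g x => ?_)
  · rw [LinearMap.smul_apply, LinearMap.smul_apply, map_smulₛₗ, hc', map_inv₀, Complex.conj_ofReal,
      smul_smul, smul_smul, hcr, ← hss, Complex.ofReal_mul]
    have : (s : ℂ)⁻¹ * (s : ℂ)⁻¹ * (s * s) = 1 := by field_simp
    rw [this, one_smul]
  · rw [LinearMap.smul_apply, hjτ, LinearMap.smul_apply, map_smul]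

end Compare

/-! ### The complex irreducible constituents of `ℝ^k` -/

section Constituents

variable {G : Type*} [Group G]

/-- A complex irreducible constituent of a real irreducible representation. -/
lemma exists_irreducible_sub [Finite G] {W : Type*} [AddCommGroup W] [Module ℝ W]
    [FiniteDimensional ℝ W] {σ : Representation ℝ G W} {t : RepType} (h : HasType σ t) :
    ∃ S : Subrepresentation (complexify σ), S.toRepresentation.IsIrreducible ∧
      (t = .one → IsEmpty (S.toRepresentation.Equiv (conjSub S).toRepresentation)) ∧
      (t ≠ .two → IsCompl S.toSubmodule (conjSub S).toSubmodule) ∧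
      (t = .two → S.toSubmodule = ⊤) ∧
      (t = .three → Nonempty (S.toRepresentation.Equiv (conjSub S).toRepresentation) ∧
        ¬ IsRealizableOverReal S.toRepresentation) := by
  cases t
  · obtain ⟨S, h1, h2, h3⟩ := h
    rw [← toSubmodule_conjSub] at h2
    exact ⟨S, h1, fun _ => isEmpty_equiv_conjSub h3, fun _ => h2,
      fun h => RepType.noConfusion h, fun h => RepType.noConfusion h⟩
  · refine ⟨⊤, ?_, fun h => RepType.noConfusion h, fun h => absurd rfl h, fun _ => rfl,
      fun h => RepType.noConfusion h⟩
    exact irreducible_of_semilinearEquiv (π := complexify σ)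
      (Submodule.topEquiv (R := ℂ) (M := ℂ ⊗[ℝ] W)).symm (fun g x => rfl) h
  · obtain ⟨S, h1, h2, h3, h4⟩ := h
    rw [← toSubmodule_conjSub] at h2
    exact ⟨S, h1, fun h => RepType.noConfusion h, fun _ => h2, fun h => RepType.noConfusion h,
      fun _ => ⟨nonempty_equiv_conjSub h1 h3, h4⟩⟩

/-- An irreducible representation is dual to its complex conjugate. -/
lemma exists_conjugate_form [Finite G] {W : Type*} [AddCommGroup W] [Module ℝ W]
    [FiniteDimensional ℝ W] {σ : Representation ℝ G W} {S : Subrepresentation (complexify σ)}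
    (hS : S.toRepresentation.IsIrreducible) :
    ∃ B : S.toSubmodule →ₗ[ℂ] (conjSub S).toSubmodule →ₗ[ℂ] ℂ, B ≠ 0 ∧
      IsInvariantForm S.toRepresentation (conjSub S).toRepresentation B := by
  obtain ⟨b, hs, hinv, hpos⟩ := exists_invariant_form σ
  let B : S.toSubmodule →ₗ[ℂ] (conjSub S).toSubmodule →ₗ[ℂ] ℂ :=
    b.compl₁₂ S.toSubmodule.subtype (conjSub S).toSubmodule.subtype
  have hB : ∀ x y, B x y = b x.1 y.1 := fun _ _ => rfl
  refine ⟨B, fun h0 => ?_, fun g x y => hinv g x.1 y.1⟩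
  have := nontrivial_of_irreducible hS
  obtain ⟨x, hx⟩ := exists_ne (0 : S.toSubmodule)
  obtain ⟨c, hc, hxc⟩ := hpos x.1 fun h => hx (Subtype.ext h)
  rw [hs, ← coe_conjEquiv, ← hB, h0, LinearMap.zero_apply, LinearMap.zero_apply] at hxc
  exact hc.ne (by exact_mod_cast hxc)

/-- The restriction of a symmetric form is symmetric; it is nonzero because `S` is everything and so
contains the conjugates of its vectors. -/
lemma exists_symmetric_form [Finite G] {W : Type*} [AddCommGroup W] [Module ℝ W]
    [FiniteDimensional ℝ W] {σ : Representation ℝ G W} {S : Subrepresentation (complexify σ)}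
    (hS : S.toRepresentation.IsIrreducible) (htop : S.toSubmodule = ⊤) :
    ∃ B : S.toSubmodule →ₗ[ℂ] S.toSubmodule →ₗ[ℂ] ℂ, B ≠ 0 ∧
      IsInvariantForm S.toRepresentation S.toRepresentation B ∧ ∀ x y, B x y = B y x := by
  obtain ⟨b, hs, hinv, hpos⟩ := exists_invariant_form σ
  let B : S.toSubmodule →ₗ[ℂ] S.toSubmodule →ₗ[ℂ] ℂ :=
    b.compl₁₂ S.toSubmodule.subtype S.toSubmodule.subtype
  have hB : ∀ x y, B x y = b x.1 y.1 := fun _ _ => rfl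
  refine ⟨B, fun h0 => ?_, fun g x y => hinv g x.1 y.1, fun x y => hs x.1 y.1⟩
  have := nontrivial_of_irreducible hS
  obtain ⟨x, hx⟩ := exists_ne (0 : S.toSubmodule)
  obtain ⟨c, hc, hxc⟩ := hpos x.1 fun h => hx (Subtype.ext h)
  have hmem : conjMap W x.1 ∈ S.toSubmodule := htop.ge Submodule.mem_top
  have h1 := hB ⟨_, hmem⟩ x
  rw [hxc, h0, LinearMap.zero_apply, LinearMap.zero_apply] at h1
  exact hc.ne (by exact_mod_cast h1)

variable {k : ℕ} {ρ : G →* Matrix.orthogonalGroup (Fin k) ℝ}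

lemma exists_real_embeddings {r : ℕ} {W : Fin (r + 1) → Type*} [∀ i, AddCommGroup (W i)]
    [∀ i, Module ℝ (W i)] [∀ i, FiniteDimensional ℝ (W i)] {σ : ∀ i, Representation ℝ G (W i)}
    {n : Fin (r + 1) → ℕ} {V : Fin (r + 1) → Subrepresentation (realRep ρ)}
    (hV : IsIsotypicDecomposition (realRep ρ) σ n V) :
    ∃ T : ∀ i, Fin (n i) → W i →ₗ[ℝ] (Fin k → ℝ),
      (∀ i h g w, T i h (σ i g w) = realRep ρ g (T i h w)) ∧
      ⊤ ≤ ⨆ i, ⨆ h, LinearMap.range (T i h) ∧ ∑ i, n i * Module.finrank ℝ (W i) = k := by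
  let e := fun i => (hV.component i).some
  let T : ∀ i, Fin (n i) → W i →ₗ[ℝ] (Fin k → ℝ) := fun i h =>
    (V i).toSubmodule.subtype ∘ₗ (e i).toLinearEquiv.symm.toLinearMap ∘ₗ
      DirectSum.lof ℝ (Fin (n i)) (fun _ => W i) h
  have hT : ∀ i h w, T i h w =
    ((e i).symm (DirectSum.lof ℝ (Fin (n i)) (fun _ => W i) h w) : Fin k → ℝ) := fun _ _ _ => rfl
  refine ⟨T, fun i h g w => ?_, ?_, ?_⟩
  · have h1 : DirectSum.lof ℝ (Fin (n i)) (fun _ => W i) h (σ i g w) =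
        Representation.directSum (fun _ : Fin (n i) => σ i) g
          (DirectSum.lof ℝ (Fin (n i)) (fun _ => W i) h w) := by
      change _ = DirectSum.lmap (fun _ => σ i g) _
      rw [DirectSum.lmap_lof]
    rw [hT, h1, equiv_equivariant]
    rfl
  · rw [← hV.isInternal.submodule_iSup_eq_top]
    refine iSup_le fun i x hx => ?_
    refine (le_iSup (fun i => ⨆ h, LinearMap.range (T i h)) i) ?_
    have key : ∀ y : DirectSum (Fin (n i)) fun _ => W i,
        ((e i).symm y : Fin k → ℝ) ∈ ⨆ h, LinearMap.range (T i h) := by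
      intro y
      induction y using DirectSum.induction_on with
      | zero =>
        rw [map_zero]
        exact Submodule.zero_mem _
      | of h w => exact (le_iSup (fun h => LinearMap.range (T i h)) h) ⟨w, hT i h w⟩
      | add y z hy hz =>
        rw [map_add]
        exact Submodule.add_mem _ hy hz
    have h2 := key (e i ⟨x, hx⟩)
    rwa [Representation.Equiv.symm_apply_apply] at h2
  · have h1 := (LinearEquiv.ofBijective (DirectSum.coeLinearMap fun i => (V i).toSubmodule)
      hV.isInternal).finrank_eq
    rw [Module.finrank_directSum, Module.finrank_fin_fun] at h1
    rw [← h1]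
    refine Finset.sum_congr rfl fun i _ => ?_
    have h2 := (e i).toLinearEquiv.finrank_eq
    rw [Module.finrank_directSum, Finset.sum_const, Finset.card_univ, Fintype.card_fin,
      smul_eq_mul] at h2
    exact h2.symm

/-- The inclusion of `ℝ^k` in `ℂ^k`. -/
def ofRealVec (k : ℕ) : (Fin k → ℝ) →ₗ[ℝ] (Fin k → ℂ) :=
  Complex.ofRealAm.toLinearMap.compLeft (Fin k)

lemma ofRealVec_apply (v : Fin k → ℝ) (i : Fin k) : ofRealVec k v i = (v i : ℂ) := rfl

/-- The complexification of a linear map to `ℝ^k`. -/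
def complexEmb {W : Type*} [AddCommGroup W] [Module ℝ W] (T : W →ₗ[ℝ] (Fin k → ℝ)) :
    (ℂ ⊗[ℝ] W) →ₗ[ℂ] (Fin k → ℂ) := (ofRealVec k ∘ₗ T).liftBaseChange ℂ

lemma complexEmb_tmul {W : Type*} [AddCommGroup W] [Module ℝ W] (T : W →ₗ[ℝ] (Fin k → ℝ)) (z : ℂ)
    (w : W) : complexEmb T (z ⊗ₜ w) = z • ofRealVec k (T w) := rfl

lemma complexEmb_equivariant {W : Type*} [AddCommGroup W] [Module ℝ W] {σ : Representation ℝ G W}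
    {T : W →ₗ[ℝ] (Fin k → ℝ)} (hT : ∀ g w, T (σ g w) = realRep ρ g (T w)) (g : G)
    (x : ℂ ⊗[ℝ] W) : complexEmb T (complexify σ g x) = complexMat ρ g *ᵥ complexEmb T x := by
  induction x using TensorProduct.induction_on with
  | zero => simp
  | tmul z w =>
    rw [complexify_tmul, complexEmb_tmul, complexEmb_tmul, hT, Matrix.mulVec_smul]
    congr 1
    ext i
    rw [ofRealVec_apply]
    exact RingHom.map_mulVec Complex.ofRealHom (ρ g : Matrix (Fin k) (Fin k) ℝ) (T w) i
  | add x y hx hy => simp only [map_add, hx, hy, Matrix.mulVec_add]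

/-- The real vectors in the complex subspace `N` form a real subspace containing every range, hence
all of `ℝ^k`, and in particular the standard basis. -/
lemma top_le_iSup_complexEmb {r : ℕ} {W : Fin (r + 1) → Type*} [∀ i, AddCommGroup (W i)]
    [∀ i, Module ℝ (W i)] {n : Fin (r + 1) → ℕ} {T : ∀ i, Fin (n i) → W i →ₗ[ℝ] (Fin k → ℝ)}
    (hT : ⊤ ≤ ⨆ i, ⨆ h, LinearMap.range (T i h)) {N : Submodule ℂ (Fin k → ℂ)}
    (hN : ∀ i h, LinearMap.range (complexEmb (T i h)) ≤ N) : N = ⊤ := by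
  have h1 : ⊤ ≤ (N.restrictScalars ℝ).comap (ofRealVec k) := by
    refine hT.trans (iSup_le fun i => iSup_le fun h => ?_)
    rintro _ ⟨w, rfl⟩
    refine hN i h ⟨1 ⊗ₜ w, ?_⟩
    rw [complexEmb_tmul, one_smul]
  rw [eq_top_iff]
  intro y _
  rw [pi_eq_sum_univ' y]
  refine Submodule.sum_mem _ fun i _ => Submodule.smul_mem _ _ ?_
  have h2 : ofRealVec k (Pi.single i 1) ∈ N := h1 Submodule.mem_top
  convert h2 using 1
  ext j
  rw [ofRealVec_apply]
  by_cases h : j = i <;> simp [h]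

/-! ### Embeddings of a constituent in `ℂ^k` -/

section Multiplicity

variable {W : Type*} [AddCommGroup W] [Module ℝ W] {σ : Representation ℝ G W}
  (S : Subrepresentation (complexify σ)) {n : ℕ} {T : Fin n → (ℂ ⊗[ℝ] W) →ₗ[ℂ] (Fin k → ℂ)}

/-- In type 3 the conjugate of `S` is isomorphic to `S`, so each copy of `W` contains `S` twice;
this is why the multiplicity is `2 * n`. -/
lemma exists_embeddings (hT : ∀ h g x, T h (complexify σ g x) = complexMat ρ g *ᵥ T h x)
    (t : RepType)
    (h3 : t = .three → Nonempty (S.toRepresentation.Equiv (conjSub S).toRepresentation)) :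
    ∃ T₁ : Fin (t.half n) → S.toSubmodule →ₗ[ℂ] (Fin k → ℂ),
      (∀ μ g x, T₁ μ (S.toRepresentation g x) = complexMat ρ g *ᵥ T₁ μ x) ∧
      (∀ h, S.toSubmodule.map (T h) ≤ ⨆ μ, LinearMap.range (T₁ μ)) ∧
      (t = .three → ∀ h, (conjSub S).toSubmodule.map (T h) ≤ ⨆ μ, LinearMap.range (T₁ μ)) := by
  have hgen : ∃ T₁ : Fin n → S.toSubmodule →ₗ[ℂ] (Fin k → ℂ),
      (∀ μ g x, T₁ μ (S.toRepresentation g x) = complexMat ρ g *ᵥ T₁ μ x) ∧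
      (∀ h, S.toSubmodule.map (T h) ≤ ⨆ μ, LinearMap.range (T₁ μ)) := by
    refine ⟨fun μ => T μ ∘ₗ S.toSubmodule.subtype, fun μ g x => hT μ g x, fun h => ?_⟩
    refine le_trans ?_ (le_iSup _ h)
    rintro _ ⟨x, hx, rfl⟩
    exact ⟨⟨x, hx⟩, rfl⟩
  cases t
  · obtain ⟨T₁, h1, h2⟩ := hgen
    exact ⟨T₁, h1, h2, fun h => RepType.noConfusion h⟩
  · obtain ⟨T₁, h1, h2⟩ := hgen
    exact ⟨T₁, h1, h2, fun h => RepType.noConfusion h⟩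
  · obtain ⟨e⟩ := h3 rfl
    let T₂ : Fin 2 × Fin n → S.toSubmodule →ₗ[ℂ] (Fin k → ℂ) := fun p =>
      if p.1 = 0 then T p.2 ∘ₗ S.toSubmodule.subtype
      else T p.2 ∘ₗ (conjSub S).toSubmodule.subtype ∘ₗ e.toLinearMap
    have h₀ : ∀ h x, T₂ (0, h) x = T h x.1 := fun h x => rfl
    have h₁ : ∀ h x, T₂ (1, h) x = T h (e x).1 := fun h x => rfl
    have hle : ∀ p, LinearMap.range (T₂ p) ≤
        ⨆ μ : Fin (2 * n), LinearMap.range (T₂ (finProdFinEquiv.symm μ)) := fun p => by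
      refine le_trans ?_ (le_iSup _ (finProdFinEquiv p))
      rw [Equiv.symm_apply_apply]
    have hT₂ : ∀ p g x, T₂ p (S.toRepresentation g x) = complexMat ρ g *ᵥ T₂ p x := by
      rintro ⟨p, h⟩ g x
      fin_cases p
      · exact hT h g x
      · change T₂ (1, h) _ = _ *ᵥ T₂ (1, h) x
        rw [h₁, h₁, equiv_equivariant]
        exact hT h g _
    refine ⟨fun μ => T₂ (finProdFinEquiv.symm μ), fun μ => hT₂ _, fun h => ?_, fun _ h => ?_⟩
    · refine le_trans ?_ (hle (0, h))
      rintro _ ⟨x, hx, rfl⟩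
      exact ⟨⟨x, hx⟩, rfl⟩
    · refine le_trans ?_ (hle (1, h))
      rintro _ ⟨x, hx, rfl⟩
      refine ⟨e.symm ⟨x, hx⟩, ?_⟩
      rw [h₁, Representation.Equiv.apply_symm_apply]

lemma exists_embeddings_conj
    (hT : ∀ h g x, T h (complexify σ g x) = complexMat ρ g *ᵥ T h x) (t : RepType) :
    ∃ T₁ : Fin (t.half n) → (conjSub S).toSubmodule →ₗ[ℂ] (Fin k → ℂ),
      (∀ μ g x, T₁ μ ((conjSub S).toRepresentation g x) = complexMat ρ g *ᵥ T₁ μ x) ∧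
      (t = .one → ∀ h, (conjSub S).toSubmodule.map (T h) ≤ ⨆ μ, LinearMap.range (T₁ μ)) := by
  by_cases ht : t = .one
  · obtain ⟨T₁, h1, h2, -⟩ := exists_embeddings (conjSub S) hT t
      fun h => RepType.noConfusion (h.symm.trans ht)
    exact ⟨T₁, h1, fun _ => h2⟩
  -- Outside type 1 there is no index for the conjugate, and zero maps serve as a default.
  · exact ⟨0, by simp, fun h => absurd h ht⟩

end Multiplicity

/-- The constituent with the given index. -/
def constituent {r : ℕ} {W : Fin (r + 1) → Type*} [∀ i, AddCommGroup (W i)]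
    [∀ i, Module ℝ (W i)] {σ : ∀ i, Representation ℝ G (W i)} {t : Fin (r + 1) → RepType}
    (S : ∀ i, Subrepresentation (complexify (σ i))) :
    ∀ a : CIdx t, Subrepresentation (complexify (σ a.base))
  | .inl i => S i
  | .inr i => conjSub (S i.1)

/-- The constituents are `S i` and, in type 1 only, its conjugate. Within one real representation
the two differ by their characters; across different ones, `isEmpty_equiv_of_isEmpty` applies. -/
theorem nonempty_splitReps.{u} [Finite G] {r : ℕ} {W : Fin (r + 1) → Type u} [∀ i, AddCommGroup (W i)]
    [∀ i, Module ℝ (W i)] [∀ i, FiniteDimensional ℝ (W i)] {σ : ∀ i, Representation ℝ G (W i)}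
    {n : Fin (r + 1) → ℕ} {V : Fin (r + 1) → Subrepresentation (realRep ρ)}
    (hV : IsIsotypicDecomposition (realRep ρ) σ n V) {t : Fin (r + 1) → RepType}
    (ht : ∀ i, HasType (σ i) (t i)) :
    Nonempty (SplitReps.{u} ρ t fun i => (t i).half (n i)) := by
  obtain ⟨T, hT, hspan, hdim⟩ := exists_real_embeddings hV
  choose S hirr h1 hcompl h2 h3 using fun i => exists_irreducible_sub (ht i)
  have hTc := fun i h => complexEmb_equivariant (hT i h)
  choose T₁ hT₁ hr₁ hr₃ using fun i => exists_embeddings (S i) (hTc i) (t i) fun h => (h3 i h).1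
  choose T₂ hT₂ hr₂ using fun i => exists_embeddings_conj (S i) (hTc i) (t i)
  have hfin : ∀ i, Module.finrank ℝ (W i) = Module.finrank ℂ (ℂ ⊗[ℝ] W i) := fun i =>
    (Module.finrank_baseChange (R := ℂ) (S := ℝ) (M' := W i)).symm
  have hfin' : ∀ i, t i ≠ .two →
      Module.finrank ℝ (W i) = 2 * Module.finrank ℂ (S i).toSubmodule := fun i hi => by
    rw [hfin, ← Submodule.finrank_add_eq_of_isCompl (hcompl i hi), finrank_conjSub, two_mul]
  let T' : ∀ a : CIdx t, Fin ((t a.base).half (n a.base)) →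
      (constituent S a).toSubmodule →ₗ[ℂ] (Fin k → ℂ) := fun a => match a with
    | .inl i => T₁ i
    | .inr i => T₂ i.1
  refine ⟨{
    U := fun a => (constituent S a).toSubmodule
    τ := fun a => (constituent S a).toRepresentation
    irreducible := ?_
    not_iso := ?_
    d := fun i => Module.finrank ℂ (S i).toSubmodule
    u := fun a => match a with
      | .inl i => Module.finBasis ℂ (S i).toSubmodule
      | .inr i => conjBasis (S i.1) (Module.finBasis ℂ (S i.1).toSubmodule)
    T := T'
    equivariant := ?_
    span_eq_top := ?_
    sum_eq := ?_
    form_one := ?_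
    form_two := ?_
    form_three := ?_ }⟩
  · rintro (i | i)
    · exact hirr i
    · exact irreducible_conjSub (hirr i.1)
  · intro a b hab
    by_cases hbase : a.base = b.base
    · rcases a with i | ⟨i, hi⟩ <;> rcases b with j | ⟨j, hj⟩ <;> obtain rfl : i = j := hbase
      · exact absurd rfl hab
      · exact h1 i hj
      · exact ⟨fun e => (h1 i hi).false e.symm⟩
      · exact absurd rfl hab
    · have hirr' : (constituent S a).toRepresentation.IsIrreducible := by
        rcases a with i | i
        · exact hirr i
        · exact irreducible_conjSub (hirr i.1)
      exact isEmpty_equiv_of_isEmpty (hV.irreducible _) (hV.irreducible _) (hV.not_iso _ _ hbase)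
        _ _ hirr'
  · rintro (i | i) μ g x
    · exact hT₁ i μ g x
    · exact hT₂ i.1 μ g x
  · refine (top_le_iSup_complexEmb hspan fun i h => ?_).ge
    have hle₁ : ⨆ μ, LinearMap.range (T₁ i μ) ≤ ⨆ a, ⨆ μ, LinearMap.range (T' a μ) :=
      le_iSup (fun a => ⨆ μ, LinearMap.range (T' a μ)) (.inl i)
    have hS := (hr₁ i h).trans hle₁
    rw [LinearMap.range_eq_map]
    by_cases hi : t i = .two
    · rwa [h2 i hi] at hS
    · rw [← (hcompl i hi).sup_eq_top, Submodule.map_sup]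
      refine sup_le hS ?_
      obtain h | h | h := (t i).eq_one_or
      · have hle₂ : ⨆ μ, LinearMap.range (T₂ i μ) ≤ ⨆ a, ⨆ μ, LinearMap.range (T' a μ) :=
          le_iSup (fun a => ⨆ μ, LinearMap.range (T' a μ)) (.inr ⟨i, h⟩)
        exact (hr₂ i h _).trans hle₂
      · exact absurd h hi
      · exact (hr₃ i h _).trans hle₁
  -- Each real representation contributes `n` times its dimension: in type 1 as two constituents of
  -- half the dimension, in type 2 as one of full dimension, in type 3 as one of half the dimension
  -- occurring `2 * n` times.
  · classical
    rw [Fintype.sum_sum_type]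
    have hsum : ∑ i : {i // t i = .one}, Module.finrank ℂ (S i.1).toSubmodule *
        (t i.1).half (n i.1) = ∑ i, if t i = .one then Module.finrank ℂ (S i).toSubmodule *
          (t i).half (n i) else 0 := by
      rw [← Finset.sum_filter]
      exact (Finset.sum_subtype (Finset.univ.filter fun i => t i = .one) (by simp) fun i =>
        Module.finrank ℂ (S i).toSubmodule * (t i).half (n i)).symm
    refine (congrArg _ hsum).trans (Eq.trans ?_ hdim)
    rw [← Finset.sum_add_distrib]
    refine Finset.sum_congr rfl fun i _ => ?_
    change Module.finrank ℂ (S i).toSubmodule * (t i).half (n i) + _ = _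
    obtain h | h | h := (t i).eq_one_or
    · rw [if_pos h, hfin' i (by rw [h]; exact RepType.noConfusion), h]
      change _ * n i + _ * n i = _
      ring
    · rw [if_neg (by rw [h]; exact RepType.noConfusion), hfin, h2 i h, finrank_top, h, add_zero]
      exact mul_comm _ _
    · rw [if_neg (by rw [h]; exact RepType.noConfusion),
        hfin' i (by rw [h]; exact RepType.noConfusion), h, add_zero]
      change _ * (2 * n i) = _
      ring
  · exact fun i _ => exists_conjugate_form (hirr i)
  · exact fun i h => exists_symmetric_form (hirr i) (h2 i h)
  · intro i h
    obtain ⟨⟨e⟩, hreal⟩ := h3 i h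
    exact exists_antisymmetric_form (hirr i) hreal e

end Constituents

end GLag

end

/-! ### Assembly of the theorem -/

theorem mainTheorem11 {G : Type*} [Group G] [Finite G] {k : ℕ}
    (ρ : G →* Matrix.orthogonalGroup (Fin k) ℝ)
    {r : ℕ} {W : Fin (r + 1) → Type*} [∀ i, AddCommGroup (W i)] [∀ i, Module ℝ (W i)]
    [∀ i, FiniteDimensional ℝ (W i)] (σ : ∀ i, Representation ℝ G (W i))
    (n : Fin (r + 1) → ℕ) (V : Fin (r + 1) → Subrepresentation (realRep ρ))
    (hV : IsIsotypicDecomposition (realRep ρ) σ n V)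
    (t : Fin (r + 1) → RepType) (ht : ∀ i, HasType (σ i) (t i)) :
    IsClosed[zariskiTopology (HalfGr k)] (closureSym ρ) ∧
    closureSym ρ = connectedComponentIn (invariantLagrangians ρ) (firstSummand k) ∧
    AreIsomorphic (closureSym ρ)
      (Set.univ.pi fun i => (t i).factor (n i) :
        Set (∀ i : Fin (r + 1), HalfGr ((t i).half (n i)))) ∧
    ∀ i, IsSmoothOfDim ((t i).factor (n i)) ((t i).dim (n i)) := by
  refine ⟨isClosed_zariski_closureSym ρ, closureSym_eq_connectedComponentIn ρ, ?_,
    fun i => isSmoothOfDim_factor _ _⟩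
  obtain ⟨D⟩ := nonempty_splitReps hV ht
  have h := D.toSplitBase.toSplitData.areIsomorphic
  simpa only [← RepType.factor_eq] using h
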